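/- **Setting.** Let $L<R$, $H\in\mathbb R$, and let $b:[L,R]\to\mathbb R$ be continuous and piecewise linear with $b(L)=b(R)$ and $b<H$. Put $\Omega=\{x\in\mathbb R^2: L<x_1<R,\ -H+b(x_1)<x_2<0\}$, with free surface $\Gamma_S=\{x_2=0\}$, bottom $\Gamma_N=\{x_2=-H+b(x_1)\}$ and periodic lateral boundaries $x_1=L$, $x_1=R$. Let $T>0$, $N\ge 1$, $\Delta t=T/N$, $t_n=n\Delta t$, $I_n=(t_n,t_{n+1})$. Let $\mathcal T$ be a finite conforming triangulation of $\overline\Omega$ (no hanging nodes) whose edges on $x_1=L$ and $x_1=R$ match; its space-time elements on slab $n$ are $\mathcal K=K\times I_n$, $K\in\mathcal T$, with lateral faces $F=e\times I_n$, $e$ an edge of $K$; $\boldsymbol n$ is the outward unit spatial normal. Fix an integer $p\ge 0$, $\alpha>0$, $f_n(t)=e^{-\alpha(t-t_n)}$, and a stabilization parameter $\tau>0$ (constant on each lateral face of each element). **Exact solution.** $(\boldsymbol q,v)$ satisfies $\partial_t\boldsymbol q=\nabla v$, $\nabla\cdot\boldsymbol q=0$ in $(0,T)\times\Omega$, $-\boldsymbol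 q\cdot\boldsymbol n=\partial_t v$ on $\Gamma_S$, $\boldsymbol q\cdot\boldsymbol n=0$ on $\Gamma_N$, with $v$ and $\boldsymbol q\cdot\boldsymbol n$ periodic, where $\boldsymbol q\in[H^1((0,T)\times\Omega)]^2$ and $v,\nabla v\in L^2((0,T)\times\Omega)$; boundary values, values on mesh faces and values of $\boldsymbol q$ at time levels are traces, and $v|_{\Gamma_S}$ is absolutely continuous in time. **Discrete spaces.** $W_h$: functions equal on each $\mathcal K$ to an element of $P_p(K)\otimes P_p(I_n)$; $\boldsymbol V_h=[W_h]^2$; $M_h$: functions on the lateral faces that lie in $Q_p(F)$ on each face $F$ and agree on faces identified by periodicity. $\widetilde W_h(\mathcal K)=P_{p-1}(K)\otimes P_p(I_n)$, $\widetilde{\boldsymbol V}_h(\mathcal K)=[\widetilde W_h(\mathcal K)]^2$ (with $P_{-1}=\{0\}$). Below, $(\cdot,\cdot)_{\mathcal T^n}=\sum_{K}\int_{\mathcal K}$; $\langle\cdot,\cdot\rangle_{\mathcal F_{\mathcal Q}^n}$ is the sum over all $K$ of integrals over the three lateral faces of $\mathcal K$; $\mathcal F_\Omega^n(t)$ stands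 for the triangles at time $t$; $\mathcal F_{\mathcal S}^n$ for the faces $e\times I_n$ with $e\subset\Gamma_S$; $\partial\mathcal E_{\mathcal S}^n(t)$ for the edges $e\subset\Gamma_S$ at time $t$. Norms are $L^2$ norms, and a subscript $f_n$ means with weight: $\|u\|_{f_n,D}^2=\int_D f_n|u|^2$. **Method.** For every $n=0,\dots,N-1$, $(\boldsymbol q_h,v_h,\lambda_h)\in\boldsymbol V_h\times W_h\times M_h$ on slab $n$ satisfies, for all $(\boldsymbol r,w,\mu)\in \boldsymbol V_h\times W_h\times M_h$, $$-(\boldsymbol q_h,f_n\partial_t\boldsymbol r)_{\mathcal T^n}-(\boldsymbol q_h,\boldsymbol r f_n')_{\mathcal T^n}+\langle\boldsymbol q_h,\boldsymbol r f_n\rangle_{\mathcal F_\Omega^n(t_{n+1})}+(v_h,f_n\nabla\cdot\boldsymbol r)_{\mathcal T^n}-\langle\lambda_h,\boldsymbol r\cdot\boldsymbol n f_n\rangle_{\mathcal F_{\mathcal Q}^n}=\langle\boldsymbol q_h^-,\boldsymbol r f_n\rangle_{\mathcal F_\Omega^n(t_n)},$$ $$-(w,f_n\nabla\cdot\boldsymbol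 q_h)_{\mathcal T^n}+\langle\tau(v_h-\lambda_h),wf_n\rangle_{\mathcal F_{\mathcal Q}^n}=0,$$ $$\langle\boldsymbol q_h\cdot\boldsymbol n-\tau(v_h-\lambda_h),\mu f_n\rangle_{\mathcal F_{\mathcal Q}^n}-\langle\lambda_h,f_n\partial_t\mu\rangle_{\mathcal F_{\mathcal S}^n}-\langle\lambda_h,\mu f_n'\rangle_{\mathcal F_{\mathcal S}^n}+\langle\lambda_h,\mu f_n\rangle_{\partial\mathcal E_{\mathcal S}^n(t_{n+1})}=\langle\lambda_h^-,\mu f_n\rangle_{\partial\mathcal E_{\mathcal S}^n(t_n)},$$ where $\boldsymbol q_h^-,\lambda_h^-$ are the values at $t_n$ of $\boldsymbol q_h,\lambda_h$ from slab $n-1$ if $n\ge1$, and $\boldsymbol q_h^-=\boldsymbol q(0,\cdot)$, $\lambda_h^-=v(0,\cdot)$ if $n=0$. **Projections.** On each $\mathcal K$, $(\boldsymbol{\Pi_V q},\Pi_W v)\in\boldsymbol V_h(\mathcal K)\times W_h(\mathcal K)$ is defined by $(\boldsymbol{\Pi_V q},\boldsymbol s f_n)_{\mathcal K}=(\boldsymbol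 q,\boldsymbol s f_n)_{\mathcal K}$ for $\boldsymbol s\in\widetilde{\boldsymbol V}_h(\mathcal K)$, $(\Pi_W v,zf_n)_{\mathcal K}=(v,zf_n)_{\mathcal K}$ for $z\in\widetilde W_h(\mathcal K)$, and $\langle\boldsymbol{\Pi_V q}\cdot\boldsymbol n-\tau\Pi_W v,\sigma f_n\rangle_F=\langle\boldsymbol q\cdot\boldsymbol n-\tau v,\sigma f_n\rangle_F$ for $\sigma\in Q_p(F)$ on each lateral face $F$ of $\mathcal K$. $P_M^{f_n}v$ is the $f_n$-weighted $L^2$-projection of $v$ onto $Q_p(F)$ on each lateral face. $\boldsymbol{\Pi_{V^-}q}$ and $P_{M^-}^{f_{n-1}}v$ are the same projections on slab $n-1$ if $n\ge1$; if $n=0$ they denote $\boldsymbol q(0,\cdot)$ and $v(0,\cdot)$. Put $\boldsymbol{\varepsilon}^{q}_h=\boldsymbol{\Pi_V q}-\boldsymbol q_h$, $\varepsilon^\lambda_h=P_M^{f_n}v-\lambda_h$, $\boldsymbol{\varepsilon}^{q-}_h=\boldsymbol{\Pi_{V^-}q}-\boldsymbol q_h^-$, $\varepsilon^{\lambda-}_h=P_{M^-}^{f_{n-1}}v-\lambda_h^-$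 (the last two vanish for $n=0$). **Claim.** There is a constant $C>0$, depending only on $p$, $\alpha$ and $T$ (in particular not on the mesh or $\Delta t$), such that in this setting, for every $n=0,\dots,N-1$, $$\begin{aligned} &\tfrac{\alpha}{2}\|\boldsymbol{\varepsilon}^q_h\|_{f_n,\mathcal T^n}^2+\tfrac{\alpha}{2}\|\varepsilon^\lambda_h\|_{f_n,\mathcal F_{\mathcal S}^n}^2+e^{-\alpha\Delta t}\|\boldsymbol{\varepsilon}^q_h\|^2_{\mathcal F_\Omega^n(t_{n+1})}+e^{-\alpha\Delta t}\|\varepsilon^\lambda_h\|^2_{\partial\mathcal E_{\mathcal S}^n(t_{n+1})}\\ &\le \|\boldsymbol{\varepsilon}^{q-}_h\|^2_{\mathcal F_\Omega^n(t_n)}+\|\varepsilon^{\lambda-}_h\|^2_{\partial\mathcal E_{\mathcal S}^n(t_n)}+C\Delta t^{-2}\|\boldsymbol q-\boldsymbol{\Pi_V q}\|^2_{f_n,\mathcal T^n}+C\|\boldsymbol{\Pi_V q}-\boldsymbol q\|^2_{f_n,\mathcal T^n}\\ &\quad+C\Delta t^{-1}\|\boldsymbol{\Pi_V q}-\boldsymbol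 q\|^2_{f_n,\mathcal F_\Omega^n(t_{n+1})}+C\Delta t^{-1}\|\boldsymbol{\Pi_{V^-}q}-\boldsymbol q\|^2_{f_n,\mathcal F_\Omega^n(t_n)}\\ &\quad+C\Delta t^{-1}\|P_M^{f_n}v-v\|^2_{f_n,\partial\mathcal E_{\mathcal S}^n(t_{n+1})}+C\Delta t^{-1}\|P_{M^-}^{f_{n-1}}v-v\|^2_{f_n,\partial\mathcal E_{\mathcal S}^n(t_n)}. \end{aligned}$$ -/

import Mathlib

open MeasureTheory Set Filter Topology
open scoped ContDiff

noncomputable section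

namespace FreeSurfaceHDG

/-- The spatial plane, with the Euclidean norm; the coordinates are `x 0`, `x 1`
(written `x₁`, `x₂` in the usual notation). -/
abbrev Plane : Type := EuclideanSpace ℝ (Fin 2)

/-- Space-time points `(t, x)`. -/
abbrev SpaceTime : Type := ℝ × Plane

/-! ### The flow domain -/

/-- Data of the flow domain `{-H + b(x₁) < x₂ < 0, L < x₁ < R}`, periodic in `x₁`, with a
continuous piecewise linear bottom. -/
structure FlowDomain where
  L : ℝ
  R : ℝ
  H : ℝ
  b : ℝ → ℝ
  L_lt_R : L < R
  b_continuous : ContinuousOn b (Icc L R)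
  b_piecewise_linear : ∃ S : Finset ℝ, ∀ x y, L ≤ x → x ≤ y → y ≤ R →
    (∀ s ∈ S, s ∉ Ioo x y) → ∃ m c : ℝ, ∀ z ∈ Icc x y, b z = m * z + c
  depth_pos : ∀ x ∈ Icc L R, -H + b x < 0
  b_periodic : b L = b R

namespace FlowDomain

variable (dom : FlowDomain)

/-- The spatial domain. -/
def Omega : Set Plane :=
  {x | dom.L < x 0 ∧ x 0 < dom.R ∧ -dom.H + dom.b (x 0) < x 1 ∧ x 1 < 0}

/-- The space-time domain `(0,T) × Ω`. -/
def spaceTime (T : ℝ) : Set SpaceTime := Ioo 0 T ×ˢ dom.Omega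

/-- The translation that identifies the left periodic boundary with the right one. -/
def shift : Plane := !₂[dom.R - dom.L, 0]

end FlowDomain

/-! ### Spatial triangulations -/

/-- A periodic conforming (face-to-face) triangulation of the flow domain: a finite pure
two-dimensional simplicial complex that fills the closed domain and whose edges on the two periodic
boundaries match. Simplices are given by their vertex sets. -/
structure SpatialMesh (dom : FlowDomain) where
  complex : Geometry.SimplicialComplex ℝ Plane
  finite : complex.faces.Finite
  pure : ∀ s ∈ complex.faces, ∃ K ∈ complex.faces, K.card = 3 ∧ s ⊆ K
  space_eq : complex.space = closure dom.Omega
  periodic_right : ∀ e ∈ complex.faces, e.card = 2 → (∀ x ∈ e, x 0 = dom.L) →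
    e.map (Equiv.addRight dom.shift).toEmbedding ∈ complex.faces
  periodic_left : ∀ e ∈ complex.faces, e.card = 2 → (∀ x ∈ e, x 0 = dom.R) →
    e.map (Equiv.addRight (-dom.shift)).toEmbedding ∈ complex.faces

namespace SpatialMesh

variable {dom : FlowDomain} (mesh : SpatialMesh dom)

/-- The triangles. -/
def elements : Finset (Finset Plane) := mesh.finite.toFinset.filter (fun s => s.card = 3)

/-- The edges. -/
def edges : Finset (Finset Plane) := mesh.finite.toFinset.filter (fun s => s.card = 2)

open Classical in
/-- The edges on the free surface `x₂ = 0`. -/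
def surfaceEdges : Finset (Finset Plane) := mesh.edges.filter (fun e => ∀ x ∈ e, x 1 = 0)

end SpatialMesh

/-- The three edges of a triangle. -/
def edgesOf (K : Finset Plane) : Finset (Finset Plane) := K.powersetCard 2

/-- `n` is the outward unit normal of the triangle `K` on its edge `e`. -/
def IsOutwardUnitNormal (K e : Finset Plane) (n : Plane) : Prop :=
  ‖n‖ = 1 ∧ (∀ a ∈ e, ∀ c ∈ e, inner ℝ n (c - a) = 0) ∧
    ∀ a ∈ e, ∀ c ∈ K, c ∉ e → inner ℝ n (c - a) < 0

/-- The outward unit normal of the triangle `K` on its edge `e`. -/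
def normal (K e : Finset Plane) : Plane := Classical.epsilon (IsOutwardUnitNormal K e)

/-! ### Measures -/

/-- Area measure on the triangle with vertex set `K`. -/
def area (K : Finset Plane) : Measure Plane := volume.restrict (convexHull ℝ (K : Set Plane))

/-- Length measure on the edge with vertex set `e`. -/
def arc (e : Finset Plane) : Measure Plane :=
  (Measure.hausdorffMeasure 1).restrict (convexHull ℝ (e : Set Plane))

/-- Lebesgue measure on the time interval `(a,b)`. -/
def during (a b : ℝ) : Measure ℝ := volume.restrict (Ioo a b)

/-- The measure that fixes the time `t`. -/
def atTime (t : ℝ) : Measure ℝ := Measure.dirac t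

/-! ### Differential operators -/

/-- Time derivative. -/
def dt {V : Type*} [NormedAddCommGroup V] [NormedSpace ℝ V] (u : SpaceTime → V) (z : SpaceTime) :
    V := deriv (fun s => u (s, z.2)) z.1

/-- Spatial divergence. -/
def divx (r : SpaceTime → Plane) (z : SpaceTime) : ℝ :=
  ∑ i : Fin 2, fderiv ℝ (fun y => r (z.1, y) i) z.2 (EuclideanSpace.single i 1)

/-- The spatial coordinate directions. -/
def spaceDir (i : Fin 2) : SpaceTime := (0, EuclideanSpace.single i 1)

/-- The three space-time coordinate directions; index `0` is time. -/
def allDir : Fin 3 → SpaceTime := Fin.cons (1, 0) spaceDir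

/-! ### Sobolev functions and their traces -/

/-- `g` is the weak derivative of `u` on `U` in the direction `d`. -/
def HasWeakDeriv (U : Set SpaceTime) (d : SpaceTime) (u g : SpaceTime → ℝ) : Prop :=
  ∀ φ : SpaceTime → ℝ, ContDiff ℝ ∞ φ → HasCompactSupport φ → tsupport φ ⊆ U →
    ∫ z in U, u z * fderiv ℝ φ z d = -∫ z in U, g z * φ z

/-- `u` lies in `L²(U)`, has weak derivatives `g i ∈ L²(U)` in the directions `d i`, and on each of
the surfaces (given by their surface measures in `S`) its pointwise values are those of its trace:
there are smooth functions on the whole space that converge to `u` in the Sobolev norm on `U` and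
whose restrictions to each surface converge to the values of `u` there in `L²`. Since the surfaces
are null sets, every Sobolev class on a Lipschitz domain has a representative of this kind. -/
structure IsSobolevWithTraces {ι : Type*} (U : Set SpaceTime) (d : ι → SpaceTime)
    (S : Set (Measure SpaceTime)) (u : SpaceTime → ℝ) (g : ι → SpaceTime → ℝ) : Prop where
  memLp : MemLp u 2 (volume.restrict U)
  memLp_deriv : ∀ i, MemLp (g i) 2 (volume.restrict U)
  weakDeriv : ∀ i, HasWeakDeriv U (d i) u (g i)
  memLp_trace : ∀ σ ∈ S, MemLp u 2 σ
  trace : ∃ φ : ℕ → SpaceTime → ℝ, (∀ k, ContDiff ℝ ∞ (φ k)) ∧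
    Tendsto (fun k => eLpNorm (fun z => φ k z - u z) 2 (volume.restrict U)) atTop (𝓝 0) ∧
    (∀ i, Tendsto (fun k => eLpNorm (fun z => fderiv ℝ (φ k) z (d i) - g i z) 2
      (volume.restrict U)) atTop (𝓝 0)) ∧
    ∀ σ ∈ S, Tendsto (fun k => eLpNorm (fun z => φ k z - u z) 2 σ) atTop (𝓝 0)

/-- The space-time faces `(0,T) × e`. -/
def lateralSurfaces {dom : FlowDomain} (mesh : SpatialMesh dom) (T : ℝ) :
    Set (Measure SpaceTime) := {σ | ∃ e ∈ mesh.edges, σ = (during 0 T).prod (arc e)}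

/-- The time levels `{t_n} × Ω` for `t_n = n T / N`, `0 ≤ n ≤ N`. -/
def timeSurfaces (dom : FlowDomain) (T : ℝ) (N : ℕ) : Set (Measure SpaceTime) :=
  {σ | ∃ n : ℕ, n ≤ N ∧ σ = (atTime (n * (T / N))).prod (volume.restrict dom.Omega)}

/-! ### The exact solution -/

/-- `(q, v)` solves the mixed form of the linear free-surface problem on `(0,T) × Ω`:
`∂ₜq = ∇v` and `∇·q = 0` in the domain, `-q·n = ∂ₜv` on the free surface (`n = (0,1)`),
`q·n = 0` on the bottom (`n` parallel to `(b', -1)`), and `v` and `q·n` are periodic. Here `q` is of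
class `H¹` in space-time, `v` and its spatial gradient are square integrable, and the values of `q`
and `v` on mesh faces, and of `q` on time levels, are their traces. -/
structure IsExactSolution {dom : FlowDomain} (mesh : SpatialMesh dom) (T : ℝ) (N : ℕ)
    (q : SpaceTime → Plane) (v : SpaceTime → ℝ) : Prop where
  equations : ∃ (Dv : Fin 2 → SpaceTime → ℝ) (Dq : Fin 2 → Fin 3 → SpaceTime → ℝ),
    IsSobolevWithTraces (dom.spaceTime T) spaceDir (lateralSurfaces mesh T) v Dv ∧
    (∀ i, IsSobolevWithTraces (dom.spaceTime T) allDir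
      (lateralSurfaces mesh T ∪ timeSurfaces dom T N) (fun z => q z i) (Dq i)) ∧
    (∀ i, ∀ᵐ z ∂(volume.restrict (dom.spaceTime T)), Dq i 0 z - Dv i z = 0) ∧
    (∀ᵐ z ∂(volume.restrict (dom.spaceTime T)), ∑ i : Fin 2, Dq i i.succ z = 0)
  freeSurface : ∀ᵐ s ∂(volume.restrict (Ioo dom.L dom.R)),
    AbsolutelyContinuousOnInterval (fun t => v (t, !₂[s, 0])) 0 T ∧
    ∀ᵐ t ∂(volume.restrict (Ioo 0 T)),
      HasDerivAt (fun t' => v (t', !₂[s, 0])) (-(q (t, !₂[s, 0]) 1)) t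
  bottom : ∀ᵐ w ∂((volume.restrict (Ioo 0 T)).prod (volume.restrict (Ioo dom.L dom.R))),
    deriv dom.b w.2 * q (w.1, !₂[w.2, -dom.H + dom.b w.2]) 0
      - q (w.1, !₂[w.2, -dom.H + dom.b w.2]) 1 = 0
  periodic : ∀ᵐ w ∂((volume.restrict (Ioo 0 T)).prod
      (volume.restrict (Ioo (-dom.H + dom.b dom.L) 0))),
    v (w.1, !₂[dom.L, w.2]) = v (w.1, !₂[dom.R, w.2]) ∧
    q (w.1, !₂[dom.L, w.2]) 0 = q (w.1, !₂[dom.R, w.2]) 0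

/-! ### Discrete spaces

Functions that are polynomial on an element or face are represented by functions on space-time, one
for each element or face; on an element the polynomial is taken on the whole of space-time. -/

/-- `P_p(K) ⊗ P_p(I)`. -/
def localW (p : ℕ) : Submodule ℝ (SpaceTime → ℝ) :=
  Submodule.span ℝ {w | ∃ (a : MvPolynomial (Fin 2) ℝ) (c : Polynomial ℝ),
    a.totalDegree ≤ p ∧ c.natDegree ≤ p ∧
    w = fun z => MvPolynomial.eval (fun i => z.2 i) a * c.eval z.1}

/-- `P_{p-1}(K) ⊗ P_p(I)`; it is `0` for `p = 0`. -/
def localWTilde (p : ℕ) : Submodule ℝ (SpaceTime → ℝ) :=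
  Submodule.span ℝ {w | ∃ (a : MvPolynomial (Fin 2) ℝ) (c : Polynomial ℝ),
    a.totalDegree < p ∧ c.natDegree ≤ p ∧
    w = fun z => MvPolynomial.eval (fun i => z.2 i) a * c.eval z.1}

/-- `[P_p(K) ⊗ P_p(I)]²`. -/
def localV (p : ℕ) : Set (SpaceTime → Plane) := {r | ∀ i, (fun z => r z i) ∈ localW p}

/-- `[P_{p-1}(K) ⊗ P_p(I)]²`. -/
def localVTilde (p : ℕ) : Set (SpaceTime → Plane) := {r | ∀ i, (fun z => r z i) ∈ localWTilde p}

/-- `Q_p` on the face over the edge `e`: polynomials of degree at most `p` in time and in the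
coordinate along `e`; values off `e` are arbitrary and never used. -/
def localM (p : ℕ) (e : Finset Plane) : Set (SpaceTime → ℝ) :=
  {μ | ∀ x ∈ e, ∀ y ∈ e, ∃ c : Fin (p + 1) → Fin (p + 1) → ℝ, ∀ t : ℝ, ∀ s ∈ Icc (0 : ℝ) 1,
    μ (t, AffineMap.lineMap x y s) = ∑ i, ∑ j, c i j * t ^ (i : ℕ) * s ^ (j : ℕ)}

section Global

variable {dom : FlowDomain} (mesh : SpatialMesh dom)

/-- The space `V_h`. -/
def spaceV (p : ℕ) : Set (Finset Plane → SpaceTime → Plane) :=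
  {r | ∀ K ∈ mesh.elements, r K ∈ localV p}

/-- The space `W_h`. -/
def spaceW (p : ℕ) : Set (Finset Plane → SpaceTime → ℝ) :=
  {w | ∀ K ∈ mesh.elements, w K ∈ localW p}

/-- The space `M_h`; faces that the periodicity identifies carry the same function. -/
def spaceM (p : ℕ) : Set (Finset Plane → SpaceTime → ℝ) :=
  {μ | (∀ e ∈ mesh.edges, μ e ∈ localM p e) ∧
    ∀ e ∈ mesh.edges, (∀ x ∈ e, x 0 = dom.L) → ∀ t : ℝ, ∀ x ∈ convexHull ℝ (e : Set Plane),
      μ (e.map (Equiv.addRight dom.shift).toEmbedding) (t, x + dom.shift) = μ e (t, x)}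

end Global

/-- The weight `exp(-α(t - s))`. -/
def weight (α s t : ℝ) : ℝ := Real.exp (-(α * (t - s)))

/-! ### The space-time HDG method on one slab -/

/-- `(qh, vh, lh)` solves the weighted space-time HDG scheme on the slab `(t₀,t₁) × Ω` with
stabilization `τ K e` and with values `qm`, `lm` from before, at time `t₀`. -/
structure IsHDGSolution {dom : FlowDomain} (mesh : SpatialMesh dom) (p : ℕ) (α : ℝ)
    (τ : Finset Plane → Finset Plane → ℝ) (t₀ t₁ : ℝ)
    (qm : Finset Plane → SpaceTime → Plane) (lm : Finset Plane → SpaceTime → ℝ)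
    (qh : Finset Plane → SpaceTime → Plane) (vh lh : Finset Plane → SpaceTime → ℝ) : Prop where
  mem_V : qh ∈ spaceV mesh p
  mem_W : vh ∈ spaceW mesh p
  mem_M : lh ∈ spaceM mesh p
  eq_q : ∀ r ∈ spaceV mesh p,
    -(∑ K ∈ mesh.elements, ∫ z, inner ℝ (qh K z) (weight α t₀ z.1 • dt (r K) z)
        ∂(during t₀ t₁).prod (area K))
    - (∑ K ∈ mesh.elements, ∫ z, inner ℝ (qh K z) (deriv (weight α t₀) z.1 • r K z)
        ∂(during t₀ t₁).prod (area K))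
    + (∑ K ∈ mesh.elements, ∫ z, inner ℝ (qh K z) (weight α t₀ z.1 • r K z)
        ∂(atTime t₁).prod (area K))
    + (∑ K ∈ mesh.elements, ∫ z, vh K z * (weight α t₀ z.1 * divx (r K) z)
        ∂(during t₀ t₁).prod (area K))
    - (∑ K ∈ mesh.elements, ∑ e ∈ edgesOf K,
        ∫ z, lh e z * (inner ℝ (r K z) (normal K e) * weight α t₀ z.1)
          ∂(during t₀ t₁).prod (arc e))
    = ∑ K ∈ mesh.elements, ∫ z, inner ℝ (qm K z) (weight α t₀ z.1 • r K z)
        ∂(atTime t₀).prod (area K)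
  eq_v : ∀ w ∈ spaceW mesh p,
    -(∑ K ∈ mesh.elements, ∫ z, w K z * (weight α t₀ z.1 * divx (qh K) z)
        ∂(during t₀ t₁).prod (area K))
    + (∑ K ∈ mesh.elements, ∑ e ∈ edgesOf K,
        ∫ z, τ K e * (vh K z - lh e z) * (w K z * weight α t₀ z.1)
          ∂(during t₀ t₁).prod (arc e)) = 0
  eq_l : ∀ μ ∈ spaceM mesh p,
    (∑ K ∈ mesh.elements, ∑ e ∈ edgesOf K,
        ∫ z, (inner ℝ (qh K z) (normal K e) - τ K e * (vh K z - lh e z))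
            * (μ e z * weight α t₀ z.1)
          ∂(during t₀ t₁).prod (arc e))
    - (∑ e ∈ mesh.surfaceEdges, ∫ z, lh e z * (weight α t₀ z.1 * dt (μ e) z)
        ∂(during t₀ t₁).prod (arc e))
    - (∑ e ∈ mesh.surfaceEdges, ∫ z, lh e z * (μ e z * deriv (weight α t₀) z.1)
        ∂(during t₀ t₁).prod (arc e))
    + (∑ e ∈ mesh.surfaceEdges, ∫ z, lh e z * (μ e z * weight α t₀ z.1)
        ∂(atTime t₁).prod (arc e))
    = ∑ e ∈ mesh.surfaceEdges, ∫ z, lm e z * (μ e z * weight α t₀ z.1)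
        ∂(atTime t₀).prod (arc e)

/-! ### Projections -/

/-- `(PV, PW) = Π_h(q, v)` on the space-time element `(t₀,t₁) × K`. -/
structure IsElementProjection (p : ℕ) (α : ℝ) (τ : Finset Plane → Finset Plane → ℝ) (t₀ t₁ : ℝ)
    (K : Finset Plane) (q : SpaceTime → Plane) (v : SpaceTime → ℝ)
    (PV : SpaceTime → Plane) (PW : SpaceTime → ℝ) : Prop where
  mem_V : PV ∈ localV p
  mem_W : PW ∈ localW p
  eq_V : ∀ s ∈ localVTilde p,
    ∫ z, inner ℝ (PV z) (weight α t₀ z.1 • s z) ∂(during t₀ t₁).prod (area K)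
      = ∫ z, inner ℝ (q z) (weight α t₀ z.1 • s z) ∂(during t₀ t₁).prod (area K)
  eq_W : ∀ w ∈ localWTilde p,
    ∫ z, PW z * (w z * weight α t₀ z.1) ∂(during t₀ t₁).prod (area K)
      = ∫ z, v z * (w z * weight α t₀ z.1) ∂(during t₀ t₁).prod (area K)
  eq_face : ∀ e ∈ edgesOf K, ∀ σ ∈ localM p e,
    ∫ z, (inner ℝ (PV z) (normal K e) - τ K e * PW z) * (σ z * weight α t₀ z.1)
        ∂(during t₀ t₁).prod (arc e)
      = ∫ z, (inner ℝ (q z) (normal K e) - τ K e * v z) * (σ z * weight α t₀ z.1)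
        ∂(during t₀ t₁).prod (arc e)

/-- `P` is the weighted `L²` projection of `v` onto `M_h` on the face `(t₀,t₁) × e`. -/
def IsFaceProjection (p : ℕ) (α t₀ t₁ : ℝ) (e : Finset Plane) (v P : SpaceTime → ℝ) : Prop :=
  P ∈ localM p e ∧ ∀ σ ∈ localM p e,
    ∫ z, P z * (σ z * weight α t₀ z.1) ∂(during t₀ t₁).prod (arc e)
      = ∫ z, v z * (σ z * weight α t₀ z.1) ∂(during t₀ t₁).prod (arc e)

/-! ### Norms -/

/-- Squared norm with weight `f`, summed over the triangles; `θ` is the measure in time. -/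
def sqNormElements {dom : FlowDomain} (mesh : SpatialMesh dom) (θ : Measure ℝ) (f : ℝ → ℝ)
    (u : Finset Plane → SpaceTime → Plane) : ℝ :=
  ∑ K ∈ mesh.elements, ∫ z, f z.1 * ‖u K z‖ ^ 2 ∂θ.prod (area K)

/-- Squared norm with weight `f`, summed over the free-surface edges; `θ` is the measure in time. -/
def sqNormSurface {dom : FlowDomain} (mesh : SpatialMesh dom) (θ : Measure ℝ) (f : ℝ → ℝ)
    (u : Finset Plane → SpaceTime → ℝ) : ℝ :=
  ∑ e ∈ mesh.surfaceEdges, ∫ z, f z.1 * u e z ^ 2 ∂θ.prod (arc e)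

/-- The object from the previous slab; on the first slab it is given by the initial data. -/
def previous {A : Type*} (init : A) (u : ℕ → A) : ℕ → A
  | 0 => init
  | n + 1 => u n

end FreeSurfaceHDG

end

/-!
The estimate is the energy argument for the weighted space-time HDG method, carried out on one time
slab. Write `E`, `W`, `M` for the differences between the projections of the exact solution and the
discrete solution.

* *Consistency.* The traces of the exact solution are `L²` limits of smooth functions, so the
  divergence theorem on a triangle (`integral_area_fderiv`) extends to Green formulas in space and
  in time (`green_space`, `green_time`), and the exact solution satisfies the first equation of the
  scheme on each element (`IsExactSolution.element_identity`). On the free surface the condition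
  `-q·n = ∂ₜv` is integrated by parts in time (`IsExactSolution.surface`).
* *Flux cancellation.* In the third equation the flux `q·n` is summed over the faces of all
  elements. It cancels between the two triangles at an interior edge, vanishes on the bottom and
  cancels between the two periodic boundaries, so only the free surface contributes
  (`SpatialMesh.sum_faces`, `IsExactSolution.sum_flux`). This rests on the fact that an edge with a
  triangle on one side only lies on the boundary (`SpatialMesh.notMem_Omega_of_one_sided`).
* *Error equations.* The projections are made so that `v` and the normal flux drop out, and the
  errors satisfy the scheme with a right-hand side in which only the time derivatives of the
  projection errors of `q`, and of `v` on the free surface, remain (`IsSlab.first_error`,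
  `IsSlab.second_error`, `IsSlab.third_error`). The face
  projections of `v` are given edge by edge; `periodize` carries those on the left boundary over to
  the right one, which gives a member of the global space `M_h`.
* *Energy.* With `E`, `W`, `M` as test functions the coupling terms cancel, the stabilization is
  nonnegative (`IsSlab.energy`), and the exponential weight turns the time derivative into the
  energy on the left-hand side (`cellForm_self_ge`).
* *Absorption.* The right-hand side is estimated by Young's inequality. Time derivatives and values
  at the two time levels of a polynomial in time are bounded by its weighted `L²` norm on the slab
  (`exists_inverse_prod`); rescaling to the unit interval shows that the constant depends on the
  degree, on `α` and on `T` only, and gives the powers of the time step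
  (`exists_cellForm_bounds`, `exists_slab_estimate`).
-/

noncomputable section

namespace FreeSurfaceHDG

/-! ### Measures on elements, faces and time levels -/

/-- A finite measure that is carried by a compact set. -/
structure CompactlyCarried {X : Type*} [TopologicalSpace X] [MeasurableSpace X]
    (σ : Measure X) : Prop where
  finite : IsFiniteMeasure σ
  carrier : ∃ S : Set X, IsCompact S ∧ ∀ᵐ x ∂σ, x ∈ S

theorem CompactlyCarried.memLp {X : Type*} [TopologicalSpace X] [MeasurableSpace X]
    [OpensMeasurableSpace X] [SecondCountableTopology X] {σ : Measure X} (hσ : CompactlyCarried σ)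
    {E : Type*} [NormedAddCommGroup E] [MeasurableSpace E] [BorelSpace E]
    [SecondCountableTopology E] {g : X → E} (hg : Continuous g) (r : ENNReal) : MemLp g r σ := by
  obtain ⟨S, hS, hae⟩ := hσ.carrier
  have := hσ.finite
  obtain ⟨c, hc⟩ := hS.exists_bound_of_continuousOn hg.continuousOn
  exact MemLp.of_bound hg.aestronglyMeasurable c (hae.mono hc)

theorem CompactlyCarried.integrable {X : Type*} [TopologicalSpace X] [MeasurableSpace X]
    [OpensMeasurableSpace X] [SecondCountableTopology X] {σ : Measure X} (hσ : CompactlyCarried σ)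
    {E : Type*} [NormedAddCommGroup E] [MeasurableSpace E] [BorelSpace E]
    [SecondCountableTopology E] {g : X → E} (hg : Continuous g) : Integrable g σ :=
  memLp_one_iff_integrable.1 (hσ.memLp hg 1)

theorem CompactlyCarried.prod {X Y : Type*} [TopologicalSpace X] [MeasurableSpace X]
    [TopologicalSpace Y] [MeasurableSpace Y] {σ : Measure X} {ρ : Measure Y}
    (hσ : CompactlyCarried σ) (hρ : CompactlyCarried ρ) : CompactlyCarried (σ.prod ρ) := by
  have := hσ.finite
  have := hρ.finite
  obtain ⟨S, hS, h1⟩ := hσ.carrier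
  obtain ⟨S', hS', h2⟩ := hρ.carrier
  refine ⟨inferInstance, S ×ˢ S', hS.prod hS', ?_⟩
  filter_upwards [Measure.quasiMeasurePreserving_fst.ae h1,
    Measure.quasiMeasurePreserving_snd.ae h2] with z h1 h2 using ⟨h1, h2⟩

theorem isCompact_hull (s : Finset Plane) : IsCompact (convexHull ℝ (s : Set Plane)) :=
  s.finite_toSet.isCompact_convexHull ℝ

theorem measurableSet_hull (s : Finset Plane) : MeasurableSet (convexHull ℝ (s : Set Plane)) :=
  (isCompact_hull s).measurableSet

theorem compactlyCarried_during (a b : ℝ) : CompactlyCarried (during a b) := by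
  refine ⟨⟨?_⟩, Icc a b, isCompact_Icc, ?_⟩
  · simp [during]
  · exact (ae_restrict_mem measurableSet_Ioo).mono fun x hx => Ioo_subset_Icc_self hx

theorem compactlyCarried_atTime (t : ℝ) : CompactlyCarried (atTime t) := by
  refine ⟨by unfold atTime; infer_instance, {t}, isCompact_singleton, ?_⟩
  simp [atTime]

theorem compactlyCarried_area (K : Finset Plane) : CompactlyCarried (area K) := by
  refine ⟨⟨?_⟩, _, isCompact_hull K, ae_restrict_mem (measurableSet_hull K)⟩
  simpa [area] using (isCompact_hull K).measure_lt_top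

/-- Length measure on the image of an interval under an affine parametrization. -/
theorem hausdorffMeasure_restrict_affine_image (c d : Plane) (hd : d ≠ 0) (u w : ℝ) :
    (Measure.hausdorffMeasure 1 : Measure Plane).restrict ((fun s : ℝ => c + s • d) '' Icc u w)
      = ENNReal.ofReal ‖d‖ • (volume.restrict (Icc u w)).map (fun s : ℝ => c + s • d) := by
  have hn : 0 < ‖d‖ := norm_pos_iff.2 hd
  set ψ : ℝ → Plane := fun s => c + s • (‖d‖⁻¹ • d) with hψ
  have hiso : Isometry ψ := by
    refine Isometry.of_dist_eq fun x y => ?_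
    simp only [hψ, dist_eq_norm, add_sub_add_left_eq_sub, ← sub_smul, norm_smul, norm_inv,
      norm_norm]
    rw [inv_mul_cancel₀ hn.ne', mul_one]
  have hmul : (fun s : ℝ => c + s • d) = ψ ∘ (fun s => ‖d‖ * s) := by
    funext s
    simp only [hψ, Function.comp, smul_smul]
    rw [mul_comm ‖d‖ s, mul_assoc, mul_inv_cancel₀ hn.ne', mul_one]
  have hmap : (volume : Measure ℝ).map (fun s : ℝ => c + s • d)
      = ENNReal.ofReal ‖d‖⁻¹ • (Measure.hausdorffMeasure 1 : Measure Plane).restrict (range ψ) := by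
    rw [hmul, ← Measure.map_map hiso.continuous.measurable (measurable_const_mul _),
      Real.map_volume_mul_left hn.ne', Measure.map_smul, ← hausdorffMeasure_real,
      hiso.map_hausdorffMeasure (Or.inl zero_le_one), abs_of_pos (inv_pos.2 hn)]
  have hinj : Function.Injective (fun s : ℝ => c + s • d) := by
    intro x y hxy
    simpa using smul_left_injective ℝ hd (add_left_cancel hxy)
  have hcont : Continuous (fun s : ℝ => c + s • d) := by fun_prop
  have hms : MeasurableSet ((fun s : ℝ => c + s • d) '' Icc u w) :=
    (isCompact_Icc.image hcont).measurableSet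
  have h1 : (volume.restrict (Icc u w)).map (fun s : ℝ => c + s • d)
      = ((volume : Measure ℝ).map (fun s : ℝ => c + s • d)).restrict
        ((fun s : ℝ => c + s • d) '' Icc u w) := by
    rw [Measure.restrict_map hcont.measurable hms, preimage_image_eq _ hinj]
  have hsub : (fun s : ℝ => c + s • d) '' Icc u w ⊆ range ψ := by
    rw [hmul]
    rintro _ ⟨s, _, rfl⟩
    exact ⟨_, rfl⟩
  rw [h1, hmap, Measure.restrict_smul, Measure.restrict_restrict hms, inter_eq_left.2 hsub,
    smul_smul, ← ENNReal.ofReal_mul hn.le, mul_inv_cancel₀ hn.ne', ENNReal.ofReal_one, one_smul]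

theorem hull_pair (a b : Plane) [DecidableEq Plane] :
    convexHull ℝ ((({a, b} : Finset Plane)) : Set Plane)
      = (fun s : ℝ => a + s • (b - a)) '' Icc 0 1 := by
  rw [Finset.coe_pair, convexHull_pair, segment_eq_image']

theorem arc_pair (a b : Plane) (hab : a ≠ b) [DecidableEq Plane] :
    arc {a, b} = ENNReal.ofReal ‖b - a‖ •
      (volume.restrict (Icc 0 1)).map (fun s : ℝ => a + s • (b - a)) := by
  rw [arc, hull_pair, hausdorffMeasure_restrict_affine_image _ _ (sub_ne_zero.2 hab.symm)]

theorem exists_pair {e : Finset Plane} (he : e.card = 2) [DecidableEq Plane] :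
    ∃ a b, a ≠ b ∧ e = {a, b} := Finset.card_eq_two.1 he

open Classical in
theorem compactlyCarried_arc {e : Finset Plane} (he : e.card = 2) : CompactlyCarried (arc e) := by
  obtain ⟨a, b, hab, rfl⟩ := exists_pair he
  refine ⟨⟨?_⟩, _, isCompact_hull _, ae_restrict_mem (measurableSet_hull _)⟩
  rw [arc, Measure.restrict_apply_univ, Finset.coe_pair, convexHull_pair, hausdorffMeasure_segment]
  exact edist_lt_top _ _

theorem integral_arc_pair (a b : Plane) (hab : a ≠ b) [DecidableEq Plane] (g : Plane → ℝ) :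
    ∫ x, g x ∂(arc {a, b}) = ‖b - a‖ * ∫ s in (0 : ℝ)..1, g (a + s • (b - a)) := by
  have hinj : Function.Injective (fun s : ℝ => a + s • (b - a)) := by
    intro x y hxy
    simpa using smul_left_injective ℝ (sub_ne_zero.2 hab.symm) (add_left_cancel hxy)
  have hcont : Continuous (fun s : ℝ => a + s • (b - a)) := by fun_prop
  rw [arc_pair a b hab, integral_smul_measure,
    (hcont.measurableEmbedding hinj).integral_map, intervalIntegral.integral_of_le zero_le_one,
    integral_Icc_eq_integral_Ioc, ENNReal.toReal_ofReal (norm_nonneg _), smul_eq_mul]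

theorem integral_atTime_prod {X : Type*} [MeasurableSpace X]
    (t : ℝ) (ρ : Measure X) [SFinite ρ] (g : ℝ × X → ℝ) :
    ∫ z, g z ∂((atTime t).prod ρ) = ∫ x, g (t, x) ∂ρ := by
  rw [atTime, Measure.dirac_prod, (measurableEmbedding_prodMk_left t).integral_map]

/-- Convergence in `L²` implies convergence of the integrals against an `L²` function. -/
theorem tendsto_integral_mul_of_eLpNorm {X : Type*} [MeasurableSpace X] {σ : Measure X}
    {u : X → ℝ} {φ : ℕ → X → ℝ} {h : X → ℝ} (hu : MemLp u 2 σ) (hφ : ∀ k, MemLp (φ k) 2 σ)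
    (hh : MemLp h 2 σ)
    (hlim : Tendsto (fun k => eLpNorm (fun z => φ k z - u z) 2 σ) atTop (𝓝 0)) :
    Tendsto (fun k => ∫ z, φ k z * h z ∂σ) atTop (𝓝 (∫ z, u z * h z ∂σ)) := by
  refine tendsto_integral_of_L1' (fun z => u z * h z) (hu.integrable_mul hh).1
    (Eventually.of_forall fun k => (hφ k).integrable_mul hh) ?_
  have hbound : ∀ k, eLpNorm ((fun z => φ k z * h z) - fun z => u z * h z) 1 σ
      ≤ eLpNorm (fun z => φ k z - u z) 2 σ * eLpNorm h 2 σ := by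
    intro k
    have := eLpNorm_smul_le_mul_eLpNorm (p := 2) (q := 2) (r := 1)
      (φ := fun z => φ k z - u z) (f := h) hh.1 ((hφ k).sub hu).1
    refine le_trans (le_of_eq ?_) this
    congr 1
    funext z
    simp [sub_mul]
  have h0 : Tendsto (fun k => eLpNorm (fun z => φ k z - u z) 2 σ * eLpNorm h 2 σ) atTop (𝓝 0) := by
    simpa using ENNReal.Tendsto.mul_const hlim (Or.inr hh.2.ne)
  exact tendsto_of_tendsto_of_tendsto_of_le_of_le tendsto_const_nhds h0 (fun _ => bot_le) hbound

/-! ### The divergence theorem on a triangle -/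

/-- The planar cross product. -/
def cross (u w : Plane) : ℝ := u 0 * w 1 - u 1 * w 0

theorem inner_plane (u w : Plane) : inner ℝ u w = u 0 * w 0 + u 1 * w 1 := by
  simp [PiLp.inner_apply, Fin.sum_univ_two, mul_comm]

theorem norm_sq_plane (u : Plane) : ‖u‖ ^ 2 = u 0 ^ 2 + u 1 ^ 2 := by
  rw [EuclideanSpace.real_norm_sq_eq, Fin.sum_univ_two]

theorem plane_ext {u w : Plane} (h0 : u 0 = w 0) (h1 : u 1 = w 1) : u = w := by
  ext i; fin_cases i <;> assumption

theorem cross_ne_zero_of_not_collinear {a b c : Plane} (h : ¬ Collinear ℝ {a, b, c}) :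
    cross (b - a) (c - a) ≠ 0 := by
  intro h0
  apply h
  by_cases hab : b = a
  · subst hab; simpa using collinear_pair ℝ b c
  rw [collinear_iff_of_mem (p₀ := a) (by simp)]
  refine ⟨b - a, ?_⟩
  have hpos : 0 < ‖b - a‖ ^ 2 := by
    have := norm_pos_iff.2 (sub_ne_zero.2 hab); positivity
  simp only [cross, PiLp.sub_apply] at h0
  have hn := norm_sq_plane (b - a)
  simp only [PiLp.sub_apply] at hn
  rintro p (rfl | rfl | rfl)
  · exact ⟨0, by simp⟩
  · exact ⟨1, by simp⟩
  · refine ⟨inner ℝ (b - a) (p - a) / ‖b - a‖ ^ 2, ?_⟩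
    rw [inner_plane]
    have k0 : (p 0 - a 0) * ‖b - a‖ ^ 2
        = ((b 0 - a 0) * (p 0 - a 0) + (b 1 - a 1) * (p 1 - a 1)) * (b 0 - a 0) := by
      rw [hn]; linear_combination -(b 1 - a 1) * h0
    have k1 : (p 1 - a 1) * ‖b - a‖ ^ 2
        = ((b 0 - a 0) * (p 0 - a 0) + (b 1 - a 1) * (p 1 - a 1)) * (b 1 - a 1) := by
      rw [hn]; linear_combination (b 0 - a 0) * h0
    refine plane_ext ?_ ?_ <;>
      simp only [vadd_eq_add, PiLp.add_apply, PiLp.smul_apply, PiLp.sub_apply, smul_eq_mul]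
    · rw [div_mul_eq_mul_div, ← k0, mul_div_cancel_right₀ _ hpos.ne']; ring
    · rw [div_mul_eq_mul_div, ← k1, mul_div_cancel_right₀ _ hpos.ne']; ring

open Classical in
theorem exists_triple {K : Finset Plane} (hK : K.card = 3)
    (hind : AffineIndependent ℝ ((↑) : K → Plane)) :
    ∃ a b c, a ≠ b ∧ a ≠ c ∧ b ≠ c ∧ K = {a, b, c} ∧ cross (b - a) (c - a) ≠ 0 := by
  obtain ⟨a, b, c, hab, hac, hbc, rfl⟩ := Finset.card_eq_three.1 hK
  refine ⟨a, b, c, hab, hac, hbc, rfl, cross_ne_zero_of_not_collinear ?_⟩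
  rw [← affineIndependent_iff_not_collinear_set]
  let f : Fin 3 → ({a, b, c} : Finset Plane) :=
    ![⟨a, by simp⟩, ⟨b, by simp⟩, ⟨c, by simp⟩]
  have hf : Function.Injective f := by
    intro i j hij
    have hba := hab.symm
    have hca := hac.symm
    have hcb := hbc.symm
    fin_cases i <;> fin_cases j <;> simp_all [f, Subtype.ext_iff]
  have h := hind.comp_embedding ⟨f, hf⟩
  have h2 : ((↑) : ({a, b, c} : Finset Plane) → Plane) ∘ f = ![a, b, c] := by
    funext i
    fin_cases i <;> rfl
  exact h2 ▸ h

theorem sum_edgesOf [DecidableEq Plane] {a b c : Plane} (hab : a ≠ b) (hac : a ≠ c) (hbc : b ≠ c)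
    (F : Finset Plane → ℝ) :
    ∑ e ∈ edgesOf {a, b, c}, F e = F {a, b} + F {a, c} + F {b, c} := by
  have h : edgesOf ({a, b, c} : Finset Plane) = {{a, b}, {a, c}, {b, c}} := by
    ext e
    simp only [edgesOf, Finset.mem_powersetCard, Finset.mem_insert, Finset.mem_singleton]
    constructor
    · rintro ⟨hsub, hcard⟩
      obtain ⟨x, y, hxy, rfl⟩ := exists_pair hcard
      have hx : x ∈ ({a, b, c} : Finset Plane) := hsub (by simp)
      have hy : y ∈ ({a, b, c} : Finset Plane) := hsub (by simp)
      simp only [Finset.mem_insert, Finset.mem_singleton] at hx hy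
      rcases hx with rfl | rfl | rfl <;> rcases hy with rfl | rfl | rfl <;>
        simp_all [Finset.pair_comm]
    · rintro (rfl | rfl | rfl)
      · exact ⟨by intro x; simp; tauto, Finset.card_pair hab⟩
      · exact ⟨by intro x; simp; tauto, Finset.card_pair hac⟩
      · exact ⟨by intro x; simp; tauto, Finset.card_pair hbc⟩
  have h1 : ({a, b} : Finset Plane) ≠ {a, c} := by
    intro h
    have : b ∈ ({a, c} : Finset Plane) := h ▸ (by simp)
    simp only [Finset.mem_insert, Finset.mem_singleton] at this
    rcases this with h | h
    · exact hab h.symm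
    · exact hbc h
  have h2 : ({a, b} : Finset Plane) ≠ {b, c} := by
    intro h
    have : a ∈ ({b, c} : Finset Plane) := h ▸ (by simp)
    simp only [Finset.mem_insert, Finset.mem_singleton] at this
    exact this.elim hab hac
  have h3 : ({a, c} : Finset Plane) ≠ {b, c} := by
    intro h
    have : a ∈ ({b, c} : Finset Plane) := h ▸ (by simp)
    simp only [Finset.mem_insert, Finset.mem_singleton] at this
    exact this.elim hab hac
  rw [h, Finset.sum_insert (by simp [h1, h2]), Finset.sum_insert (by simp [h3]),
    Finset.sum_singleton, add_assoc]

theorem hull_triple [DecidableEq Plane] (a b c : Plane) (hD : cross (b - a) (c - a) ≠ 0) (x y : ℝ) :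
    a + x • (b - a) + y • (c - a) ∈ convexHull ℝ (({a, b, c} : Finset Plane) : Set Plane)
      ↔ 0 ≤ x ∧ 0 ≤ y ∧ x + y ≤ 1 := by
  have hmem : ∀ z : Plane, z ∈ convexHull ℝ (({a, b, c} : Finset Plane) : Set Plane) ↔
      ∃ s t : ℝ, 0 ≤ s ∧ 0 ≤ t ∧ s + t ≤ 1 ∧ z = a + s • (b - a) + t • (c - a) := by
    intro z
    rw [Finset.coe_insert, Finset.coe_pair, convexHull_insert (by simp), convexHull_pair,
      mem_convexJoin]
    simp only [mem_singleton_iff, exists_eq_left, segment_eq_image', mem_image]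
    constructor
    · rintro ⟨_, ⟨r, hr, rfl⟩, s, hs, rfl⟩
      refine ⟨s * (1 - r), s * r, mul_nonneg hs.1 (by linarith [hr.2]), mul_nonneg hs.1 hr.1,
        by linarith [hs.2], ?_⟩
      module
    · rintro ⟨s, t, hs, ht, hst, rfl⟩
      rcases (add_nonneg hs ht).eq_or_lt with h | h
      · obtain rfl : s = 0 := by linarith
        obtain rfl : t = 0 := by linarith
        exact ⟨b, ⟨0, by simp, by simp⟩, 0, by simp, by simp⟩
      · refine ⟨_, ⟨t / (s + t), ⟨by positivity, (div_le_one h).2 (by linarith)⟩, rfl⟩, s + t,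
          ⟨h.le, hst⟩, ?_⟩
        have h1 : (s + t) • (b + (t / (s + t)) • (c - b) - a)
            = (s + t) • (b - a) + ((s + t) * (t / (s + t))) • (c - b) := by module
        rw [h1, mul_div_cancel₀ _ h.ne']
        module
  rw [hmem]
  constructor
  · rintro ⟨s, t, hs, ht, hst, h⟩
    have e : ∀ i, x * (b i - a i) + y * (c i - a i) = s * (b i - a i) + t * (c i - a i) := by
      intro i
      have := congrArg (fun z : Plane => z i) h
      simp only [PiLp.add_apply, PiLp.smul_apply, PiLp.sub_apply, smul_eq_mul] at this
      linarith
    have e0 := e 0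
    have e1 := e 1
    simp only [cross, PiLp.sub_apply] at hD
    have hx : x = s := by
      apply mul_right_cancel₀ hD
      linear_combination (c 1 - a 1) * e0 - (c 0 - a 0) * e1
    have hy : y = t := by
      apply mul_right_cancel₀ hD
      linear_combination -(b 1 - a 1) * e0 + (b 0 - a 0) * e1
    subst hx hy
    exact ⟨hs, ht, hst⟩
  · rintro ⟨hx, hy, hxy⟩
    exact ⟨x, y, hx, hy, hxy, rfl⟩

/-- Integration over a triangle in barycentric coordinates. -/
theorem integral_area_triple [DecidableEq Plane] (a b c : Plane)
    (hD : cross (b - a) (c - a) ≠ 0) (g : Plane → ℝ) (hg : Continuous g) :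
    ∫ x, g x ∂(area {a, b, c}) = |cross (b - a) (c - a)| *
      ∫ y in (0 : ℝ)..1, ∫ x in (0 : ℝ)..(1 - y), g (a + x • (b - a) + y • (c - a)) := by
  set D := cross (b - a) (c - a) with hDdef
  set A : Matrix (Fin 2) (Fin 2) ℝ := !![(b - a) 0, (c - a) 0; (b - a) 1, (c - a) 1] with hA
  have hdet : A.det = D := by
    rw [hA, Matrix.det_fin_two_of, hDdef, cross]; ring
  set Φ : (Fin 2 → ℝ) → Plane := fun s => a + s 0 • (b - a) + s 1 • (c - a) with hΦ
  have hΦc : Continuous Φ := by fun_prop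
  have hcomp : Φ = (fun x => a + x) ∘ (WithLp.toLp 2) ∘ (Matrix.toLin' A) := by
    funext s
    refine plane_ext ?_ ?_ <;>
      simp [hΦ, hA, dotProduct, Fin.sum_univ_two] <;> ring
  have hinj : Function.Injective Φ := by
    intro s s' h
    have e : ∀ i, s 0 * (b i - a i) + s 1 * (c i - a i)
        = s' 0 * (b i - a i) + s' 1 * (c i - a i) := by
      intro i
      have := congrArg (fun z : Plane => z i) h
      simp only [hΦ, PiLp.add_apply, PiLp.smul_apply, PiLp.sub_apply, smul_eq_mul] at this
      linarith
    have e0 := e 0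
    have e1 := e 1
    simp only [hDdef, cross, PiLp.sub_apply] at hD
    ext i
    apply mul_right_cancel₀ hD
    fin_cases i
    · simp only [Fin.zero_eta]
      linear_combination (c 1 - a 1) * e0 - (c 0 - a 0) * e1
    · simp only [Fin.mk_one]
      linear_combination -(b 1 - a 1) * e0 + (b 0 - a 0) * e1
  have hmap : (volume : Measure (Fin 2 → ℝ)).map Φ = ENNReal.ofReal |D⁻¹| • volume := by
    have hlin : Measurable (Matrix.toLin' A) :=
      (LinearMap.continuous_of_finiteDimensional _).measurable
    rw [hcomp, ← Measure.map_map (measurable_const_add a)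
      ((PiLp.volume_preserving_toLp (Fin 2)).measurable.comp hlin),
      ← Measure.map_map (PiLp.volume_preserving_toLp (Fin 2)).measurable hlin,
      Real.map_matrix_volume_pi_eq_smul_volume_pi (by rw [hdet]; exact hD), Measure.map_smul,
      (PiLp.volume_preserving_toLp (Fin 2)).map_eq, Measure.map_smul, map_add_left_eq_self, hdet]
  have hvol : (volume : Measure Plane)
      = ENNReal.ofReal |D| • (volume : Measure (Fin 2 → ℝ)).map Φ := by
    rw [hmap, smul_smul, ← ENNReal.ofReal_mul (abs_nonneg _), ← abs_mul, mul_inv_cancel₀ hD]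
    simp
  set T : Set (ℝ × ℝ) := {z | 0 ≤ z.1 ∧ 0 ≤ z.2 ∧ z.1 + z.2 ≤ 1} with hT
  have hTc : IsCompact T := by
    refine (isCompact_Icc (a := ((0 : ℝ), (0 : ℝ))) (b := (1, 1))).of_isClosed_subset ?_ ?_
    · refine (isClosed_le continuous_const continuous_fst).inter
        ((isClosed_le continuous_const continuous_snd).inter
        (isClosed_le (continuous_fst.add continuous_snd) continuous_const))
    · rintro ⟨x, y⟩ ⟨h1, h2, h3⟩
      simp only at h1 h2 h3
      exact ⟨⟨h1, h2⟩, ⟨by simp; linarith, by simp; linarith⟩⟩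
  set G : ℝ × ℝ → ℝ := fun z => g (a + z.1 • (b - a) + z.2 • (c - a)) with hG
  have hGc : Continuous G := by fun_prop
  have hpre : Φ ⁻¹' (convexHull ℝ (({a, b, c} : Finset Plane) : Set Plane))
      = MeasurableEquiv.finTwoArrow ⁻¹' T := by
    ext s
    simp only [hΦ, mem_preimage]
    rw [hull_triple a b c hD]
    rfl
  have h1 : ∫ x, g x ∂(area {a, b, c}) = |D| * ∫ z in T, G z := by
    rw [area]
    conv_lhs => rw [hvol]
    rw [Measure.restrict_smul, integral_smul_measure, ENNReal.toReal_ofReal (abs_nonneg _),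
      Measure.restrict_map hΦc.measurable (measurableSet_hull _),
      (hΦc.measurableEmbedding hinj).integral_map, hpre, smul_eq_mul]
    congr 1
    exact (volume_preserving_finTwoArrow ℝ).setIntegral_preimage_emb
      MeasurableEquiv.finTwoArrow.measurableEmbedding G T
  rw [h1, ← integral_indicator hTc.measurableSet, Measure.volume_eq_prod, integral_prod_symm]
  swap
  · rw [integrable_indicator_iff hTc.measurableSet]
    exact hGc.continuousOn.integrableOn_compact hTc
  congr 1
  rw [intervalIntegral.integral_of_le zero_le_one, ← integral_Icc_eq_integral_Ioc,
    ← integral_indicator measurableSet_Icc]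
  congr 1
  funext y
  by_cases hy : y ∈ Icc (0 : ℝ) 1
  · rw [indicator_of_mem hy, intervalIntegral.integral_of_le (by linarith [hy.2]),
      ← integral_Icc_eq_integral_Ioc, ← integral_indicator measurableSet_Icc]
    congr 1
    funext x
    by_cases hx : x ∈ Icc 0 (1 - y)
    · rw [indicator_of_mem hx, indicator_of_mem]
      exact ⟨hx.1, hy.1, by simp; linarith [hx.2]⟩
    · rw [indicator_of_notMem hx, indicator_of_notMem]
      rintro ⟨h1, h2, h3⟩
      simp only at h1 h2 h3
      exact hx ⟨h1, by linarith⟩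
  · rw [indicator_of_notMem hy]
    rw [← integral_zero ℝ ℝ]
    congr 1
    funext x
    rw [indicator_of_notMem]
    rintro ⟨h1, h2, h3⟩
    simp only at h1 h2 h3
    exact hy ⟨h2, by linarith⟩

theorem integral_area_fderiv_side [DecidableEq Plane] (a b c : Plane)
    (hD : cross (b - a) (c - a) ≠ 0) (g : Plane → ℝ) (hg : ContDiff ℝ 1 g) :
    ∫ x, fderiv ℝ g x (b - a) ∂(area {a, b, c}) = |cross (b - a) (c - a)| *
      ((∫ y in (0 : ℝ)..1, g (b + y • (c - b))) - ∫ y in (0 : ℝ)..1, g (a + y • (c - a))) := by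
  have hc : Continuous fun x => fderiv ℝ g x (b - a) :=
    (hg.continuous_fderiv one_ne_zero).clm_apply continuous_const
  rw [integral_area_triple a b c hD _ hc]
  congr 1
  rw [← intervalIntegral.integral_sub
    (Continuous.intervalIntegrable (by have := hg.continuous; fun_prop) _ _)
    (Continuous.intervalIntegrable (by have := hg.continuous; fun_prop) _ _)]
  congr 1
  funext y
  have hder : ∀ x : ℝ, HasDerivAt (fun x : ℝ => g (a + x • (b - a) + y • (c - a)))
      (fderiv ℝ g (a + x • (b - a) + y • (c - a)) (b - a)) x := by
    intro x
    have h1 : HasDerivAt (fun x : ℝ => a + x • (b - a) + y • (c - a)) (b - a) x := by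
      simpa using (((hasDerivAt_id x).smul_const (b - a)).const_add a).add_const (y • (c - a))
    exact ((hg.differentiable one_ne_zero _).hasFDerivAt).comp_hasDerivAt x h1
  rw [intervalIntegral.integral_eq_sub_of_hasDerivAt (fun x _ => hder x)
    (Continuous.intervalIntegrable (by fun_prop) _ _)]
  congr 2
  · module
  · module

theorem isOutwardUnitNormal_pair [DecidableEq Plane] {a b c : Plane} (hbc : b ≠ c) (hac : a ≠ c)
    (hab : a ≠ b) {n : Plane} :
    IsOutwardUnitNormal {a, b, c} {b, c} n ↔
      ‖n‖ = 1 ∧ inner ℝ n (c - b) = 0 ∧ inner ℝ n (a - b) < 0 := by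
  unfold IsOutwardUnitNormal
  simp only [Finset.mem_insert, Finset.mem_singleton, forall_eq_or_imp, forall_eq, sub_self,
    inner_zero_right, true_and, and_true, not_or, not_true_eq_false, hab, hac,
    not_false_eq_true, forall_const, lt_self_iff_false, and_self]
  refine and_congr_right fun _ => ⟨fun h => ⟨h.1.1, ?_⟩, fun h => ⟨⟨h.1, ?_⟩, ?_⟩⟩
  · have := h.2
    simp_all
  · rw [← neg_sub, inner_neg_right, h.1, neg_zero]
  · have h2 : inner ℝ n (a - c) < 0 := by
      have : a - c = (a - b) - (c - b) := by abel
      rw [this, inner_sub_right, h.1, sub_zero]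
      exact h.2
    simp_all

/-- The outward unit normal exists, and its component along another side of the triangle is
determined by the area. -/
theorem normal_pair [DecidableEq Plane] {a b c : Plane} (hab : a ≠ b) (hac : a ≠ c) (hbc : b ≠ c)
    (hD : cross (b - a) (c - a) ≠ 0) :
    IsOutwardUnitNormal {a, b, c} {b, c} (normal {a, b, c} {b, c}) := by
  apply Classical.epsilon_spec (p := IsOutwardUnitNormal {a, b, c} {b, c})
  simp only [isOutwardUnitNormal_pair hbc hac hab]
  have hl : 0 < ‖c - b‖ := norm_pos_iff.2 (sub_ne_zero.2 hbc.symm)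
  have hl2 := norm_sq_plane (c - b)
  simp only [PiLp.sub_apply] at hl2
  have key : ∀ σ : ℝ, σ ^ 2 = 1 → σ * cross (b - a) (c - a) < 0 →
      ∃ n : Plane, ‖n‖ = 1 ∧ inner ℝ n (c - b) = 0 ∧ inner ℝ n (a - b) < 0 := by
    intro σ hσ hneg
    refine ⟨(σ / ‖c - b‖) • !₂[-(c 1 - b 1), c 0 - b 0], ?_, ?_, ?_⟩
    · rw [← sq_eq_sq₀ (norm_nonneg _) zero_le_one, norm_sq_plane]
      simp only [PiLp.smul_apply, smul_eq_mul, Matrix.cons_val_zero,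
        Matrix.cons_val_one]
      have : (σ / ‖c - b‖ * -(c 1 - b 1)) ^ 2 + (σ / ‖c - b‖ * (c 0 - b 0)) ^ 2
        = σ ^ 2 * (((c 0 - b 0) ^ 2 + (c 1 - b 1) ^ 2) / ‖c - b‖ ^ 2) := by ring
      rw [this, ← hl2, hσ, div_self (by positivity)]
      norm_num
    · rw [inner_plane]
      simp only [PiLp.smul_apply, smul_eq_mul, Matrix.cons_val_zero,
        Matrix.cons_val_one, PiLp.sub_apply]
      ring
    · rw [inner_plane]
      have : 0 < ‖c - b‖⁻¹ := by positivity
      have h3 : ‖c - b‖⁻¹ * (σ * cross (b - a) (c - a)) < 0 := mul_neg_of_pos_of_neg this hneg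
      simp only [cross, PiLp.smul_apply, smul_eq_mul, Matrix.cons_val_zero,
        Matrix.cons_val_one, PiLp.sub_apply] at h3 ⊢
      convert h3 using 1
      ring
  rcases lt_or_gt_of_ne hD with h | h
  · exact key 1 (by norm_num) (by linarith)
  · exact key (-1) (by norm_num) (by linarith)

theorem norm_mul_inner_normal [DecidableEq Plane] {a b c n : Plane} (hab : a ≠ b) (hac : a ≠ c)
    (hbc : b ≠ c) (hn : IsOutwardUnitNormal {a, b, c} {b, c} n) :
    ‖c - b‖ * inner ℝ n (b - a) = |cross (b - a) (c - a)| := by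
  rw [isOutwardUnitNormal_pair hbc hac hab] at hn
  obtain ⟨h1, h2, h3⟩ := hn
  have hpos : 0 < inner ℝ n (b - a) := by
    rw [← neg_sub, inner_neg_right]; linarith
  rw [← abs_of_nonneg (mul_nonneg (norm_nonneg _) hpos.le), ← sq_eq_sq_iff_abs_eq_abs, mul_pow,
    norm_sq_plane]
  have h4 : n 0 ^ 2 + n 1 ^ 2 = 1 := by rw [← norm_sq_plane, h1]; norm_num
  rw [inner_plane] at h2 ⊢
  simp only [cross, PiLp.sub_apply] at h2 ⊢
  -- both sides are the squared area of the parallelogram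
  have h5 : ((b 0 - a 0) * (c 1 - a 1) - (b 1 - a 1) * (c 0 - a 0))
      = (n 0 * (b 0 - a 0) + n 1 * (b 1 - a 1)) * (n 0 * (c 1 - b 1) - n 1 * (c 0 - b 0)) := by
    linear_combination (-((b 0 - a 0) * (c 1 - b 1)) + (b 1 - a 1) * (c 0 - b 0)) * h4
      + (n 1 * (b 0 - a 0) - n 0 * (b 1 - a 1)) * h2
  rw [h5]
  have h6 : (n 0 * (c 1 - b 1) - n 1 * (c 0 - b 0)) ^ 2
      = (c 0 - b 0) ^ 2 + (c 1 - b 1) ^ 2 := by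
    linear_combination ((c 0 - b 0) ^ 2 + (c 1 - b 1) ^ 2) * h4
      - (n 0 * (c 0 - b 0) + n 1 * (c 1 - b 1)) * h2
  rw [mul_pow, h6]
  ring

theorem normal_sides [DecidableEq Plane] {a b c : Plane} (hab : a ≠ b) (hac : a ≠ c) (hbc : b ≠ c)
    (hD : cross (b - a) (c - a) ≠ 0) {K : Finset Plane} (hK : K = {a, b, c}) :
    inner ℝ (normal K {a, b}) (b - a) = 0 ∧
    ‖c - b‖ * inner ℝ (normal K {b, c}) (b - a) = |cross (b - a) (c - a)| ∧
    ‖c - a‖ * inner ℝ (normal K {a, c}) (b - a) = -|cross (b - a) (c - a)| := by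
  have hK2 : K = {c, a, b} := by rw [hK]; ext x; simp; tauto
  have hK3 : K = {b, a, c} := by rw [hK]; ext x; simp; tauto
  have e2 : cross (a - c) (b - c) = cross (b - a) (c - a) := by
    simp only [cross, PiLp.sub_apply]; ring
  have e3 : cross (a - b) (c - b) = -cross (b - a) (c - a) := by
    simp only [cross, PiLp.sub_apply]; ring
  refine ⟨?_, ?_, ?_⟩
  · have h := normal_pair hac.symm hbc.symm hab (by rw [e2]; exact hD)
    rw [isOutwardUnitNormal_pair hab hbc.symm hac.symm] at h
    rw [hK2]
    exact h.2.1
  · rw [hK]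
    exact norm_mul_inner_normal hab hac hbc (normal_pair hab hac hbc hD)
  · rw [hK3]
    have h := norm_mul_inner_normal hab.symm hbc hac
      (normal_pair hab.symm hbc hac (by rw [e3]; exact neg_ne_zero.2 hD))
    rw [e3, abs_neg] at h
    rw [← h, ← neg_sub a b, inner_neg_right]
    ring

/-- The divergence theorem on a triangle, for one directional derivative. -/
theorem integral_area_fderiv {K : Finset Plane} (hK : K.card = 3)
    (hind : AffineIndependent ℝ ((↑) : K → Plane)) {g : Plane → ℝ} (hg : ContDiff ℝ 1 g)
    (d : Plane) :
    ∫ x, fderiv ℝ g x d ∂(area K)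
      = ∑ e ∈ edgesOf K, ∫ x, g x * inner ℝ (normal K e) d ∂(arc e) := by
  classical
  obtain ⟨a, b, c, hab, hac, hbc, hKe, hD⟩ := exists_triple hK hind
  -- it suffices to treat two sides of the triangle as directions
  have side : ∀ b c : Plane, a ≠ b → a ≠ c → b ≠ c → K = {a, b, c} →
      cross (b - a) (c - a) ≠ 0 → ∫ x, fderiv ℝ g x (b - a) ∂(area K)
      = ∑ e ∈ edgesOf K, ∫ x, g x * inner ℝ (normal K e) (b - a) ∂(arc e) := by
    intro b c hab hac hbc hKe hD
    obtain ⟨h1, h2, h3⟩ := normal_sides hab hac hbc hD hKe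
    simp only [integral_mul_const]
    have := sum_edgesOf hab hac hbc
      (fun e => (∫ x, g x ∂(arc e)) * inner ℝ (normal K e) (b - a))
    rw [← hKe] at this
    rw [this, h1, integral_arc_pair a c hac, integral_arc_pair b c hbc]
    have := integral_area_fderiv_side a b c hD g hg
    rw [← hKe] at this
    rw [this]
    linear_combination -(∫ s in (0 : ℝ)..1, g (a + s • (c - a))) * h3
      - (∫ s in (0 : ℝ)..1, g (b + s • (c - b))) * h2
  have hb := side b c hab hac hbc hKe hD
  have e3 : cross (c - a) (b - a) = -cross (b - a) (c - a) := by
    simp only [cross, PiLp.sub_apply]; ring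
  have hc := side c b hac hab hbc.symm (by rw [hKe]; ext x; simp; tauto)
    (by rw [e3]; exact neg_ne_zero.2 hD)
  have hd : d = (cross d (c - a) / cross (b - a) (c - a)) • (b - a)
      + (cross (b - a) d / cross (b - a) (c - a)) • (c - a) := by
    refine plane_ext ?_ ?_ <;>
    · simp only [PiLp.add_apply, PiLp.smul_apply, smul_eq_mul]
      rw [div_mul_eq_mul_div, div_mul_eq_mul_div, ← add_div, eq_div_iff hD]
      simp only [cross, PiLp.sub_apply]
      ring
  set x := cross d (c - a) / cross (b - a) (c - a)
  set y := cross (b - a) d / cross (b - a) (c - a)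
  have hi : ∀ w : Plane, Integrable (fun x => fderiv ℝ g x w) (area K) := fun w =>
    (compactlyCarried_area K).integrable
      ((hg.continuous_fderiv one_ne_zero).clm_apply continuous_const)
  rw [hd]
  simp only [map_add, map_smul, smul_eq_mul, inner_add_right, inner_smul_right]
  rw [integral_add ((hi _).const_mul _) ((hi _).const_mul _), integral_const_mul,
    integral_const_mul, hb, hc, Finset.mul_sum, Finset.mul_sum, ← Finset.sum_add_distrib]
  refine Finset.sum_congr rfl fun e he => ?_
  rw [integral_mul_const, integral_mul_const, integral_mul_const]
  ring

/-! ### Green's formulas in space-time -/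

theorem fderiv_slice {G : SpaceTime → ℝ} (hG : ContDiff ℝ 1 G) (t : ℝ) (x d : Plane) :
    fderiv ℝ (fun y => G (t, y)) x d = fderiv ℝ G (t, x) (0, d) := by
  have h1 : HasFDerivAt (fun y : Plane => (t, y)) (ContinuousLinearMap.inr ℝ ℝ Plane) x :=
    hasFDerivAt_prodMk_right t x
  have h := ((hG.differentiable one_ne_zero (t, x)).hasFDerivAt).comp x h1
  have h2 : fderiv ℝ (fun y => G (t, y)) x
      = (fderiv ℝ G (t, x)).comp (ContinuousLinearMap.inr ℝ ℝ Plane) := h.fderiv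
  rw [h2]
  rfl

theorem hasDerivAt_slice {G : SpaceTime → ℝ} (hG : ContDiff ℝ 1 G) (t : ℝ) (x : Plane) :
    HasDerivAt (fun s => G (s, x)) (fderiv ℝ G (t, x) (1, 0)) t := by
  have h1 : HasDerivAt (fun s : ℝ => (s, x)) ((1 : ℝ), (0 : Plane)) t :=
    (hasDerivAt_id t).prodMk (hasDerivAt_const t x)
  exact ((hG.differentiable one_ne_zero (t, x)).hasFDerivAt).comp_hasDerivAt t h1

theorem continuous_fderiv_apply {G : SpaceTime → ℝ} (hG : ContDiff ℝ 1 G) (d : SpaceTime) :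
    Continuous fun z => fderiv ℝ G z d :=
  (hG.continuous_fderiv one_ne_zero).clm_apply continuous_const

theorem card_of_mem_edgesOf {K e : Finset Plane} (he : e ∈ edgesOf K) : e.card = 2 :=
  (Finset.mem_powersetCard.1 he).2

theorem integral_fderiv_space {K : Finset Plane} (hK : K.card = 3)
    (hind : AffineIndependent ℝ ((↑) : K → Plane)) {θ : Measure ℝ} (hθ : CompactlyCarried θ)
    {G : SpaceTime → ℝ} (hG : ContDiff ℝ 1 G) (d : Plane) :
    ∫ z, fderiv ℝ G z (0, d) ∂(θ.prod (area K))
      = ∑ e ∈ edgesOf K, ∫ z, G z * inner ℝ (normal K e) d ∂(θ.prod (arc e)) := by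
  have := hθ.finite
  have := (compactlyCarried_area K).finite
  rw [integral_prod _ ((hθ.prod (compactlyCarried_area K)).integrable
    (continuous_fderiv_apply hG _))]
  have hGi : ∀ e ∈ edgesOf K, Integrable (fun z => G z * inner ℝ (normal K e) d)
      (θ.prod (arc e)) := fun e he =>
    (hθ.prod (compactlyCarried_arc (card_of_mem_edgesOf he))).integrable
      (hG.continuous.mul continuous_const)
  have h1 : ∀ e ∈ edgesOf K, ∫ z, G z * inner ℝ (normal K e) d ∂(θ.prod (arc e))
      = ∫ t, ∫ x, G (t, x) * inner ℝ (normal K e) d ∂(arc e) ∂θ := by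
    intro e he
    have := (compactlyCarried_arc (card_of_mem_edgesOf he)).finite
    exact integral_prod _ (hGi e he)
  rw [Finset.sum_congr rfl h1, ← integral_finsetSum]
  · refine integral_congr_ae (Eventually.of_forall fun t => ?_)
    simp only
    rw [← integral_area_fderiv hK hind (g := fun y => G (t, y))
      (hG.comp (contDiff_const.prodMk contDiff_id)) d]
    simp only [fderiv_slice hG]
  · intro e he
    have := (compactlyCarried_arc (card_of_mem_edgesOf he)).finite
    exact (hGi e he).integral_prod_left

theorem integral_fderiv_time {ρ : Measure Plane} (hρ : CompactlyCarried ρ)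
    {G : SpaceTime → ℝ} (hG : ContDiff ℝ 1 G) {t₀ t₁ : ℝ} (ht : t₀ ≤ t₁) :
    ∫ z, fderiv ℝ G z (1, 0) ∂((during t₀ t₁).prod ρ)
      = ∫ z, G z ∂((atTime t₁).prod ρ) - ∫ z, G z ∂((atTime t₀).prod ρ) := by
  have := hρ.finite
  have := (compactlyCarried_during t₀ t₁).finite
  rw [integral_prod_symm _ (((compactlyCarried_during t₀ t₁).prod hρ).integrable
    (continuous_fderiv_apply hG _)), integral_atTime_prod, integral_atTime_prod,
    ← integral_sub (hρ.integrable (by have := hG.continuous; fun_prop))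
      (hρ.integrable (by have := hG.continuous; fun_prop))]
  refine integral_congr_ae (Eventually.of_forall fun x => ?_)
  simp only [during]
  rw [← integral_Ioc_eq_integral_Ioo, ← intervalIntegral.integral_of_le ht]
  refine intervalIntegral.integral_eq_sub_of_hasDerivAt (fun t _ => hasDerivAt_slice hG t x) ?_
  exact Continuous.intervalIntegrable
    ((continuous_fderiv_apply hG (1, 0)).comp (by fun_prop : Continuous fun t : ℝ => (t, x))) _ _

/-- Green's formula in space for a function with a square-integrable spatial derivative, obtained
from smooth functions by passage to the limit. -/
theorem green_space {ι : Type*} {U : Set SpaceTime} {dir : ι → SpaceTime}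
    {S : Set (Measure SpaceTime)} {u : SpaceTime → ℝ} {g : ι → SpaceTime → ℝ}
    (hu : IsSobolevWithTraces U dir S u g) {K : Finset Plane} (hK : K.card = 3)
    (hind : AffineIndependent ℝ ((↑) : K → Plane)) {t₀ t₁ : ℝ}
    (hU : (during t₀ t₁).prod (area K) ≤ volume.restrict U)
    (hS : ∀ e ∈ edgesOf K, ∃ σ ∈ S, (during t₀ t₁).prod (arc e) ≤ σ)
    (i : ι) (d : Plane) (hd : dir i = (0, d)) {h : SpaceTime → ℝ} (hh : ContDiff ℝ 1 h) :
    ∫ z, u z * fderiv ℝ h z (0, d) ∂((during t₀ t₁).prod (area K))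
      + ∫ z, g i z * h z ∂((during t₀ t₁).prod (area K))
      = ∑ e ∈ edgesOf K, ∫ z, u z * (h z * inner ℝ (normal K e) d)
          ∂((during t₀ t₁).prod (arc e)) := by
  obtain ⟨φ, hφ, hφu, hφg, hφS⟩ := hu.trace
  set σ := (during t₀ t₁).prod (area K) with hσ
  have hσc : CompactlyCarried σ :=
    (compactlyCarried_during t₀ t₁).prod (compactlyCarried_area K)
  have hφ1 : ∀ k, ContDiff ℝ 1 (φ k) := fun k => (hφ k).of_le (by exact_mod_cast le_top)
  have mono : ∀ {μ ν : Measure SpaceTime} (_ : μ ≤ ν) {w : ℕ → SpaceTime → ℝ},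
      Tendsto (fun k => eLpNorm (w k) 2 ν) atTop (𝓝 0) →
      Tendsto (fun k => eLpNorm (w k) 2 μ) atTop (𝓝 0) := fun hμν _ hw =>
    tendsto_of_tendsto_of_tendsto_of_le_of_le tendsto_const_nhds hw (fun _ => bot_le)
      fun _ => eLpNorm_mono_measure _ hμν
  have l1 := tendsto_integral_mul_of_eLpNorm (σ := σ) (hu.memLp.mono_measure hU)
    (fun k => hσc.memLp (hφ k).continuous 2)
    (hσc.memLp (continuous_fderiv_apply hh (0, d)) 2) (mono hU hφu)
  have l2 := tendsto_integral_mul_of_eLpNorm (σ := σ) ((hu.memLp_deriv i).mono_measure hU)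
    (fun k => hσc.memLp (continuous_fderiv_apply (hφ1 k) (dir i)) 2)
    (hσc.memLp hh.continuous 2) (mono hU (hφg i))
  have l3 : ∀ e ∈ edgesOf K, Tendsto (fun k => ∫ z, φ k z * (h z * inner ℝ (normal K e) d)
      ∂((during t₀ t₁).prod (arc e))) atTop (𝓝 (∫ z, u z * (h z * inner ℝ (normal K e) d)
      ∂((during t₀ t₁).prod (arc e)))) := by
    intro e he
    obtain ⟨ρ, hρ, hle⟩ := hS e he
    have hc := (compactlyCarried_during t₀ t₁).prod
      (compactlyCarried_arc (card_of_mem_edgesOf he))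
    exact tendsto_integral_mul_of_eLpNorm ((hu.memLp_trace ρ hρ).mono_measure hle)
      (fun k => hc.memLp (hφ k).continuous 2)
      (hc.memLp (hh.continuous.mul continuous_const) 2) (mono hle (hφS ρ hρ))
  refine tendsto_nhds_unique (l1.add l2) ?_
  have l4 := tendsto_finsetSum _ l3
  refine l4.congr fun k => ?_
  have hprod := integral_fderiv_space hK hind (compactlyCarried_during t₀ t₁)
    ((hφ1 k).mul hh) d
  simp only [mul_assoc] at hprod
  rw [← hprod, ← integral_add]
  · refine integral_congr_ae (Eventually.of_forall fun z => ?_)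
    simp only
    rw [fderiv_fun_mul ((hφ1 k).differentiable one_ne_zero z) (hh.differentiable one_ne_zero z), hd]
    simp only [add_apply, smul_apply, smul_eq_mul]
    ring
  · exact hσc.integrable ((hφ k).continuous.mul (continuous_fderiv_apply hh _))
  · exact hσc.integrable ((continuous_fderiv_apply (hφ1 k) _).mul hh.continuous)

/-- Integration by parts in time for a function with a square-integrable time derivative. -/
theorem green_time {ι : Type*} {U : Set SpaceTime} {dir : ι → SpaceTime}
    {S : Set (Measure SpaceTime)} {u : SpaceTime → ℝ} {g : ι → SpaceTime → ℝ}
    (hu : IsSobolevWithTraces U dir S u g) {K : Finset Plane} {t₀ t₁ : ℝ} (ht : t₀ ≤ t₁)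
    (hU : (during t₀ t₁).prod (area K) ≤ volume.restrict U)
    (h0 : ∃ σ ∈ S, (atTime t₀).prod (area K) ≤ σ) (h1 : ∃ σ ∈ S, (atTime t₁).prod (area K) ≤ σ)
    (i : ι) (hd : dir i = (1, 0)) {h : SpaceTime → ℝ} (hh : ContDiff ℝ 1 h) :
    ∫ z, u z * fderiv ℝ h z (1, 0) ∂((during t₀ t₁).prod (area K))
      + ∫ z, g i z * h z ∂((during t₀ t₁).prod (area K))
      = ∫ z, u z * h z ∂((atTime t₁).prod (area K))
        - ∫ z, u z * h z ∂((atTime t₀).prod (area K)) := by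
  obtain ⟨φ, hφ, hφu, hφg, hφS⟩ := hu.trace
  set σ := (during t₀ t₁).prod (area K) with hσ
  have hσc : CompactlyCarried σ :=
    (compactlyCarried_during t₀ t₁).prod (compactlyCarried_area K)
  have hφ1 : ∀ k, ContDiff ℝ 1 (φ k) := fun k => (hφ k).of_le (by exact_mod_cast le_top)
  have mono : ∀ {μ ν : Measure SpaceTime} (_ : μ ≤ ν) {w : ℕ → SpaceTime → ℝ},
      Tendsto (fun k => eLpNorm (w k) 2 ν) atTop (𝓝 0) →
      Tendsto (fun k => eLpNorm (w k) 2 μ) atTop (𝓝 0) := fun hμν _ hw =>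
    tendsto_of_tendsto_of_tendsto_of_le_of_le tendsto_const_nhds hw (fun _ => bot_le)
      fun _ => eLpNorm_mono_measure _ hμν
  have l1 := tendsto_integral_mul_of_eLpNorm (σ := σ) (hu.memLp.mono_measure hU)
    (fun k => hσc.memLp (hφ k).continuous 2)
    (hσc.memLp (continuous_fderiv_apply hh (1, 0)) 2) (mono hU hφu)
  have l2 := tendsto_integral_mul_of_eLpNorm (σ := σ) ((hu.memLp_deriv i).mono_measure hU)
    (fun k => hσc.memLp (continuous_fderiv_apply (hφ1 k) (dir i)) 2)
    (hσc.memLp hh.continuous 2) (mono hU (hφg i))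
  have l3 : ∀ t, (∃ σ ∈ S, (atTime t).prod (area K) ≤ σ) →
      Tendsto (fun k => ∫ z, φ k z * h z ∂((atTime t).prod (area K))) atTop
        (𝓝 (∫ z, u z * h z ∂((atTime t).prod (area K)))) := by
    rintro t ⟨ρ, hρ, hle⟩
    have hc := (compactlyCarried_atTime t).prod (compactlyCarried_area K)
    exact tendsto_integral_mul_of_eLpNorm ((hu.memLp_trace ρ hρ).mono_measure hle)
      (fun k => hc.memLp (hφ k).continuous 2)
      (hc.memLp hh.continuous 2) (mono hle (hφS ρ hρ))
  refine tendsto_nhds_unique (l1.add l2) (((l3 t₁ h1).sub (l3 t₀ h0)).congr fun k => ?_)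
  rw [← integral_fderiv_time (compactlyCarried_area K) ((hφ1 k).mul hh) ht, ← integral_add]
  · refine integral_congr_ae (Eventually.of_forall fun z => ?_)
    simp only
    rw [fderiv_fun_mul ((hφ1 k).differentiable one_ne_zero z) (hh.differentiable one_ne_zero z), hd]
    simp only [add_apply, smul_apply, smul_eq_mul]
    ring
  · exact hσc.integrable ((hφ k).continuous.mul (continuous_fderiv_apply hh _))
  · exact hσc.integrable ((continuous_fderiv_apply (hφ1 k) _).mul hh.continuous)

/-! ### Polynomials on elements and faces -/

/-- `u` is a polynomial of degree at most `p` in time. -/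
def IsTimePolynomial (p : ℕ) (u : ℝ → ℝ) : Prop :=
  ∃ P : Polynomial ℝ, P.natDegree ≤ p ∧ ∀ t, u t = P.eval t

theorem IsTimePolynomial.add {p : ℕ} {u w : ℝ → ℝ} (hu : IsTimePolynomial p u)
    (hw : IsTimePolynomial p w) : IsTimePolynomial p (fun t => u t + w t) := by
  obtain ⟨P, hP, h⟩ := hu
  obtain ⟨Q, hQ, h'⟩ := hw
  exact ⟨P + Q, (Polynomial.natDegree_add_le _ _).trans (max_le hP hQ), by simp [h, h']⟩

theorem IsTimePolynomial.const_mul {p : ℕ} {u : ℝ → ℝ} (hu : IsTimePolynomial p u) (k : ℝ) :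
    IsTimePolynomial p (fun t => k * u t) := by
  obtain ⟨P, hP, h⟩ := hu
  exact ⟨Polynomial.C k * P, (Polynomial.natDegree_C_mul_le _ _).trans hP, by simp [h]⟩

theorem contDiff_polynomial_eval {n : WithTop ℕ∞} (c : Polynomial ℝ) :
    ContDiff ℝ n (fun t : ℝ => c.eval t) := by
  simpa [Polynomial.aeval_def] using c.contDiff_aeval (𝕜 := ℝ) n

/-- A monomial in space times a polynomial in time. -/
def monomialW (i j : ℕ) (c : Polynomial ℝ) : SpaceTime → ℝ :=
  fun z => z.2 0 ^ i * z.2 1 ^ j * c.eval z.1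

theorem monomialW_mem_localWTilde {p i j : ℕ} {c : Polynomial ℝ} (hij : i + j < p)
    (hc : c.natDegree ≤ p) : monomialW i j c ∈ localWTilde p := by
  refine Submodule.subset_span ⟨MvPolynomial.X 0 ^ i * MvPolynomial.X 1 ^ j, c, ?_, hc, ?_⟩
  · refine lt_of_le_of_lt (MvPolynomial.totalDegree_mul _ _) ?_
    simpa [MvPolynomial.totalDegree_X_pow] using hij
  · funext z
    simp [monomialW]

theorem localW_induction {p : ℕ} {Q : (SpaceTime → ℝ) → Prop} (h0 : Q 0)
    (hadd : ∀ u w, Q u → Q w → Q (u + w)) (hsmul : ∀ (k : ℝ) u, Q u → Q (k • u))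
    (hmon : ∀ i j c, i + j ≤ p → c.natDegree ≤ p → Q (monomialW i j c)) {w : SpaceTime → ℝ}
    (hw : w ∈ localW p) : Q w := by
  refine Submodule.span_induction ?_ h0 (fun u w _ _ => hadd u w) (fun k u _ => hsmul k u) hw
  rintro _ ⟨a, c, ha, hc, rfl⟩
  have hsum : (fun z : SpaceTime => MvPolynomial.eval (fun i => z.2 i) a * c.eval z.1)
      = ∑ m ∈ a.support, a.coeff m • monomialW (m 0) (m 1) c := by
    funext z
    rw [MvPolynomial.eval_eq', Finset.sum_mul, Finset.sum_apply]
    refine Finset.sum_congr rfl fun m _ => ?_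
    simp [monomialW, Fin.prod_univ_two, mul_assoc]
  rw [hsum]
  refine Finset.sum_induction _ Q hadd h0 fun m hm => hsmul _ _ (hmon _ _ _ ?_ hc)
  have := (MvPolynomial.le_totalDegree hm).trans ha
  rwa [Finsupp.sum_fintype _ _ (fun _ => rfl), Fin.sum_univ_two] at this

theorem contDiff_of_mem_localW {p : ℕ} {w : SpaceTime → ℝ} (hw : w ∈ localW p) :
    ContDiff ℝ ∞ w := by
  refine localW_induction contDiff_const (fun u w hu hw => hu.add hw)
    (fun k u hu => hu.const_smul k) (fun i j c _ _ => ?_) hw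
  have h : ∀ i : Fin 2, ContDiff ℝ ∞ (fun z : SpaceTime => z.2 i) := fun i =>
    contDiff_euclidean.1 contDiff_snd i
  exact (((h 0).pow i).mul ((h 1).pow j)).mul ((contDiff_polynomial_eval c).comp contDiff_fst)

theorem isTimePolynomial_of_mem_localW {p : ℕ} {w : SpaceTime → ℝ} (hw : w ∈ localW p) (x : Plane) :
    IsTimePolynomial p (fun t => w (t, x)) := by
  refine localW_induction (Q := fun w => IsTimePolynomial p (fun t => w (t, x)))
    ⟨0, by simp, by simp⟩ (fun u w hu hw => hu.add hw)
    (fun k u hu => hu.const_mul k) (fun i j c _ hc => ?_) hw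
  exact IsTimePolynomial.const_mul ⟨c, hc, fun t => rfl⟩ (x 0 ^ i * x 1 ^ j)

theorem fderiv_mem_localWTilde {p : ℕ} {w : SpaceTime → ℝ} (hw : w ∈ localW p) (k : Fin 2) :
    (fun z => fderiv ℝ w z (spaceDir k)) ∈ localWTilde p := by
  have hmain : ContDiff ℝ 1 w ∧ (fun z => fderiv ℝ w z (spaceDir k)) ∈ localWTilde p := by
    refine localW_induction (Q := fun w => ContDiff ℝ 1 w ∧
      (fun z => fderiv ℝ w z (spaceDir k)) ∈ localWTilde p) ?_ ?_ ?_ ?_ hw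
    · refine ⟨contDiff_const, ?_⟩
      convert (localWTilde p).zero_mem using 1
      funext z
      simp
    · rintro u w ⟨hu, hu'⟩ ⟨hw, hw'⟩
      refine ⟨hu.add hw, ?_⟩
      convert (localWTilde p).add_mem hu' hw' using 1
      funext z
      rw [fderiv_add (hu.differentiable one_ne_zero z) (hw.differentiable one_ne_zero z)]
      rfl
    · rintro l u ⟨hu, hu'⟩
      refine ⟨hu.const_smul l, ?_⟩
      convert (localWTilde p).smul_mem l hu' using 1
      funext z
      rw [fderiv_const_smul (hu.differentiable one_ne_zero z)]
      rfl
    · intro i j c hij hc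
      have h1 : ContDiff ℝ 1 (monomialW i j c) := by
        have h : ∀ i : Fin 2, ContDiff ℝ 1 (fun z : SpaceTime => z.2 i) := fun i =>
          contDiff_euclidean.1 contDiff_snd i
        exact (((h 0).pow i).mul ((h 1).pow j)).mul ((contDiff_polynomial_eval c).comp contDiff_fst)
      refine ⟨h1, ?_⟩
      -- the derivative along a coordinate line through the point
      have hline : ∀ z : SpaceTime, HasDerivAt (fun s : ℝ => monomialW i j c (z + s • spaceDir k))
          (fderiv ℝ (monomialW i j c) z (spaceDir k)) 0 := by
        intro z
        have h2 : HasDerivAt (fun s : ℝ => z + s • spaceDir k) (spaceDir k) 0 := by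
          simpa using ((hasDerivAt_id (0 : ℝ)).smul_const (spaceDir k)).const_add z
        have h3 : HasFDerivAt (monomialW i j c) (fderiv ℝ (monomialW i j c) z)
            (z + (0 : ℝ) • spaceDir k) := by
          rw [zero_smul, add_zero]
          exact (h1.differentiable one_ne_zero z).hasFDerivAt
        exact h3.comp_hasDerivAt (0 : ℝ) h2
      fin_cases k
      · rcases Nat.eq_zero_or_pos i with rfl | hi
        · convert (localWTilde p).zero_mem using 1
          funext z
          refine (hline z).unique ?_
          have : (fun s : ℝ => monomialW 0 j c (z + s • spaceDir 0))
              = fun _ => monomialW 0 j c z := by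
            funext s
            simp [monomialW, spaceDir]
          simp only [Fin.zero_eta, this]
          exact hasDerivAt_const _ _
        · have : (fun z => fderiv ℝ (monomialW i j c) z (spaceDir 0))
              = (i : ℝ) • monomialW (i - 1) j c := by
            funext z
            refine (hline z).unique ?_
            have : (fun s : ℝ => monomialW i j c (z + s • spaceDir 0))
                = fun s => (z.2 0 + s) ^ i * (z.2 1 ^ j * c.eval z.1) := by
              funext s
              simp [monomialW, spaceDir, mul_assoc]
            simp only [Fin.zero_eta, this]
            refine ((((hasDerivAt_id (0 : ℝ)).const_add (z.2 0)).pow i).mul_const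
              (z.2 1 ^ j * c.eval z.1)).congr_deriv ?_
            simp only [monomialW, id, add_zero, Pi.smul_apply, smul_eq_mul]
            ring
          simp only [Fin.zero_eta, this]
          exact (localWTilde p).smul_mem _ (monomialW_mem_localWTilde (by omega) hc)
      · rcases Nat.eq_zero_or_pos j with rfl | hj
        · convert (localWTilde p).zero_mem using 1
          funext z
          refine (hline z).unique ?_
          have : (fun s : ℝ => monomialW i 0 c (z + s • spaceDir 1))
              = fun _ => monomialW i 0 c z := by
            funext s
            simp [monomialW, spaceDir]
          simp only [Fin.mk_one, this]
          exact hasDerivAt_const _ _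
        · have : (fun z => fderiv ℝ (monomialW i j c) z (spaceDir 1))
              = (j : ℝ) • monomialW i (j - 1) c := by
            funext z
            refine (hline z).unique ?_
            have : (fun s : ℝ => monomialW i j c (z + s • spaceDir 1))
                = fun s => (z.2 1 + s) ^ j * (z.2 0 ^ i * c.eval z.1) := by
              funext s
              simp [monomialW, spaceDir]
              ring
            simp only [Fin.mk_one, this]
            refine ((((hasDerivAt_id (0 : ℝ)).const_add (z.2 1)).pow j).mul_const
              (z.2 0 ^ i * c.eval z.1)).congr_deriv ?_
            simp only [monomialW, id, add_zero, Pi.smul_apply, smul_eq_mul]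
            ring
          simp only [Fin.mk_one, this]
          exact (localWTilde p).smul_mem _ (monomialW_mem_localWTilde (by omega) hc)
  exact hmain.2

theorem localM_add {p : ℕ} {e : Finset Plane} {μ ν : SpaceTime → ℝ} (hμ : μ ∈ localM p e)
    (hν : ν ∈ localM p e) : (fun z => μ z + ν z) ∈ localM p e := by
  intro x hx y hy
  obtain ⟨c, hc⟩ := hμ x hx y hy
  obtain ⟨c', hc'⟩ := hν x hx y hy
  refine ⟨fun i j => c i j + c' i j, fun t s hs => ?_⟩
  simp only [hc t s hs, hc' t s hs, ← Finset.sum_add_distrib, add_mul]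

theorem localM_const_mul {p : ℕ} {e : Finset Plane} {μ : SpaceTime → ℝ} (k : ℝ)
    (hμ : μ ∈ localM p e) : (fun z => k * μ z) ∈ localM p e := by
  intro x hx y hy
  obtain ⟨c, hc⟩ := hμ x hx y hy
  refine ⟨fun i j => k * c i j, fun t s hs => ?_⟩
  simp only [hc t s hs, Finset.mul_sum, mul_assoc]

theorem localM_sub {p : ℕ} {e : Finset Plane} {μ ν : SpaceTime → ℝ} (hμ : μ ∈ localM p e)
    (hν : ν ∈ localM p e) : (fun z => μ z - ν z) ∈ localM p e := by
  have := localM_add hμ (localM_const_mul (-1) hν)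
  convert this using 2
  ring

theorem localM_of_polynomial {p : ℕ} {e : Finset Plane} {μ : SpaceTime → ℝ}
    (h : ∀ x ∈ e, ∀ y ∈ e, ∃ P : Fin (p + 1) → Polynomial ℝ, (∀ j, (P j).natDegree ≤ p) ∧
      ∀ t : ℝ, ∀ s ∈ Icc (0 : ℝ) 1,
        μ (t, AffineMap.lineMap x y s) = ∑ j, (P j).eval t * s ^ (j : ℕ)) : μ ∈ localM p e := by
  intro x hx y hy
  obtain ⟨P, hP, hμ⟩ := h x hx y hy
  refine ⟨fun i j => (P j).coeff i, fun t s hs => ?_⟩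
  rw [hμ t s hs, Finset.sum_comm]
  refine Finset.sum_congr rfl fun j _ => ?_
  rw [Polynomial.eval_eq_sum_range' (Nat.lt_succ_of_le (hP j)), Finset.sum_mul,
    Finset.sum_range]

theorem polynomial_of_mem_localM {p : ℕ} {e : Finset Plane} {μ : SpaceTime → ℝ}
    (hμ : μ ∈ localM p e) {x y : Plane} (hx : x ∈ e) (hy : y ∈ e) :
    ∃ P : Fin (p + 1) → Polynomial ℝ, (∀ j, (P j).natDegree ≤ p) ∧
      ∀ t : ℝ, ∀ s ∈ Icc (0 : ℝ) 1,
        μ (t, AffineMap.lineMap x y s) = ∑ j, (P j).eval t * s ^ (j : ℕ) := by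
  obtain ⟨c, hc⟩ := hμ x hx y hy
  refine ⟨fun j => ∑ i : Fin (p + 1), Polynomial.C (c i j) * Polynomial.X ^ (i : ℕ), fun j => ?_,
    fun t s hs => ?_⟩
  · refine Polynomial.natDegree_sum_le_of_forall_le _ _ fun i _ => ?_
    exact (Polynomial.natDegree_C_mul_X_pow_le _ _).trans (Nat.lt_succ_iff.1 i.2)
  · rw [hc t s hs, Finset.sum_comm]
    refine Finset.sum_congr rfl fun j _ => ?_
    simp [Polynomial.eval_finsetSum, Finset.sum_mul]

/-- An element polynomial restricts to a face polynomial. -/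
theorem localM_of_mem_localW {p : ℕ} (e : Finset Plane) {w : SpaceTime → ℝ} (hw : w ∈ localW p) :
    w ∈ localM p e := by
  refine localW_induction (Q := fun w => w ∈ localM p e) ?_ (fun u w hu hw => localM_add hu hw)
    (fun k u hu => localM_const_mul k hu) (fun i j c hij hc => ?_) hw
  · intro x _ y _
    exact ⟨0, by simp⟩
  · intro x _ y _
    set A : Polynomial ℝ := (Polynomial.C (y 0 - x 0) * Polynomial.X + Polynomial.C (x 0)) ^ i
      * (Polynomial.C (y 1 - x 1) * Polynomial.X + Polynomial.C (x 1)) ^ j with hA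
    have hdeg : A.natDegree ≤ p := by
      refine (Polynomial.natDegree_mul_le.trans (add_le_add
        (Polynomial.natDegree_pow_le_of_le i Polynomial.natDegree_linear_le)
        (Polynomial.natDegree_pow_le_of_le j Polynomial.natDegree_linear_le))).trans ?_
      simpa using hij
    refine ⟨fun k l => c.coeff k * A.coeff l, fun t s _ => ?_⟩
    have h1 : monomialW i j c (t, AffineMap.lineMap x y s) = c.eval t * A.eval s := by
      simp only [monomialW, AffineMap.lineMap_apply, vsub_eq_sub, vadd_eq_add, PiLp.add_apply,
        PiLp.smul_apply, PiLp.sub_apply, smul_eq_mul, hA, Polynomial.eval_mul,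
        Polynomial.eval_pow, Polynomial.eval_add, Polynomial.eval_C, Polynomial.eval_X]
      ring
    rw [h1, Polynomial.eval_eq_sum_range' (Nat.lt_succ_of_le hc),
      Polynomial.eval_eq_sum_range' (Nat.lt_succ_of_le hdeg), Finset.sum_range, Finset.sum_range,
      Finset.sum_mul_sum]
    refine Finset.sum_congr rfl fun k _ => Finset.sum_congr rfl fun l _ => ?_
    ring

theorem localM_dt {p : ℕ} {e : Finset Plane} {μ : SpaceTime → ℝ} (hμ : μ ∈ localM p e) :
    dt μ ∈ localM p e := by
  refine localM_of_polynomial fun x hx y hy => ?_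
  obtain ⟨P, hP, hμP⟩ := polynomial_of_mem_localM hμ hx hy
  refine ⟨fun j => (P j).derivative, fun j => (Polynomial.natDegree_derivative_le _).trans
    ((Nat.sub_le _ _).trans (hP j)), fun t s hs => ?_⟩
  have h1 : (fun t => μ (t, AffineMap.lineMap x y s)) = fun t => ∑ j, (P j).eval t * s ^ (j : ℕ) :=
    funext fun t => hμP t s hs
  simp only [dt]
  rw [h1]
  refine HasDerivAt.deriv ?_
  exact HasDerivAt.fun_sum fun j _ => ((P j).hasDerivAt t).mul_const _

theorem mem_hull_pair [DecidableEq Plane] {a b x : Plane} :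
    x ∈ convexHull ℝ (({a, b} : Finset Plane) : Set Plane)
      ↔ ∃ s ∈ Icc (0 : ℝ) 1, x = AffineMap.lineMap a b s := by
  rw [hull_pair]
  simp only [mem_image, AffineMap.lineMap_apply, vsub_eq_sub, vadd_eq_add]
  refine exists_congr fun s => and_congr_right fun _ => ?_
  rw [add_comm, eq_comm]

theorem isTimePolynomial_of_mem_localM {p : ℕ} {e : Finset Plane} (he : e.card = 2)
    {μ : SpaceTime → ℝ} (hμ : μ ∈ localM p e) {x : Plane}
    (hx : x ∈ convexHull ℝ (e : Set Plane)) : IsTimePolynomial p (fun t => μ (t, x)) := by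
  classical
  obtain ⟨a, b, hab, rfl⟩ := exists_pair he
  obtain ⟨s, hs, rfl⟩ := mem_hull_pair.1 hx
  obtain ⟨P, hP, hμP⟩ := polynomial_of_mem_localM hμ (x := a) (y := b) (by simp) (by simp)
  refine ⟨∑ j : Fin (p + 1), Polynomial.C (s ^ (j : ℕ)) * P j, ?_, fun t => ?_⟩
  · exact Polynomial.natDegree_sum_le_of_forall_le _ _ fun j _ =>
      (Polynomial.natDegree_C_mul_le _ _).trans (hP j)
  · refine (hμP t s hs).trans ?_
    simp [Polynomial.eval_finsetSum, mul_comm]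

/-- A face polynomial agrees on its face with a smooth function on space-time. -/
theorem exists_smooth_extension {p : ℕ} {e : Finset Plane} (he : e.card = 2)
    {μ : SpaceTime → ℝ} (hμ : μ ∈ localM p e) :
    ∃ μ' : SpaceTime → ℝ, ContDiff ℝ ∞ μ' ∧
      ∀ t, ∀ x ∈ convexHull ℝ (e : Set Plane), μ (t, x) = μ' (t, x) := by
  classical
  obtain ⟨a, b, hab, rfl⟩ := exists_pair he
  obtain ⟨c, hc⟩ := hμ a (by simp) b (by simp)
  refine ⟨fun z => ∑ i, ∑ j, c i j * z.1 ^ (i : ℕ) *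
    (inner ℝ (b - a) (z.2 - a) / ‖b - a‖ ^ 2) ^ (j : ℕ), ?_, ?_⟩
  · refine ContDiff.sum fun i _ => ContDiff.sum fun j _ => ?_
    have h1 : ContDiff ℝ ∞ fun z : SpaceTime => inner ℝ (b - a) (z.2 - a) :=
      contDiff_const.inner ℝ (contDiff_snd.sub contDiff_const)
    exact (contDiff_const.mul (contDiff_fst.pow _)).mul ((h1.div_const _).pow _)
  · intro t x hx
    obtain ⟨s, hs, rfl⟩ := mem_hull_pair.1 hx
    rw [hc t s hs]
    have hpos : ‖b - a‖ ^ 2 ≠ 0 := pow_ne_zero _ (norm_ne_zero_iff.2 (sub_ne_zero.2 hab.symm))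
    have h1 : inner ℝ (b - a) (AffineMap.lineMap a b s - a) / ‖b - a‖ ^ 2 = s := by
      rw [AffineMap.lineMap_apply, vsub_eq_sub, vadd_eq_add, add_sub_cancel_right,
        inner_smul_right, real_inner_self_eq_norm_sq, mul_div_assoc, div_self hpos, mul_one]
    simp only [h1]

theorem contDiff_of_mem_localV {p : ℕ} {r : SpaceTime → Plane} (hr : r ∈ localV p) :
    ContDiff ℝ ∞ r := contDiff_euclidean.2 fun i => contDiff_of_mem_localW (hr i)

theorem dt_apply_eq {u : SpaceTime → ℝ} (hu : ContDiff ℝ 1 u) (z : SpaceTime) :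
    dt u z = fderiv ℝ u z (1, 0) := (hasDerivAt_slice hu z.1 z.2).deriv

theorem dt_component {r : SpaceTime → Plane} (hr : ContDiff ℝ 1 r) (z : SpaceTime) (i : Fin 2) :
    dt r z i = fderiv ℝ (fun z => r z i) z (1, 0) := by
  have h1 : DifferentiableAt ℝ (fun s => r (s, z.2)) z.1 :=
    (hr.differentiable one_ne_zero _).comp _ (by fun_prop)
  have h2 := (EuclideanSpace.proj i : Plane →L[ℝ] ℝ).hasFDerivAt.comp_hasDerivAt z.1 h1.hasDerivAt
  rw [← dt_apply_eq (contDiff_euclidean.1 hr i)]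
  exact h2.deriv.symm

theorem divx_eq {r : SpaceTime → Plane} (hr : ContDiff ℝ 1 r) (z : SpaceTime) :
    divx r z = fderiv ℝ (fun z => r z 0) z (spaceDir 0)
      + fderiv ℝ (fun z => r z 1) z (spaceDir 1) := by
  simp only [divx, Fin.sum_univ_two]
  rw [fderiv_slice (contDiff_euclidean.1 hr 0), fderiv_slice (contDiff_euclidean.1 hr 1)]
  rfl

theorem divx_mem_localWTilde {p : ℕ} {r : SpaceTime → Plane} (hr : r ∈ localV p) :
    divx r ∈ localWTilde p := by
  have h1 : ContDiff ℝ 1 r := (contDiff_of_mem_localV hr).of_le (by exact_mod_cast le_top)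
  rw [funext fun z => divx_eq h1 z]
  exact (localWTilde p).add_mem (fderiv_mem_localWTilde (hr 0) 0) (fderiv_mem_localWTilde (hr 1) 1)

/-- The normal component of an element polynomial is a face polynomial. -/
theorem inner_mem_localM {p : ℕ} (e : Finset Plane) {r : SpaceTime → Plane} (hr : r ∈ localV p)
    (n : Plane) : (fun z => inner ℝ (r z) n) ∈ localM p e := by
  simp only [inner_plane]
  have h := localM_add (localM_const_mul (n 0) (localM_of_mem_localW e (hr 0)))
    (localM_const_mul (n 1) (localM_of_mem_localW e (hr 1)))
  simpa only [mul_comm] using h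

/-! ### Inverse inequalities in time -/

/-- On a finite-dimensional space a continuous quadratic quantity is bounded by a multiple of a
positive definite one. -/
theorem exists_le_mul_of_homogeneous {E : Type*} [NormedAddCommGroup E] [NormedSpace ℝ E]
    [FiniteDimensional ℝ E] {F Q : E → ℝ} (hF : Continuous F) (hQ : Continuous Q)
    (hF2 : ∀ (k : ℝ) c, F (k • c) = k ^ 2 * F c) (hQ2 : ∀ (k : ℝ) c, Q (k • c) = k ^ 2 * Q c)
    (hpos : ∀ c, c ≠ 0 → 0 < Q c) : ∃ C : ℝ, 0 < C ∧ ∀ c, F c ≤ C * Q c := by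
  have hc : ContinuousOn (fun c => F c / Q c) (Metric.sphere (0 : E) 1) :=
    hF.continuousOn.div hQ.continuousOn fun c hc =>
      (hpos c (by rintro rfl; simp at hc)).ne'
  obtain ⟨C, hC⟩ := (isCompact_sphere (0 : E) 1).exists_bound_of_continuousOn hc
  refine ⟨max C 1, lt_max_of_lt_right one_pos, fun c => ?_⟩
  by_cases h0 : c = 0
  · have h1 := hF2 0 0
    have h2 := hQ2 0 0
    simp only [smul_zero] at h1 h2
    subst h0
    rw [h1, h2]
    simp
  · have hn : ‖c‖ ≠ 0 := norm_ne_zero_iff.2 h0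
    have hs : ‖c‖⁻¹ • c ∈ Metric.sphere (0 : E) 1 := by
      simp [norm_smul, inv_mul_cancel₀ hn]
    have h1 := (le_abs_self _).trans (hC _ hs)
    rw [hF2, hQ2, mul_div_mul_left _ _ (by positivity)] at h1
    rw [div_le_iff₀ (hpos c h0)] at h1
    exact h1.trans (mul_le_mul_of_nonneg_right (le_max_left _ _) (hpos c h0).le)

/-- The polynomial with the given coefficients. -/
def polyOf {p : ℕ} (c : Fin (p + 1) → ℝ) : Polynomial ℝ :=
  ∑ i : Fin (p + 1), Polynomial.C (c i) * Polynomial.X ^ (i : ℕ)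

theorem polyOf_smul {p : ℕ} (k : ℝ) (c : Fin (p + 1) → ℝ) :
    polyOf (k • c) = Polynomial.C k * polyOf c := by
  simp [polyOf, Finset.mul_sum, mul_assoc]

theorem polyOf_coeff {p : ℕ} {P : Polynomial ℝ} (hP : P.natDegree ≤ p) :
    polyOf (fun i : Fin (p + 1) => P.coeff i) = P := by
  conv_rhs => rw [P.as_sum_range_C_mul_X_pow' (Nat.lt_succ_of_le hP)]
  rw [Finset.sum_range]
  rfl

theorem polyOf_injective {p : ℕ} {c : Fin (p + 1) → ℝ} (h : polyOf c = 0) : c = 0 := by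
  funext i
  have := congrArg (fun P => P.coeff i) h
  simp only [polyOf, Polynomial.finsetSum_coeff, Polynomial.coeff_C_mul, Polynomial.coeff_X_pow,
    Fin.val_inj, mul_ite, mul_one, mul_zero, Finset.sum_ite_eq, Finset.mem_univ, if_true,
    Polynomial.coeff_zero] at this
  exact this

theorem continuous_integral_sq_eval {p : ℕ} (D : Polynomial ℝ →ₗ[ℝ] Polynomial ℝ) :
    Continuous fun c : Fin (p + 1) → ℝ => ∫ s in (0 : ℝ)..1, (D (polyOf c)).eval s ^ 2 := by
  refine intervalIntegral.continuous_parametric_intervalIntegral_of_continuous' ?_ 0 1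
  have : (fun x : (Fin (p + 1) → ℝ) × ℝ => (D (polyOf x.1)).eval x.2 ^ 2)
      = fun x => (∑ i : Fin (p + 1), x.1 i * (D (Polynomial.X ^ (i : ℕ))).eval x.2) ^ 2 := by
    funext x
    congr 1
    simp only [polyOf, map_sum, Polynomial.eval_finsetSum, ← Polynomial.smul_eq_C_mul, map_smul,
      Polynomial.eval_smul, smul_eq_mul]
  simp only [Function.uncurry_def]
  rw [this]
  have h : ∀ i : ℕ, Continuous fun x : (Fin (p + 1) → ℝ) × ℝ =>
      (D (Polynomial.X ^ i)).eval x.2 := fun i => (Polynomial.continuous _).comp continuous_snd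
  fun_prop

theorem exists_inverse_unit (p : ℕ) : ∃ C : ℝ, 0 < C ∧ ∀ P : Polynomial ℝ, P.natDegree ≤ p →
    P.eval 0 ^ 2 + P.eval 1 ^ 2 + ∫ s in (0 : ℝ)..1, P.derivative.eval s ^ 2
      ≤ C * ∫ s in (0 : ℝ)..1, P.eval s ^ 2 := by
  have hev : ∀ s : ℝ, Continuous fun c : Fin (p + 1) → ℝ => (polyOf c).eval s := by
    intro s
    simp only [polyOf, Polynomial.eval_finsetSum, Polynomial.eval_mul, Polynomial.eval_C]
    fun_prop
  have hF2 : ∀ (k : ℝ) (c : Fin (p + 1) → ℝ), (polyOf (k • c)).eval 0 ^ 2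
      + (polyOf (k • c)).eval 1 ^ 2 + ∫ s in (0 : ℝ)..1, (polyOf (k • c)).derivative.eval s ^ 2
      = k ^ 2 * ((polyOf c).eval 0 ^ 2 + (polyOf c).eval 1 ^ 2
        + ∫ s in (0 : ℝ)..1, (polyOf c).derivative.eval s ^ 2) := by
    intro k c
    simp only [polyOf_smul, Polynomial.eval_mul, Polynomial.eval_C, Polynomial.derivative_C_mul,
      mul_pow, intervalIntegral.integral_const_mul]
    ring
  have hQ2 : ∀ (k : ℝ) (c : Fin (p + 1) → ℝ), ∫ s in (0 : ℝ)..1, (polyOf (k • c)).eval s ^ 2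
      = k ^ 2 * ∫ s in (0 : ℝ)..1, (polyOf c).eval s ^ 2 := by
    intro k c
    simp only [polyOf_smul, Polynomial.eval_mul, Polynomial.eval_C,
      mul_pow, intervalIntegral.integral_const_mul]
  have hpos : ∀ c : Fin (p + 1) → ℝ, c ≠ 0 → 0 < ∫ s in (0 : ℝ)..1, (polyOf c).eval s ^ 2 := by
    intro c hc
    by_contra hle
    have hcont : Continuous fun s => (polyOf c).eval s ^ 2 := (Polynomial.continuous _).pow 2
    apply hc
    apply polyOf_injective
    -- a nonzero value in the interval would make the integral positive
    refine Polynomial.eq_zero_of_infinite_isRoot _ ((Icc_infinite zero_lt_one).mono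
      (s := Icc (0 : ℝ) 1) fun s hs => ?_)
    by_contra hne
    refine hle (intervalIntegral.integral_pos zero_lt_one hcont.continuousOn
      (fun _ _ => sq_nonneg _) ⟨s, hs, ?_⟩)
    have : (polyOf c).eval s ≠ 0 := hne
    positivity
  obtain ⟨C, hC, h⟩ := exists_le_mul_of_homogeneous
    ((((hev 0).pow 2).add ((hev 1).pow 2)).add
      (continuous_integral_sq_eval Polynomial.derivative))
    (continuous_integral_sq_eval LinearMap.id) hF2 hQ2 hpos
  refine ⟨C, hC, fun P hP => ?_⟩
  have hk := h (fun i => P.coeff i)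
  simp only [Pi.add_apply, Pi.pow_apply, polyOf_coeff hP, LinearMap.id_apply] at hk
  exact hk

theorem weight_pos (α s t : ℝ) : 0 < weight α s t := Real.exp_pos _

theorem continuous_weight (α s : ℝ) : Continuous (weight α s) := by
  unfold weight; fun_prop

theorem hasDerivAt_weight (α s t : ℝ) : HasDerivAt (weight α s) (-α * weight α s t) t := by
  have h : HasDerivAt (fun t => -(α * (t - s))) (-α) t := by
    have := (((hasDerivAt_id t).sub_const s).const_mul α).fun_neg
    simpa only [id, mul_one] using this
  have := h.exp
  rwa [mul_comm] at this

theorem deriv_weight (α s t : ℝ) : deriv (weight α s) t = -α * weight α s t :=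
  (hasDerivAt_weight α s t).deriv

/-- Inverse inequalities for polynomials on an interval, with the exponential weight. -/
theorem exists_inverse (p : ℕ) {α T : ℝ} (hα : 0 < α) : ∃ C : ℝ, 0 < C ∧
    ∀ t₀ t₁ : ℝ, t₀ < t₁ → t₁ - t₀ ≤ T → ∀ u : ℝ → ℝ, IsTimePolynomial p u →
      (∫ t in t₀..t₁, weight α t₀ t * deriv u t ^ 2
        ≤ C * ((t₁ - t₀) ^ 2)⁻¹ * ∫ t in t₀..t₁, weight α t₀ t * u t ^ 2) ∧
      (weight α t₀ t₁ * u t₁ ^ 2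
        ≤ C * (t₁ - t₀)⁻¹ * ∫ t in t₀..t₁, weight α t₀ t * u t ^ 2) ∧
      (weight α t₀ t₀ * u t₀ ^ 2
        ≤ C * (t₁ - t₀)⁻¹ * ∫ t in t₀..t₁, weight α t₀ t * u t ^ 2) := by
  obtain ⟨C, hC, h⟩ := exists_inverse_unit p
  refine ⟨C * Real.exp (α * T), by positivity, fun t₀ t₁ ht hT u hu => ?_⟩
  obtain ⟨P, hP, hu⟩ := hu
  obtain rfl : u = fun t => P.eval t := funext hu
  set Δ := t₁ - t₀ with hΔ
  have hΔ0 : 0 < Δ := sub_pos.2 ht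
  set R := P.comp (Polynomial.C Δ * Polynomial.X + Polynomial.C t₀) with hR
  have hRdeg : R.natDegree ≤ p := by
    refine Polynomial.natDegree_comp_le.trans ?_
    exact (Nat.mul_le_mul hP Polynomial.natDegree_linear_le).trans (by simp)
  have hReval : ∀ s, R.eval s = P.eval (Δ * s + t₀) := fun s => by simp [hR]
  have hR' : ∀ s, R.derivative.eval s = Δ * P.derivative.eval (Δ * s + t₀) := fun s => by
    simp [hR, Polynomial.derivative_comp]
  have key := h R hRdeg
  have hint : ∀ g : ℝ → ℝ, ∫ s in (0 : ℝ)..1, g (Δ * s + t₀) = Δ⁻¹ * ∫ t in t₀..t₁, g t := by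
    intro g
    rw [intervalIntegral.integral_comp_mul_add _ hΔ0.ne' t₀]
    simp [hΔ]
  have e1 : ∫ s in (0 : ℝ)..1, R.eval s ^ 2 = Δ⁻¹ * ∫ t in t₀..t₁, P.eval t ^ 2 := by
    simp only [hReval]
    exact hint fun t => P.eval t ^ 2
  have e2 : ∫ s in (0 : ℝ)..1, R.derivative.eval s ^ 2
      = Δ ^ 2 * (Δ⁻¹ * ∫ t in t₀..t₁, P.derivative.eval t ^ 2) := by
    simp only [hR', mul_pow, intervalIntegral.integral_const_mul]
    rw [hint fun t => P.derivative.eval t ^ 2]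
  have e3 : R.eval 0 = P.eval t₀ := by rw [hReval]; simp
  have e4 : R.eval 1 = P.eval t₁ := by rw [hReval]; congr 1; simp [hΔ]
  rw [e1, e2, e3, e4] at key
  have hI : 0 ≤ ∫ t in t₀..t₁, P.derivative.eval t ^ 2 :=
    intervalIntegral.integral_nonneg ht.le fun _ _ => sq_nonneg _
  have hw1 : ∀ t ∈ Icc t₀ t₁, weight α t₀ t ≤ 1 := by
    intro t ht
    rw [weight, Real.exp_le_one_iff]
    have := mul_nonneg hα.le (sub_nonneg.2 ht.1)
    linarith
  have hw2 : ∀ t ∈ Icc t₀ t₁, 1 ≤ Real.exp (α * T) * weight α t₀ t := by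
    intro t ht
    rw [weight, ← Real.exp_add]
    apply Real.one_le_exp
    nlinarith [ht.2]
  have cw := continuous_weight α t₀
  have cP := P.continuous
  have cP' := P.derivative.continuous
  have hJ : ∫ t in t₀..t₁, P.eval t ^ 2
      ≤ Real.exp (α * T) * ∫ t in t₀..t₁, weight α t₀ t * P.eval t ^ 2 := by
    rw [← intervalIntegral.integral_const_mul]
    refine intervalIntegral.integral_mono_on ht.le ?_ ?_ fun t ht => ?_
    · exact Continuous.intervalIntegrable (by fun_prop) _ _
    · exact Continuous.intervalIntegrable (by fun_prop) _ _
    · rw [← mul_assoc]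
      exact le_mul_of_one_le_left (sq_nonneg _) (hw2 t ht)
  have hJ' : ∫ t in t₀..t₁, weight α t₀ t * P.derivative.eval t ^ 2
      ≤ ∫ t in t₀..t₁, P.derivative.eval t ^ 2 := by
    refine intervalIntegral.integral_mono_on ht.le ?_ ?_ fun t ht => ?_
    · exact Continuous.intervalIntegrable (by fun_prop) _ _
    · exact Continuous.intervalIntegrable (by fun_prop) _ _
    · exact mul_le_of_le_one_left (sq_nonneg _) (hw1 t ht)
  simp only [Polynomial.deriv]
  set I := ∫ t in t₀..t₁, P.derivative.eval t ^ 2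
  set J := ∫ t in t₀..t₁, P.eval t ^ 2
  set J' := ∫ t in t₀..t₁, weight α t₀ t * P.eval t ^ 2
  have hJC : C * (Δ⁻¹ * J) ≤ C * Real.exp (α * T) * Δ⁻¹ * J' := by
    have := mul_le_mul_of_nonneg_left hJ (by positivity : 0 ≤ C * Δ⁻¹)
    linarith
  have hnn : 0 ≤ Δ ^ 2 * (Δ⁻¹ * I) := by positivity
  refine ⟨?_, ?_, ?_⟩
  · have h1 : Δ ^ 2 * (Δ⁻¹ * I) ≤ C * Real.exp (α * T) * Δ⁻¹ * J' := by
      nlinarith [sq_nonneg (P.eval t₀), sq_nonneg (P.eval t₁)]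
    have h2 := mul_le_mul_of_nonneg_left h1 (by positivity : 0 ≤ Δ⁻¹)
    have h3 : Δ⁻¹ * (Δ ^ 2 * (Δ⁻¹ * I)) = I := by field_simp
    rw [h3] at h2
    refine hJ'.trans (h2.trans (le_of_eq ?_))
    rw [pow_two, mul_inv]
    ring
  · have h1 := mul_le_of_le_one_left (sq_nonneg (P.eval t₁)) (hw1 t₁ (right_mem_Icc.2 ht.le))
    linarith [sq_nonneg (P.eval t₀)]
  · have h1 := mul_le_of_le_one_left (sq_nonneg (P.eval t₀)) (hw1 t₀ (left_mem_Icc.2 ht.le))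
    linarith [sq_nonneg (P.eval t₁)]

/-- Inverse inequalities in time, integrated over a spatial set. -/
theorem exists_inverse_prod (p : ℕ) {α T : ℝ} (hα : 0 < α) : ∃ C : ℝ, 0 < C ∧
    ∀ t₀ t₁ : ℝ, t₀ < t₁ → t₁ - t₀ ≤ T → ∀ ρ : Measure Plane, CompactlyCarried ρ →
    ∀ G : SpaceTime → ℝ, ContDiff ℝ 1 G → (∀ᵐ x ∂ρ, IsTimePolynomial p (fun t => G (t, x))) →
      (∫ z, weight α t₀ z.1 * fderiv ℝ G z (1, 0) ^ 2 ∂((during t₀ t₁).prod ρ)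
        ≤ C * ((t₁ - t₀) ^ 2)⁻¹ * ∫ z, weight α t₀ z.1 * G z ^ 2 ∂((during t₀ t₁).prod ρ)) ∧
      (∫ z, weight α t₀ z.1 * G z ^ 2 ∂((atTime t₁).prod ρ)
        ≤ C * (t₁ - t₀)⁻¹ * ∫ z, weight α t₀ z.1 * G z ^ 2 ∂((during t₀ t₁).prod ρ)) ∧
      (∫ z, weight α t₀ z.1 * G z ^ 2 ∂((atTime t₀).prod ρ)
        ≤ C * (t₁ - t₀)⁻¹ * ∫ z, weight α t₀ z.1 * G z ^ 2 ∂((during t₀ t₁).prod ρ)) := by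
  obtain ⟨C, hC, h⟩ := exists_inverse p (T := T) hα
  refine ⟨C, hC, fun t₀ t₁ ht hT ρ hρ G hG hpoly => ?_⟩
  have := hρ.finite
  have := (compactlyCarried_during t₀ t₁).finite
  have hσ := (compactlyCarried_during t₀ t₁).prod hρ
  have cw := continuous_weight α t₀
  have cG := hG.continuous
  have cG' := continuous_fderiv_apply hG (1, 0)
  have i1 : Integrable (fun z : SpaceTime => weight α t₀ z.1 * fderiv ℝ G z (1, 0) ^ 2)
    ((during t₀ t₁).prod ρ) := hσ.integrable (by fun_prop)
  have i2 : Integrable (fun z : SpaceTime => weight α t₀ z.1 * G z ^ 2)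
    ((during t₀ t₁).prod ρ) := hσ.integrable (by fun_prop)
  have conv : ∀ g : ℝ → ℝ, ∫ t, g t ∂(during t₀ t₁) = ∫ t in t₀..t₁, g t := fun g => by
    rw [during, ← integral_Ioc_eq_integral_Ioo, intervalIntegral.integral_of_le ht.le]
  rw [integral_prod_symm _ i1, integral_prod_symm _ i2, integral_atTime_prod, integral_atTime_prod]
  simp only [conv]
  have j1 := i1.integral_prod_right
  have j2 := i2.integral_prod_right
  simp only [conv] at j1 j2
  have hd : ∀ t x, fderiv ℝ G (t, x) (1, 0) = deriv (fun t => G (t, x)) t := fun t x =>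
    (hasDerivAt_slice hG t x).deriv.symm
  simp only [hd] at j1 ⊢
  simp only [← integral_const_mul]
  refine ⟨?_, ?_, ?_⟩
  · refine integral_mono_ae j1 (j2.const_mul _) ?_
    filter_upwards [hpoly] with x hx using (h t₀ t₁ ht hT _ hx).1
  · refine integral_mono_ae (hρ.integrable (by fun_prop)) (j2.const_mul _) ?_
    filter_upwards [hpoly] with x hx using (h t₀ t₁ ht hT _ hx).2.1
  · refine integral_mono_ae (hρ.integrable (by fun_prop)) (j2.const_mul _) ?_
    filter_upwards [hpoly] with x hx using (h t₀ t₁ ht hT _ hx).2.2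

/-! ### The flow domain and its boundary -/

namespace FlowDomain

variable (dom : FlowDomain)

/-- The closed set between bottom and surface. -/
def closedOmega : Set Plane :=
  {x | x 0 ∈ Icc dom.L dom.R ∧ -dom.H + dom.b (x 0) ≤ x 1 ∧ x 1 ≤ 0}

theorem continuous_coord (i : Fin 2) : Continuous fun x : Plane => x i := by fun_prop

theorem isOpen_Omega : IsOpen dom.Omega := by
  have hU : IsOpen {x : Plane | x 0 ∈ Ioo dom.L dom.R} := isOpen_Ioo.preimage (continuous_coord 0)
  have hc : ContinuousOn (fun x : Plane => x 1 - (-dom.H + dom.b (x 0)))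
      {x : Plane | x 0 ∈ Ioo dom.L dom.R} := by
    refine (continuous_coord 1).continuousOn.sub (continuousOn_const.add ?_)
    exact dom.b_continuous.comp (continuous_coord 0).continuousOn
      fun x hx => Ioo_subset_Icc_self hx
  have h1 := hc.isOpen_inter_preimage hU (isOpen_Ioi (a := (0 : ℝ)))
  have h2 : IsOpen {x : Plane | x 1 < 0} := isOpen_lt (continuous_coord 1) continuous_const
  convert h1.inter h2 using 1
  ext x
  simp only [Omega, mem_inter_iff, mem_ofPred_eq, mem_preimage, mem_Ioi, mem_Ioo, sub_pos]
  tauto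

theorem isClosed_closedOmega : IsClosed dom.closedOmega := by
  have hU : IsClosed {x : Plane | x 0 ∈ Icc dom.L dom.R} :=
    isClosed_Icc.preimage (continuous_coord 0)
  have hc : ContinuousOn (fun x : Plane => x 1 - (-dom.H + dom.b (x 0)))
      {x : Plane | x 0 ∈ Icc dom.L dom.R} := by
    refine (continuous_coord 1).continuousOn.sub (continuousOn_const.add ?_)
    exact dom.b_continuous.comp (continuous_coord 0).continuousOn fun x hx => hx
  have h1 := hc.preimage_isClosed_of_isClosed hU (isClosed_Ici (a := (0 : ℝ)))
  have h2 : IsClosed {x : Plane | x 1 ≤ 0} := isClosed_le (continuous_coord 1) continuous_const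
  convert h1.inter h2 using 1
  ext x
  simp only [closedOmega, mem_inter_iff, mem_ofPred_eq, mem_preimage, mem_Ici, sub_nonneg]
  tauto

theorem closure_subset : closure dom.Omega ⊆ dom.closedOmega :=
  closure_minimal (fun _ hx => ⟨⟨hx.1.le, hx.2.1.le⟩, hx.2.2.1.le, hx.2.2.2.le⟩)
    dom.isClosed_closedOmega

theorem volume_closedOmega_diff : volume (dom.closedOmega \ dom.Omega) = 0 := by
  set F : (ℝ × ℝ) → Plane := fun z => !₂[z.1, z.2] with hF
  have hFm : MeasurePreserving F := by
    have h := (PiLp.volume_preserving_toLp (Fin 2)).comp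
      (volume_preserving_finTwoArrow ℝ).symm
    have h2 : F = WithLp.toLp 2 ∘ MeasurableEquiv.finTwoArrow.symm := by
      funext z
      refine plane_ext ?_ ?_ <;> rfl
    rw [h2]
    exact h
  have hm : MeasurableSet (dom.closedOmega \ dom.Omega) :=
    dom.isClosed_closedOmega.measurableSet.diff dom.isOpen_Omega.measurableSet
  rw [← hFm.measure_preimage hm.nullMeasurableSet, Measure.volume_eq_prod,
    Measure.measure_prod_null (hFm.measurable hm)]
  have h1 : ∀ᵐ x : ℝ, x ≠ dom.L := by simp [ae_iff]
  have h2 : ∀ᵐ x : ℝ, x ≠ dom.R := by simp [ae_iff]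
  filter_upwards [h1, h2] with x hL hR
  refine measure_mono_null (t := {0, -dom.H + dom.b x}) ?_ ?_
  · rintro y ⟨⟨⟨h3, h4⟩, h5, h6⟩, h7⟩
    by_contra hne
    simp only [mem_insert_iff, mem_singleton_iff, not_or] at hne
    simp only [hF, PiLp.toLp_apply, Matrix.cons_val_zero, Matrix.cons_val_one] at h3 h4 h5 h6
    refine h7 ⟨lt_of_le_of_ne h3 hL.symm, lt_of_le_of_ne h4 hR, lt_of_le_of_ne h5 ?_,
      lt_of_le_of_ne h6 hne.1⟩
    exact fun h => hne.2 h.symm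
  · exact (Set.toFinite _).measure_zero _

theorem area_le {K : Finset Plane} (hK : convexHull ℝ (K : Set Plane) ⊆ closure dom.Omega) :
    area K ≤ volume.restrict dom.Omega := by
  refine Measure.restrict_mono_ae ?_
  have h0 : ∀ᵐ x : Plane, x ∉ dom.closedOmega \ dom.Omega :=
    measure_eq_zero_iff_ae_notMem.1 dom.volume_closedOmega_diff
  filter_upwards [h0] with x hx hxK
  by_contra h
  exact hx ⟨dom.closure_subset (hK hxK), h⟩

end FlowDomain

theorem during_mono {a b c d : ℝ} (h1 : c ≤ a) (h2 : b ≤ d) : during a b ≤ during c d :=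
  Measure.restrict_mono (Ioo_subset_Ioo h1 h2) le_rfl

theorem during_prod_area_le {dom : FlowDomain} {K : Finset Plane}
    (hK : convexHull ℝ (K : Set Plane) ⊆ closure dom.Omega) {t₀ t₁ T : ℝ} (h0 : 0 ≤ t₀)
    (h1 : t₁ ≤ T) : (during t₀ t₁).prod (area K) ≤ volume.restrict (dom.spaceTime T) := by
  rw [FlowDomain.spaceTime, Measure.volume_eq_prod, ← Measure.prod_restrict]
  exact Measure.prod_mono (during_mono h0 h1) (dom.area_le hK)

/-! ### Parametrization of boundary edges -/

theorem hull_affine_pair [DecidableEq Plane] (c d : Plane) {u w : ℝ} (huw : u ≤ w) :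
    convexHull ℝ (({c + u • d, c + w • d} : Finset Plane) : Set Plane)
      = (fun s : ℝ => c + s • d) '' Icc u w := by
  have h := image_segment ℝ (AffineMap.lineMap c (c + d) : ℝ →ᵃ[ℝ] Plane) u w
  rw [segment_eq_Icc huw] at h
  have h2 : ∀ s : ℝ, (AffineMap.lineMap c (c + d) : ℝ →ᵃ[ℝ] Plane) s = c + s • d := fun s => by
    simp [AffineMap.lineMap_apply, add_comm]
  simp only [h2] at h
  rw [Finset.coe_pair, convexHull_pair, ← h]

theorem prod_arc_eq_map (θ : Measure ℝ) (hθ : CompactlyCarried θ) {e : Finset Plane} (c d : Plane)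
    (hd : d ≠ 0) {u w : ℝ}
    (he : convexHull ℝ (e : Set Plane) = (fun s : ℝ => c + s • d) '' Icc u w) :
    θ.prod (arc e) = ENNReal.ofReal ‖d‖ •
      (θ.prod (volume.restrict (Ioo u w))).map (fun z : ℝ × ℝ => (z.1, c + z.2 • d)) := by
  have := hθ.finite
  rw [arc, he, hausdorffMeasure_restrict_affine_image c d hd, Measure.prod_smul_right,
    restrict_Ioo_eq_restrict_Icc]
  have h := Measure.map_prod_map θ (volume.restrict (Icc u w)) measurable_id
    (f := id) (g := fun s : ℝ => c + s • d) (by fun_prop : Continuous _).measurable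
  rw [Measure.map_id] at h
  rw [h]
  rfl

theorem measurableEmbedding_param (c d : Plane) (hd : d ≠ 0) :
    MeasurableEmbedding (fun z : ℝ × ℝ => (z.1, c + z.2 • d)) := by
  refine Continuous.measurableEmbedding (by fun_prop) ?_
  rintro ⟨x, y⟩ ⟨x', y'⟩ h
  simp only [Prod.mk.injEq] at h
  obtain ⟨rfl, h⟩ := h
  rw [smul_left_injective ℝ hd (add_left_cancel h)]

theorem ae_prod_arc {θ : Measure ℝ} (hθ : CompactlyCarried θ) {e : Finset Plane} {c d : Plane}
    (hd : d ≠ 0) {u w : ℝ}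
    (he : convexHull ℝ (e : Set Plane) = (fun s : ℝ => c + s • d) '' Icc u w)
    {P : SpaceTime → Prop} :
    (∀ᵐ z ∂(θ.prod (arc e)), P z) ↔
      ∀ᵐ z ∂(θ.prod (volume.restrict (Ioo u w))), P (z.1, c + z.2 • d) := by
  rw [prod_arc_eq_map θ hθ c d hd he, Measure.ae_ennreal_smul_measure_iff,
    (measurableEmbedding_param c d hd).ae_map_iff]
  simpa using hd

theorem integral_prod_arc {θ : Measure ℝ} (hθ : CompactlyCarried θ) {e : Finset Plane} {c d : Plane}
    (hd : d ≠ 0) {u w : ℝ}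
    (he : convexHull ℝ (e : Set Plane) = (fun s : ℝ => c + s • d) '' Icc u w) (g : SpaceTime → ℝ) :
    ∫ z, g z ∂(θ.prod (arc e))
      = ‖d‖ * ∫ z, g (z.1, c + z.2 • d) ∂(θ.prod (volume.restrict (Ioo u w))) := by
  rw [prod_arc_eq_map θ hθ c d hd he, integral_smul_measure,
    (measurableEmbedding_param c d hd).integral_map, ENNReal.toReal_ofReal (norm_nonneg _),
    smul_eq_mul]

theorem memLp_prod_arc {θ : Measure ℝ} (hθ : CompactlyCarried θ) {e : Finset Plane} {c d : Plane}
    (hd : d ≠ 0) {u w : ℝ}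
    (he : convexHull ℝ (e : Set Plane) = (fun s : ℝ => c + s • d) '' Icc u w) (g : SpaceTime → ℝ) :
    MemLp g 2 (θ.prod (arc e)) ↔
      MemLp (fun z : ℝ × ℝ => g (z.1, c + z.2 • d)) 2 (θ.prod (volume.restrict (Ioo u w))) := by
  have h0 : ENNReal.ofReal ‖d‖ ≠ 0 := by simpa using hd
  rw [prod_arc_eq_map θ hθ c d hd he]
  have h1 := (measurableEmbedding_param c d hd).memLp_map_measure_iff (g := g) (p := 2)
    (μ := θ.prod (volume.restrict (Ioo u w)))
  rw [Function.comp_def] at h1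
  rw [← h1]
  refine ⟨fun h => ?_, fun h => h.smul_measure ENNReal.ofReal_ne_top⟩
  have h2 := h.smul_measure (c := (ENNReal.ofReal ‖d‖)⁻¹) (by simpa using hd)
  rwa [smul_smul, ENNReal.inv_mul_cancel h0 ENNReal.ofReal_ne_top, one_smul] at h2

/-! ### Edges and triangles of the mesh -/

namespace SpatialMesh

variable {dom : FlowDomain} (mesh : SpatialMesh dom)

theorem mem_elements {K : Finset Plane} :
    K ∈ mesh.elements ↔ K ∈ mesh.complex.faces ∧ K.card = 3 := by
  simp [elements]

theorem mem_edges {e : Finset Plane} : e ∈ mesh.edges ↔ e ∈ mesh.complex.faces ∧ e.card = 2 := by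
  simp [edges]

theorem edge_of_element {K e : Finset Plane} (hK : K ∈ mesh.elements) (he : e ∈ edgesOf K) :
    e ∈ mesh.edges := by
  have h := Finset.mem_powersetCard.1 he
  refine mesh.mem_edges.2 ⟨?_, h.2⟩
  refine (mesh.complex.isRelLowerSet_faces (mesh.mem_elements.1 hK).1).2 h.1 ?_
  exact Finset.card_pos.1 (by rw [h.2]; norm_num)

theorem hull_subset {s : Finset Plane} (hs : s ∈ mesh.complex.faces) :
    convexHull ℝ (s : Set Plane) ⊆ closure dom.Omega := by
  rw [← mesh.space_eq]
  exact mesh.complex.convexHull_subset_space hs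

end SpatialMesh

/-- The signed distance from the line through `a` and `b` is affine. -/
theorem cross_affine (a b x y : Plane) (s t : ℝ) (hst : s + t = 1) :
    cross (b - a) (s • x + t • y - a) = s * cross (b - a) (x - a) + t * cross (b - a) (y - a) := by
  have ht : t = 1 - s := by linarith
  subst ht
  simp only [cross, PiLp.sub_apply, PiLp.add_apply, PiLp.smul_apply, smul_eq_mul]
  ring

theorem convex_cross_le (a b : Plane) : Convex ℝ {x : Plane | cross (b - a) (x - a) ≤ 0} := by
  intro x hx y hy s t hs ht hst
  simp only [mem_ofPred_eq] at hx hy ⊢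
  rw [cross_affine a b x y s t hst]
  exact add_nonpos (mul_nonpos_of_nonneg_of_nonpos hs hx) (mul_nonpos_of_nonneg_of_nonpos ht hy)

theorem convex_cross_eq (a b : Plane) : Convex ℝ {x : Plane | cross (b - a) (x - a) = 0} := by
  intro x hx y hy s t hs ht hst
  simp only [mem_ofPred_eq] at hx hy ⊢
  rw [cross_affine a b x y s t hst, hx, hy]
  ring

theorem cross_self (u : Plane) : cross u u = 0 := by simp [cross]; ring

theorem cross_zero (u : Plane) : cross u 0 = 0 := by simp [cross]

/-- Two triangles on the same side of a common edge have a common point off that edge. -/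
theorem exists_common_point [DecidableEq Plane] {a b c c' : Plane}
    (hc : 0 < cross (b - a) (c - a)) (hc' : 0 < cross (b - a) (c' - a)) :
    ∃ x ∈ convexHull ℝ (({a, b, c} : Finset Plane) : Set Plane),
      x ∈ convexHull ℝ (({a, b, c'} : Finset Plane) : Set Plane) ∧ 0 < cross (b - a) (x - a) := by
  set X := cross (c' - a) (c - a) / cross (b - a) (c - a) with hX
  set Y := cross (b - a) (c' - a) / cross (b - a) (c - a) with hY
  have hYpos : 0 < Y := div_pos hc' hc
  have hdec : c' - a = X • (b - a) + Y • (c - a) := by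
    refine plane_ext ?_ ?_ <;>
    · simp only [PiLp.add_apply, PiLp.smul_apply, smul_eq_mul, hX, hY]
      rw [div_mul_eq_mul_div, div_mul_eq_mul_div, ← add_div, eq_div_iff hc.ne']
      simp only [cross, PiLp.sub_apply]
      ring
  set ε : ℝ := (2 * (1 + |X| + Y))⁻¹ with hε
  have hden : 0 < 2 * (1 + |X| + Y) := by positivity
  have hεpos : 0 < ε := inv_pos.2 hden
  have hε1 : ε * (2 * (1 + |X| + Y)) = 1 := inv_mul_cancel₀ hden.ne'
  have p1 : 0 ≤ ε * |X| := mul_nonneg hεpos.le (abs_nonneg X)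
  have p2 : 0 ≤ ε * Y := (mul_pos hεpos hYpos).le
  have hsum : 2 * ε + 2 * (ε * |X|) + 2 * (ε * Y) = 1 := by linear_combination hε1
  have hXa := neg_abs_le X
  have hXb := le_abs_self X
  have h3 : ε * -|X| ≤ ε * X := mul_le_mul_of_nonneg_left hXa hεpos.le
  have h4 : ε * X ≤ ε * |X| := mul_le_mul_of_nonneg_left hXb hεpos.le
  have e1 : a + (1 / 2 * (1 - ε) : ℝ) • (b - a) + ε • (c' - a)
      = a + (1 / 2 * (1 - ε) + ε * X) • (b - a) + (ε * Y) • (c - a) := by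
    rw [hdec]; module
  refine ⟨a + (1 / 2 * (1 - ε) : ℝ) • (b - a) + ε • (c' - a), ?_, ?_, ?_⟩
  · rw [e1, hull_triple a b c hc.ne']
    refine ⟨?_, by positivity, ?_⟩
    · linarith
    · linarith
  · rw [hull_triple a b c' hc'.ne']
    exact ⟨by linarith, hεpos.le, by linarith⟩
  · have : cross (b - a) (a + (1 / 2 * (1 - ε) : ℝ) • (b - a) + ε • (c' - a) - a)
        = ε * cross (b - a) (c' - a) := by
      simp only [cross, PiLp.sub_apply, PiLp.add_apply, PiLp.smul_apply, smul_eq_mul]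
      ring
    rw [this]
    positivity

namespace SpatialMesh

variable {dom : FlowDomain} (mesh : SpatialMesh dom)

open Classical in
/-- A triangle with the edge `{a, b}` is given by its third vertex, which is off the edge. -/
theorem exists_third {a b : Plane} (hab : a ≠ b) {K : Finset Plane} (hK : K ∈ mesh.elements)
    (he : ({a, b} : Finset Plane) ⊆ K) :
    ∃ c, a ≠ c ∧ b ≠ c ∧ K = {a, b, c} ∧ cross (b - a) (c - a) ≠ 0 := by
  obtain ⟨hf, h3⟩ := mesh.mem_elements.1 hK
  obtain ⟨x, y, z, hxy, hxz, hyz, rfl, hD⟩ := exists_triple h3 (mesh.complex.indep hf)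
  have ha : a ∈ ({x, y, z} : Finset Plane) := he (by simp)
  have hb : b ∈ ({x, y, z} : Finset Plane) := he (by simp)
  have p1 : ({y, x, z} : Finset Plane) = {x, y, z} := by ext; simp; tauto
  have p2 : ({x, z, y} : Finset Plane) = {x, y, z} := by ext; simp; tauto
  have p3 : ({z, x, y} : Finset Plane) = {x, y, z} := by ext; simp; tauto
  have p4 : ({y, z, x} : Finset Plane) = {x, y, z} := by ext; simp; tauto
  have p5 : ({z, y, x} : Finset Plane) = {x, y, z} := by ext; simp; tauto
  simp only [Finset.mem_insert, Finset.mem_singleton] at ha hb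
  have hD' : ∀ D : ℝ, (D = cross (y - x) (z - x) ∨ D = -cross (y - x) (z - x)) → D ≠ 0 := by
    rintro D (rfl | rfl)
    · exact hD
    · exact neg_ne_zero.2 hD
  rcases ha with rfl | rfl | rfl <;> rcases hb with rfl | rfl | rfl
  · exact absurd rfl hab
  · exact ⟨z, hxz, hyz, rfl, hD⟩
  · exact ⟨y, hxy, hyz.symm, p2.symm, hD' _ (Or.inr (by simp only [cross, PiLp.sub_apply]; ring))⟩
  · exact ⟨z, hyz, hxz, p1.symm, hD' _ (Or.inr (by simp only [cross, PiLp.sub_apply]; ring))⟩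
  · exact absurd rfl hab
  · exact ⟨x, hxy.symm, hxz.symm, p4.symm,
      hD' _ (Or.inl (by simp only [cross, PiLp.sub_apply]; ring))⟩
  · exact ⟨y, hyz.symm, hxy, p3.symm, hD' _ (Or.inl (by simp only [cross, PiLp.sub_apply]; ring))⟩
  · exact ⟨x, hxz.symm, hxy.symm, p5.symm,
      hD' _ (Or.inr (by simp only [cross, PiLp.sub_apply]; ring))⟩
  · exact absurd rfl hab

open Classical in
/-- On each side of an edge there is at most one triangle. -/
theorem eq_of_same_side {a b c c' : Plane} (hab : a ≠ b)
    (hK : ({a, b, c} : Finset Plane) ∈ mesh.elements)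
    (hK' : ({a, b, c'} : Finset Plane) ∈ mesh.elements)
    (hc : 0 < cross (b - a) (c - a)) (hc' : 0 < cross (b - a) (c' - a)) : c = c' := by
  by_contra hne
  obtain ⟨x, hx, hx', hpos⟩ := exists_common_point hc hc'
  have h := mesh.complex.inter_subset_convexHull (mesh.mem_elements.1 hK).1
    (mesh.mem_elements.1 hK').1 ⟨hx, hx'⟩
  have hca : c ≠ a := by rintro rfl; simp [cross_zero] at hc
  have hcb : c ≠ b := by rintro rfl; simp [cross_self] at hc
  have hsub : ((({a, b, c} : Finset Plane) : Set Plane) ∩ (({a, b, c'} : Finset Plane) : Set Plane))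
      ⊆ {x : Plane | cross (b - a) (x - a) = 0} := by
    rintro y ⟨h1, h2⟩
    simp only [Finset.coe_insert, Finset.coe_singleton, mem_insert_iff, mem_singleton_iff] at h1 h2
    simp only [mem_ofPred_eq]
    rcases h1 with rfl | rfl | rfl
    · simp [cross_zero]
    · exact cross_self _
    · rcases h2 with h | h | h
      · exact absurd h hca
      · exact absurd h hcb
      · exact absurd h hne
  have h0 := convexHull_min hsub (convex_cross_eq a b) h
  simp only [mem_ofPred_eq] at h0
  exact hpos.ne' h0

open Classical in
/-- A triangle that contains a point in the interior of an edge has this edge. -/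
theorem edge_subset_of_mem {a b x : Plane} {K : Finset Plane}
    (he : ({a, b} : Finset Plane) ∈ mesh.complex.faces) (hK : K ∈ mesh.complex.faces)
    (hx : x ∈ openSegment ℝ a b) (hab : a ≠ b) (hxK : x ∈ convexHull ℝ (K : Set Plane)) :
    ({a, b} : Finset Plane) ⊆ K := by
  have hxe : x ∈ convexHull ℝ (({a, b} : Finset Plane) : Set Plane) := by
    rw [Finset.coe_pair, convexHull_pair]
    exact openSegment_subset_segment ℝ a b hx
  have h := mesh.complex.inter_subset_convexHull he hK ⟨hxe, hxK⟩
  have hxa : x ≠ a := by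
    rintro rfl
    exact hab (left_mem_openSegment_iff.1 hx)
  have hxb : x ≠ b := by
    rintro rfl
    exact hab (right_mem_openSegment_iff.1 hx)
  have key : ∀ y : Plane, ((({a, b} : Finset Plane) : Set Plane) ∩ (K : Set Plane)) ⊆ {y} →
      x = y := fun y hy => by
    have := convexHull_min hy (convex_singleton y) h
    exact this
  intro y hy
  by_contra hyK
  simp only [Finset.mem_insert, Finset.mem_singleton] at hy
  rcases hy with rfl | rfl
  · refine hxb (key b ?_)
    rintro z ⟨hz, hzK⟩
    simp only [Finset.coe_insert, Finset.coe_singleton, mem_insert_iff, mem_singleton_iff] at hz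
    rcases hz with rfl | rfl
    · exact absurd hzK hyK
    · rfl
  · refine hxa (key a ?_)
    rintro z ⟨hz, hzK⟩
    simp only [Finset.coe_insert, Finset.coe_singleton, mem_insert_iff, mem_singleton_iff] at hz
    rcases hz with rfl | rfl
    · rfl
    · exact absurd hzK hyK

open Classical in
/-- If there is no triangle on one side of an edge, then the interior of the edge does not meet the
domain. -/
theorem notMem_Omega_of_one_sided {a b : Plane} (hab : a ≠ b)
    (he : ({a, b} : Finset Plane) ∈ mesh.complex.faces)
    (hno : ∀ c, ({a, b, c} : Finset Plane) ∈ mesh.elements → ¬ 0 < cross (b - a) (c - a))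
    {x : Plane} (hx : x ∈ openSegment ℝ a b) : x ∉ dom.Omega := by
  intro hxO
  -- away from the triangles that do not contain `x`, move from `x` to the empty side
  set F : Set Plane := ⋃ K : Finset Plane,
    ⋃ _ : K ∈ mesh.elements.filter (fun K : Finset Plane => x ∉ convexHull ℝ (K : Set Plane)),
      convexHull ℝ (K : Set Plane) with hF
  have hFc : IsClosed F := by
    refine isClosed_biUnion_finset fun K _ => (isCompact_hull K).isClosed
  have hxF : x ∉ F := by
    simp only [hF, mem_iUnion, Finset.mem_filter, exists_prop, not_exists, not_and]
    exact fun K hK => hK.2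
  set ν : Plane := !₂[-(b 1 - a 1), b 0 - a 0] with hν
  have hcont : Continuous fun ε : ℝ => x + ε • ν := by fun_prop
  have hopen : IsOpen (dom.Omega ∩ Fᶜ) := dom.isOpen_Omega.inter hFc.isOpen_compl
  have hev : ∀ᶠ ε in 𝓝 (0 : ℝ), x + ε • ν ∈ dom.Omega ∩ Fᶜ :=
    hcont.continuousAt.eventually_mem (hopen.mem_nhds (by simpa using ⟨hxO, hxF⟩))
  have hev2 : ∀ᶠ ε in 𝓝[>] (0 : ℝ), x + ε • ν ∈ dom.Omega ∩ Fᶜ := hev.filter_mono nhdsWithin_le_nhds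
  obtain ⟨ε, hε, hεpos⟩ := (hev2.and self_mem_nhdsWithin).exists
  have hεpos : 0 < ε := hεpos
  obtain ⟨s, hs, hxs⟩ := mesh.complex.mem_space_iff.1
    (mesh.space_eq ▸ subset_closure hε.1 : x + ε • ν ∈ mesh.complex.space)
  obtain ⟨K, hK, hK3, hsK⟩ := mesh.pure s hs
  have hxK : x + ε • ν ∈ convexHull ℝ (K : Set Plane) :=
    convexHull_mono (by exact_mod_cast hsK) hxs
  have hKel : K ∈ mesh.elements := mesh.mem_elements.2 ⟨hK, hK3⟩
  have hxK' : x ∈ convexHull ℝ (K : Set Plane) := by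
    by_contra hcon
    refine hε.2 ?_
    simp only [hF, mem_iUnion, Finset.mem_filter, exists_prop]
    exact ⟨K, ⟨hKel, hcon⟩, hxK⟩
  obtain ⟨c, hac, hbc, rfl, hD⟩ := mesh.exists_third hab hKel
    (mesh.edge_subset_of_mem he hK hx hab hxK')
  have hc := not_lt.1 (hno c hKel)
  have hsub : (({a, b, c} : Finset Plane) : Set Plane)
      ⊆ {x : Plane | cross (b - a) (x - a) ≤ 0} := by
    intro y hy
    simp only [Finset.coe_insert, Finset.coe_singleton, mem_insert_iff, mem_singleton_iff] at hy
    simp only [mem_ofPred_eq]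
    rcases hy with rfl | rfl | rfl
    · simp [cross_zero]
    · exact (cross_self _).le
    · exact hc
  have h1 := convexHull_min hsub (convex_cross_le a b) hxK
  simp only [mem_ofPred_eq] at h1
  have hx0 : cross (b - a) (x - a) = 0 := by
    obtain ⟨s, t, hs, ht, hst, rfl⟩ := hx
    rw [cross_affine a b a b s t hst, sub_self, cross_zero, cross_self]
    ring
  have h2 : cross (b - a) (x + ε • ν - a) = cross (b - a) (x - a) + ε * ‖b - a‖ ^ 2 := by
    rw [norm_sq_plane]
    simp only [cross, hν, PiLp.sub_apply, PiLp.add_apply, PiLp.smul_apply, smul_eq_mul,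
      Matrix.cons_val_zero, Matrix.cons_val_one]
    ring
  rw [h2, hx0, zero_add] at h1
  have : 0 < ‖b - a‖ := norm_pos_iff.2 (sub_ne_zero.2 hab.symm)
  have : 0 < ε * ‖b - a‖ ^ 2 := by positivity
  linarith

end SpatialMesh

/-- The outward unit normal is determined by the side of the edge on which the triangle lies. -/
theorem normal_eq [DecidableEq Plane] {a b c n : Plane} (hab : a ≠ b) (hac : a ≠ c) (hbc : b ≠ c)
    (hD : cross (b - a) (c - a) ≠ 0) (hn1 : ‖n‖ = 1) (hn2 : inner ℝ n (b - a) = 0)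
    (hn3 : inner ℝ n (c - a) < 0) : normal {a, b, c} {a, b} = n := by
  have hK : ({a, b, c} : Finset Plane) = {c, a, b} := by ext; simp; tauto
  have e2 : cross (a - c) (b - c) = cross (b - a) (c - a) := by
    simp only [cross, PiLp.sub_apply]; ring
  have h := normal_pair hac.symm hbc.symm hab (by rw [e2]; exact hD)
  rw [isOutwardUnitNormal_pair hab hbc.symm hac.symm, ← hK] at h
  obtain ⟨h1, h2, h3⟩ := h
  set m := normal {a, b, c} {a, b}
  have k1 : m 0 ^ 2 + m 1 ^ 2 = 1 := by rw [← norm_sq_plane, h1]; norm_num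
  have k2 : n 0 ^ 2 + n 1 ^ 2 = 1 := by rw [← norm_sq_plane, hn1]; norm_num
  rw [inner_plane] at h2 h3 hn2 hn3
  simp only [PiLp.sub_apply] at h2 h3 hn2 hn3
  -- two unit vectors orthogonal to the same direction are parallel
  have hpar : m 0 * n 1 - m 1 * n 0 = 0 := by
    have z0 : (m 0 * n 1 - m 1 * n 0) * (b 0 - a 0) = 0 := by
      linear_combination n 1 * h2 - m 1 * hn2
    have z1 : (m 0 * n 1 - m 1 * n 0) * (b 1 - a 1) = 0 := by
      linear_combination -n 0 * h2 + m 0 * hn2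
    by_contra hne
    refine hab (plane_ext ?_ ?_)
    · linarith [(mul_eq_zero.1 z0).resolve_left hne]
    · linarith [(mul_eq_zero.1 z1).resolve_left hne]
  set k := m 0 * n 0 + m 1 * n 1
  have hm0 : m 0 = k * n 0 := by linear_combination -m 0 * k2 + n 1 * hpar
  have hm1 : m 1 = k * n 1 := by linear_combination -m 1 * k2 - n 0 * hpar
  have hkk : k ^ 2 = 1 := by
    have : k ^ 2 * (n 0 ^ 2 + n 1 ^ 2) = 1 := by rw [← k1, hm0, hm1]; ring
    rwa [k2, mul_one] at this
  have hkpos : 0 < k := by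
    by_contra hneg
    have h4 : k * (n 0 * (c 0 - a 0) + n 1 * (c 1 - a 1)) < 0 := by
      rw [hm0, hm1] at h3
      linarith
    exact absurd (mul_nonneg_of_nonpos_of_nonpos (not_lt.1 hneg) hn3.le) (not_le.2 h4)
  have hk1 : k = 1 := by
    have h4 : (k - 1) * (k + 1) = 0 := by linear_combination hkk
    linarith [(mul_eq_zero.1 h4).resolve_right (by linarith)]
  exact plane_ext (by rw [hm0, hk1, one_mul]) (by rw [hm1, hk1, one_mul])

/-! ### Sums over the faces of all triangles -/

theorem cross_eq_inner_mul {u w n : Plane} (hn : ‖n‖ = 1) (h : inner ℝ n u = 0) :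
    cross u w = inner ℝ n w * cross u n := by
  have k2 : n 0 ^ 2 + n 1 ^ 2 = 1 := by rw [← norm_sq_plane, hn]; norm_num
  rw [inner_plane] at h ⊢
  simp only [cross]
  linear_combination (-(u 0 * w 1) + u 1 * w 0) * k2 + (n 0 * w 1 - n 1 * w 0) * h

theorem normal_spec_pair [DecidableEq Plane] {a b c : Plane} (hab : a ≠ b) (hac : a ≠ c)
    (hbc : b ≠ c) (hD : cross (b - a) (c - a) ≠ 0) :
    ‖normal {a, b, c} {a, b}‖ = 1 ∧ inner ℝ (normal {a, b, c} {a, b}) (b - a) = 0 ∧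
      inner ℝ (normal {a, b, c} {a, b}) (c - a) < 0 := by
  have hK : ({a, b, c} : Finset Plane) = {c, a, b} := by ext; simp; tauto
  have e2 : cross (a - c) (b - c) = cross (b - a) (c - a) := by
    simp only [cross, PiLp.sub_apply]; ring
  have h := normal_pair hac.symm hbc.symm hab (by rw [e2]; exact hD)
  rwa [isOutwardUnitNormal_pair hab hbc.symm hac.symm, ← hK] at h

namespace SpatialMesh

variable {dom : FlowDomain} (mesh : SpatialMesh dom)

open Classical in
/-- The triangles with a given edge. -/
def trianglesAt (e : Finset Plane) : Finset (Finset Plane) :=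
  mesh.elements.filter (fun K => e ⊆ K)

open Classical in
/-- An edge belongs to two triangles, one on each side, or to a single triangle; in the latter case
its interior does not meet the domain. -/
theorem trianglesAt_cases {a b : Plane} (hab : a ≠ b) (he : ({a, b} : Finset Plane) ∈ mesh.edges) :
    (∃ c c', a ≠ c ∧ b ≠ c ∧ a ≠ c' ∧ b ≠ c' ∧
      0 < cross (b - a) (c - a) ∧ cross (b - a) (c' - a) < 0 ∧
      mesh.trianglesAt {a, b} = {{a, b, c}, {a, b, c'}} ∧
      ({a, b, c} : Finset Plane) ∈ mesh.elements ∧ ({a, b, c'} : Finset Plane) ∈ mesh.elements) ∨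
    (∃ c, a ≠ c ∧ b ≠ c ∧ cross (b - a) (c - a) ≠ 0 ∧ mesh.trianglesAt {a, b} = {{a, b, c}} ∧
      ({a, b, c} : Finset Plane) ∈ mesh.elements ∧
      ∀ x ∈ openSegment ℝ a b, x ∉ dom.Omega) := by
  have hef := (mesh.mem_edges.1 he).1
  have hswap : ∀ c : Plane, ({b, a, c} : Finset Plane) = {a, b, c} := fun c => by
    ext; simp; tauto
  have hneg : ∀ c : Plane, cross (a - b) (c - b) = -cross (b - a) (c - a) := fun c => by
    simp only [cross, PiLp.sub_apply]; ring
  have hpos_unique : ∀ c c', ({a, b, c} : Finset Plane) ∈ mesh.elements →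
      ({a, b, c'} : Finset Plane) ∈ mesh.elements → 0 < cross (b - a) (c - a) →
      0 < cross (b - a) (c' - a) → c = c' := fun c c' h h' => mesh.eq_of_same_side hab h h'
  have hneg_unique : ∀ c c', ({a, b, c} : Finset Plane) ∈ mesh.elements →
      ({a, b, c'} : Finset Plane) ∈ mesh.elements → cross (b - a) (c - a) < 0 →
      cross (b - a) (c' - a) < 0 → c = c' := fun c c' h h' h1 h2 =>
    mesh.eq_of_same_side hab.symm (by rwa [hswap]) (by rwa [hswap])
      (by rw [hneg]; linarith) (by rw [hneg]; linarith)
  have hmem : ∀ K, K ∈ mesh.trianglesAt {a, b} ↔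
      ∃ c, a ≠ c ∧ b ≠ c ∧ K = {a, b, c} ∧ cross (b - a) (c - a) ≠ 0 ∧
        ({a, b, c} : Finset Plane) ∈ mesh.elements := by
    intro K
    rw [trianglesAt, Finset.mem_filter]
    constructor
    · rintro ⟨hK, hsub⟩
      obtain ⟨c, h1, h2, rfl, h3⟩ := mesh.exists_third hab hK hsub
      exact ⟨c, h1, h2, rfl, h3, hK⟩
    · rintro ⟨c, h1, h2, rfl, h3, hK⟩
      exact ⟨hK, by intro x; simp; tauto⟩
  by_cases hp : ∃ c, ({a, b, c} : Finset Plane) ∈ mesh.elements ∧ 0 < cross (b - a) (c - a)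
  · obtain ⟨c, hc, hcp⟩ := hp
    have hac : a ≠ c := by rintro rfl; simp [cross_zero] at hcp
    have hbc : b ≠ c := by rintro rfl; simp [cross_self] at hcp
    by_cases hm : ∃ c, ({a, b, c} : Finset Plane) ∈ mesh.elements ∧ cross (b - a) (c - a) < 0
    · obtain ⟨c', hc', hcm⟩ := hm
      have hac' : a ≠ c' := by rintro rfl; simp [cross_zero] at hcm
      have hbc' : b ≠ c' := by rintro rfl; simp [cross_self] at hcm
      refine Or.inl ⟨c, c', hac, hbc, hac', hbc', hcp, hcm, ?_, hc, hc'⟩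
      ext K
      rw [hmem, Finset.mem_insert, Finset.mem_singleton]
      constructor
      · rintro ⟨d, _, _, rfl, hd, hdK⟩
        rcases lt_or_gt_of_ne hd with h | h
        · rw [hneg_unique d c' hdK hc' h hcm]; exact Or.inr rfl
        · rw [hpos_unique d c hdK hc h hcp]; exact Or.inl rfl
      · rintro (rfl | rfl)
        · exact ⟨c, hac, hbc, rfl, hcp.ne', hc⟩
        · exact ⟨c', hac', hbc', rfl, hcm.ne, hc'⟩
    · refine Or.inr ⟨c, hac, hbc, hcp.ne', ?_, hc, fun x hx => ?_⟩
      · ext K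
        rw [hmem, Finset.mem_singleton]
        constructor
        · rintro ⟨d, _, _, rfl, hd, hdK⟩
          rcases lt_or_gt_of_ne hd with h | h
          · exact absurd ⟨d, hdK, h⟩ hm
          · rw [hpos_unique d c hdK hc h hcp]
        · rintro rfl
          exact ⟨c, hac, hbc, rfl, hcp.ne', hc⟩
      · refine mesh.notMem_Omega_of_one_sided hab.symm (by rwa [Finset.pair_comm]) ?_
          (by rwa [openSegment_symm])
        intro d hd hd'
        rw [hswap] at hd
        rw [hneg] at hd'
        exact hm ⟨d, hd, by linarith⟩
  · obtain ⟨K, hKf, hK3, hsub⟩ := mesh.pure _ hef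
    have hK : K ∈ mesh.elements := mesh.mem_elements.2 ⟨hKf, hK3⟩
    obtain ⟨c, hac, hbc, rfl, hD⟩ := mesh.exists_third hab hK hsub
    have hcm : cross (b - a) (c - a) < 0 :=
      lt_of_le_of_ne (not_lt.1 fun h => hp ⟨c, hK, h⟩) hD
    refine Or.inr ⟨c, hac, hbc, hD, ?_, hK, fun x hx => ?_⟩
    · ext K'
      rw [hmem, Finset.mem_singleton]
      constructor
      · rintro ⟨d, _, _, rfl, hd, hdK⟩
        rcases lt_or_gt_of_ne hd with h | h
        · rw [hneg_unique d c hdK hK h hcm]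
        · exact absurd ⟨d, hdK, h⟩ hp
      · rintro rfl
        exact ⟨c, hac, hbc, rfl, hD, hK⟩
    · exact mesh.notMem_Omega_of_one_sided hab hef (fun d hd hd' => hp ⟨d, hd, hd'⟩) hx

theorem mem_closedOmega {K : Finset Plane} (hK : K ∈ mesh.complex.faces) {x : Plane} (hx : x ∈ K) :
    x ∈ dom.closedOmega :=
  dom.closure_subset (mesh.hull_subset hK (subset_convexHull ℝ _ hx))

open Classical in
/-- An edge on a supporting line of the domain belongs to one triangle, whose normal is that of the
line. -/
theorem sum_trianglesAt_of_support {a b n : Plane} (hab : a ≠ b)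
    (he : ({a, b} : Finset Plane) ∈ mesh.edges) {κ : ℝ} (hn : ‖n‖ = 1)
    (hκ : ∀ x ∈ dom.closedOmega, inner ℝ n x ≤ κ) (ha : inner ℝ n a = κ) (hb : inner ℝ n b = κ)
    (Ψ : Plane → ℝ) :
    ∑ K ∈ mesh.trianglesAt {a, b}, Ψ (normal K {a, b}) = Ψ n := by
  have hba : inner ℝ n (b - a) = 0 := by rw [inner_sub_right, ha, hb, sub_self]
  have hle : ∀ c, ({a, b, c} : Finset Plane) ∈ mesh.elements → inner ℝ n (c - a) ≤ 0 := by
    intro c hc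
    rw [inner_sub_right, ha]
    linarith [hκ c (mesh.mem_closedOmega (mesh.mem_elements.1 hc).1 (by simp))]
  rcases mesh.trianglesAt_cases hab he with
    ⟨c, c', hac, hbc, hac', hbc', hp, hm, htr, hc, hc'⟩ | ⟨c, hac, hbc, hD, htr, hc, -⟩
  · exfalso
    rw [cross_eq_inner_mul hn hba] at hp hm
    have h1 := hle c hc
    have h2 := hle c' hc'
    rcases le_or_gt (cross (b - a) n) 0 with h | h
    · exact absurd (mul_nonneg_of_nonpos_of_nonpos h2 h) (not_le.2 hm)
    · exact absurd (mul_nonpos_of_nonpos_of_nonneg h1 h.le) (not_le.2 hp)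
  · rw [htr, Finset.sum_singleton]
    congr 1
    refine normal_eq hab hac hbc hD hn hba (lt_of_le_of_ne (hle c hc) fun h => hD ?_)
    rw [cross_eq_inner_mul hn hba, h, zero_mul]

/-- The edge lies on the left periodic boundary. -/
def IsLeft (dom : FlowDomain) (e : Finset Plane) : Prop := ∀ x ∈ e, x 0 = dom.L

/-- The edge lies on the right periodic boundary. -/
def IsRight (dom : FlowDomain) (e : Finset Plane) : Prop := ∀ x ∈ e, x 0 = dom.R

open Classical in
/-- The sum over the faces of all triangles of a quantity that is odd in the normal vector and that
vanishes on the bottom only has contributions from the free surface and the periodic boundaries. -/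
theorem sum_faces (Ψ : Finset Plane → Plane → ℝ) (hodd : ∀ e n, Ψ e (-n) = -Ψ e n)
    (hbottom : ∀ a b, a ≠ b → ({a, b} : Finset Plane) ∈ mesh.edges →
      (∀ x ∈ openSegment ℝ a b, (dom.L < x 0 ∧ x 0 < dom.R) ∧ x 1 = -dom.H + dom.b (x 0)) →
      ∀ n : Plane, inner ℝ n (b - a) = 0 → Ψ {a, b} n = 0) :
    ∑ K ∈ mesh.elements, ∑ e ∈ edgesOf K, Ψ e (normal K e)
      = ∑ e ∈ mesh.surfaceEdges, Ψ e (EuclideanSpace.single 1 1)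
        - ∑ e ∈ mesh.edges.filter (IsLeft dom), Ψ e (EuclideanSpace.single 0 1)
        + ∑ e ∈ mesh.edges.filter (IsRight dom), Ψ e (EuclideanSpace.single 0 1) := by
  have hswap : ∑ K ∈ mesh.elements, ∑ e ∈ edgesOf K, Ψ e (normal K e)
      = ∑ e ∈ mesh.edges, ∑ K ∈ mesh.trianglesAt e, Ψ e (normal K e) := by
    refine Finset.sum_comm' fun K e => ?_
    rw [trianglesAt, Finset.mem_filter]
    constructor
    · rintro ⟨hK, he⟩
      exact ⟨⟨hK, (Finset.mem_powersetCard.1 he).1⟩, mesh.edge_of_element hK he⟩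
    · rintro ⟨⟨hK, hsub⟩, he⟩
      exact ⟨hK, Finset.mem_powersetCard.2 ⟨hsub, (mesh.mem_edges.1 he).2⟩⟩
  rw [hswap, surfaceEdges, Finset.sum_filter, Finset.sum_filter, Finset.sum_filter,
    ← Finset.sum_sub_distrib, ← Finset.sum_add_distrib]
  refine Finset.sum_congr rfl fun e he => ?_
  obtain ⟨a, b, hab, rfl⟩ := exists_pair (mesh.mem_edges.1 he).2
  have hef := (mesh.mem_edges.1 he).1
  have hmema := mesh.mem_closedOmega hef (x := a) (by simp)
  have hmemb := mesh.mem_closedOmega hef (x := b) (by simp)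
  have hS : (∀ x ∈ ({a, b} : Finset Plane), x 1 = 0) ↔ a 1 = 0 ∧ b 1 = 0 := by simp
  have hL : IsLeft dom {a, b} ↔ a 0 = dom.L ∧ b 0 = dom.L := by simp [IsLeft]
  have hR : IsRight dom {a, b} ↔ a 0 = dom.R ∧ b 0 = dom.R := by simp [IsRight]
  simp only [hS, hL, hR]
  have hLR := dom.L_lt_R
  have hn1 : ∀ i : Fin 2, ‖(EuclideanSpace.single i 1 : Plane)‖ = 1 := fun i => by simp
  by_cases h1 : a 1 = 0 ∧ b 1 = 0
  · have h2 : ¬ (a 0 = dom.L ∧ b 0 = dom.L) := fun h =>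
      hab (plane_ext (h.1.trans h.2.symm) (h1.1.trans h1.2.symm))
    have h3 : ¬ (a 0 = dom.R ∧ b 0 = dom.R) := fun h =>
      hab (plane_ext (h.1.trans h.2.symm) (h1.1.trans h1.2.symm))
    rw [if_pos h1, if_neg h2, if_neg h3, sub_zero, add_zero]
    refine mesh.sum_trianglesAt_of_support hab he (κ := 0) (hn1 1) (fun x hx => ?_) ?_ ?_ (Ψ {a, b})
    · rw [inner_plane]; simpa using hx.2.2
    · rw [inner_plane]; simpa using h1.1
    · rw [inner_plane]; simpa using h1.2
  by_cases h2 : a 0 = dom.L ∧ b 0 = dom.L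
  · have h3 : ¬ (a 0 = dom.R ∧ b 0 = dom.R) := fun h => hLR.ne (h2.1.symm.trans h.1)
    rw [if_neg h1, if_pos h2, if_neg h3, add_zero, zero_sub, ← hodd]
    refine mesh.sum_trianglesAt_of_support hab he (κ := -dom.L) (by rw [norm_neg, hn1])
      (fun x hx => ?_) ?_ ?_ (Ψ {a, b})
    · rw [inner_plane]; simpa using hx.1.1
    · rw [inner_plane]; simpa using h2.1
    · rw [inner_plane]; simpa using h2.2
  by_cases h3 : a 0 = dom.R ∧ b 0 = dom.R
  · rw [if_neg h1, if_neg h2, if_pos h3, sub_zero, zero_add]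
    refine mesh.sum_trianglesAt_of_support hab he (κ := dom.R) (hn1 0) (fun x hx => ?_) ?_ ?_
      (Ψ {a, b})
    · rw [inner_plane]; simpa using hx.1.2
    · rw [inner_plane]; simpa using h3.1
    · rw [inner_plane]; simpa using h3.2
  rw [if_neg h1, if_neg h2, if_neg h3, sub_zero, add_zero]
  rcases mesh.trianglesAt_cases hab he with
    ⟨c, c', hac, hbc, hac', hbc', hp, hm, htr, hc, hc'⟩ | ⟨c, hac, hbc, hD, htr, hc, hout⟩
  · -- the two normals are opposite to each other
    have hne : ({a, b, c} : Finset Plane) ≠ {a, b, c'} := by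
      intro h
      have : c ∈ ({a, b, c'} : Finset Plane) := h ▸ (by simp)
      simp only [Finset.mem_insert, Finset.mem_singleton] at this
      rcases this with h | h | h
      · exact hac h.symm
      · exact hbc h.symm
      · rw [h] at hp; linarith
    obtain ⟨m1, m2, m3⟩ := normal_spec_pair hab hac' hbc' hm.ne
    rw [htr, Finset.sum_pair hne]
    have : normal {a, b, c} {a, b} = -normal {a, b, c'} {a, b} := by
      refine normal_eq hab hac hbc hp.ne' (by rw [norm_neg, m1])
        (by rw [inner_neg_left, m2, neg_zero]) ?_
      rw [inner_neg_left, neg_lt_zero]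
      rw [cross_eq_inner_mul m1 m2] at hp hm
      have hpos : 0 < cross (b - a) (normal {a, b, c'} {a, b}) := by
        by_contra h
        exact absurd (mul_nonneg_of_nonpos_of_nonpos m3.le (not_lt.1 h)) (not_le.2 hm)
      exact pos_of_mul_pos_left hp hpos.le
    rw [this, hodd, neg_add_cancel]
  · rw [htr, Finset.sum_singleton]
    refine hbottom a b hab he (fun x hx => ?_) _ (normal_spec_pair hab hac hbc hD).2.1
    have hxO := hout x hx
    have hxc : x ∈ dom.closedOmega := by
      refine dom.closure_subset (mesh.hull_subset hef ?_)
      rw [Finset.coe_pair, convexHull_pair]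
      exact openSegment_subset_segment ℝ a b hx
    obtain ⟨s, t, hs, ht, hst, hxst⟩ := hx
    have hx0 : x 0 = s * a 0 + t * b 0 := by rw [← hxst]; simp
    have hx1 : x 1 = s * a 1 + t * b 1 := by rw [← hxst]; simp
    -- an affine function that attains its extremum inside the edge is constant on it
    have ext_const : ∀ α β γ : ℝ, α ≤ γ → β ≤ γ → s * α + t * β = γ → α = γ ∧ β = γ := by
      intro α β γ h1 h2 h3
      have e1 : s * (γ - α) + t * (γ - β) = 0 := by linear_combination γ * hst - h3
      have e2 := mul_nonneg hs.le (sub_nonneg.2 h1)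
      have e3 := mul_nonneg ht.le (sub_nonneg.2 h2)
      have e4 := (mul_eq_zero.1 (by linarith : s * (γ - α) = 0)).resolve_left hs.ne'
      have e5 := (mul_eq_zero.1 (by linarith : t * (γ - β) = 0)).resolve_left ht.ne'
      exact ⟨by linarith, by linarith⟩
    have i1 : x 0 ≠ dom.L := by
      intro h
      have := ext_const (-a 0) (-b 0) (-dom.L) (by linarith [hmema.1.1]) (by linarith [hmemb.1.1])
        (by linarith)
      exact h2 ⟨by linarith [this.1], by linarith [this.2]⟩
    have i2 : x 0 ≠ dom.R := fun h =>
      h3 (ext_const (a 0) (b 0) dom.R hmema.1.2 hmemb.1.2 (by linarith))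
    have i3 : x 1 ≠ 0 := fun h =>
      h1 (ext_const (a 1) (b 1) 0 hmema.2.2 hmemb.2.2 (by linarith))
    have j1 := lt_of_le_of_ne hxc.1.1 i1.symm
    have j2 := lt_of_le_of_ne hxc.1.2 i2
    have j3 := lt_of_le_of_ne hxc.2.2 i3
    refine ⟨⟨j1, j2⟩, le_antisymm (not_lt.1 fun h => hxO ⟨j1, j2, h, j3⟩) hxc.2.1⟩

end SpatialMesh

/-! ### Periodicity -/

/-- The edge translated by `s`. -/
def translate (s : Plane) (e : Finset Plane) : Finset Plane := e.map (Equiv.addRight s).toEmbedding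

theorem coe_translate (s : Plane) (e : Finset Plane) :
    ((translate s e : Finset Plane) : Set Plane) = (fun x => x + s) '' (e : Set Plane) := by
  simp [translate]

theorem hull_translate (s : Plane) (e : Finset Plane) :
    convexHull ℝ ((translate s e : Finset Plane) : Set Plane)
      = (fun x => x + s) '' convexHull ℝ (e : Set Plane) := by
  rw [coe_translate]
  have h := (AffineEquiv.constVAdd ℝ Plane s).toAffineMap.image_convexHull (e : Set Plane)
  have h2 : ((AffineEquiv.constVAdd ℝ Plane s).toAffineMap : Plane → Plane) = fun x => x + s := by
    funext x
    simp [add_comm]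
  rw [h2] at h
  exact h.symm

theorem translate_translate_neg (s : Plane) (e : Finset Plane) :
    translate s (translate (-s) e) = e := by
  ext x
  simp [translate]

theorem translate_neg_translate (s : Plane) (e : Finset Plane) :
    translate (-s) (translate s e) = e := by
  ext x
  simp [translate]

theorem card_translate (s : Plane) (e : Finset Plane) : (translate s e).card = e.card :=
  Finset.card_map _

theorem measurePreserving_translate (s : Plane) (e : Finset Plane) :
    MeasurePreserving (fun x => x + s) (arc e) (arc (translate s e)) := by
  have h := (IsometryEquiv.addRight s).measurePreserving_hausdorffMeasure (1 : ℝ)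
  have h2 := h.restrict_preimage_emb (IsometryEquiv.addRight s).toHomeomorph.measurableEmbedding
    (convexHull ℝ ((translate s e : Finset Plane) : Set Plane))
  have h3 : (IsometryEquiv.addRight s) ⁻¹' (convexHull ℝ ((translate s e : Finset Plane) : Set Plane))
      = convexHull ℝ (e : Set Plane) := by
    rw [hull_translate]
    exact preimage_image_eq _ (add_left_injective s)
  rw [h3] at h2
  exact h2

theorem integral_translate {θ : Measure ℝ} (hθ : CompactlyCarried θ) (s : Plane) {e : Finset Plane}
    (he : e.card = 2) (g : SpaceTime → ℝ) :
    ∫ z, g z ∂(θ.prod (arc (translate s e))) = ∫ z, g (z.1, z.2 + s) ∂(θ.prod (arc e)) := by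
  have := hθ.finite
  have := (compactlyCarried_arc he).finite
  have := (compactlyCarried_arc ((card_translate s e).trans he)).finite
  have h := (MeasurePreserving.id θ).prod (measurePreserving_translate s e)
  have hemb : MeasurableEmbedding (Prod.map id (fun x : Plane => x + s) : SpaceTime → SpaceTime) :=
    ((Homeomorph.refl ℝ).prodCongr (Homeomorph.addRight s)).measurableEmbedding
  exact (h.integral_comp hemb g).symm

theorem localM_translate {p : ℕ} {e : Finset Plane} (s : Plane) {μ : SpaceTime → ℝ}
    (hμ : μ ∈ localM p e) : (fun z => μ (z.1, z.2 - s)) ∈ localM p (translate s e) := by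
  intro x hx y hy
  simp only [translate, Finset.mem_map, Equiv.coe_toEmbedding, Equiv.coe_addRight] at hx hy
  obtain ⟨x, hx, rfl⟩ := hx
  obtain ⟨y, hy, rfl⟩ := hy
  obtain ⟨c, hc⟩ := hμ x hx y hy
  refine ⟨c, fun t r hr => ?_⟩
  rw [← hc t r hr]
  simp only [AffineMap.lineMap_apply, vsub_eq_sub, vadd_eq_add, add_sub_add_right_eq_sub]
  congr 2
  abel

theorem arc_ae_mem_hull {θ : Measure ℝ} (hθ : CompactlyCarried θ) {e : Finset Plane}
    (he : e.card = 2) : ∀ᵐ z ∂(θ.prod (arc e)), z.2 ∈ convexHull ℝ (e : Set Plane) := by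
  have := hθ.finite
  have := (compactlyCarried_arc he).finite
  exact Measure.quasiMeasurePreserving_snd.ae (ae_restrict_mem (measurableSet_hull e))

theorem ae_slab_of_ae {P : ℝ × ℝ → Prop} {T A B t₀ t₁ u w : ℝ}
    (h : ∀ᵐ z ∂((volume.restrict (Ioo 0 T)).prod (volume.restrict (Ioo A B))), P z)
    (h0 : 0 ≤ t₀) (h1 : t₁ ≤ T) (hu : A ≤ u) (hw : w ≤ B) :
    ∀ᵐ z ∂((during t₀ t₁).prod (volume.restrict (Ioo u w))), P z := by
  refine ae_mono ?_ h
  exact Measure.prod_mono (during_mono h0 h1) (Measure.restrict_mono (Ioo_subset_Ioo hu hw) le_rfl)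

theorem hull_vertical [DecidableEq Plane] {a b : Plane} {k : ℝ} (ha : a 0 = k) (hb : b 0 = k)
    (hab : a 1 ≤ b 1) : convexHull ℝ (({a, b} : Finset Plane) : Set Plane)
      = (fun s : ℝ => !₂[k, 0] + s • (!₂[0, 1] : Plane)) '' Icc (a 1) (b 1) := by
  rw [← hull_affine_pair _ _ hab]
  congr
  · exact plane_ext (by simp [ha]) (by simp)
  · exact plane_ext (by simp [hb]) (by simp)

theorem hull_horizontal [DecidableEq Plane] {a b : Plane} (ha : a 1 = 0) (hb : b 1 = 0)
    (hab : a 0 ≤ b 0) : convexHull ℝ (({a, b} : Finset Plane) : Set Plane)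
      = (fun s : ℝ => 0 + s • (!₂[1, 0] : Plane)) '' Icc (a 0) (b 0) := by
  rw [← hull_affine_pair _ _ hab]
  congr
  · exact plane_ext (by simp) (by simp [ha])
  · exact plane_ext (by simp) (by simp [hb])

theorem vertical_ne_zero : (!₂[0, 1] : Plane) ≠ 0 := fun h => by
  simpa using congrArg (fun x : Plane => x 1) h

theorem horizontal_ne_zero (m : ℝ) : (!₂[1, m] : Plane) ≠ 0 := fun h => by
  simpa using congrArg (fun x : Plane => x 0) h

namespace SpatialMesh

variable {dom : FlowDomain} (mesh : SpatialMesh dom)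

theorem translate_right {e : Finset Plane} (he : e ∈ mesh.edges) (hL : IsLeft dom e) :
    translate dom.shift e ∈ mesh.edges ∧ IsRight dom (translate dom.shift e) := by
  obtain ⟨hf, hc⟩ := mesh.mem_edges.1 he
  refine ⟨mesh.mem_edges.2 ⟨mesh.periodic_right e hf hc hL, (card_translate _ _).trans hc⟩, ?_⟩
  intro x hx
  simp only [translate, Finset.mem_map, Equiv.coe_toEmbedding, Equiv.coe_addRight] at hx
  obtain ⟨y, hy, rfl⟩ := hx
  simp [FlowDomain.shift, hL y hy]

theorem translate_left {e : Finset Plane} (he : e ∈ mesh.edges) (hR : IsRight dom e) :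
    translate (-dom.shift) e ∈ mesh.edges ∧ IsLeft dom (translate (-dom.shift) e) := by
  obtain ⟨hf, hc⟩ := mesh.mem_edges.1 he
  refine ⟨mesh.mem_edges.2 ⟨mesh.periodic_left e hf hc hR, (card_translate _ _).trans hc⟩, ?_⟩
  intro x hx
  simp only [translate, Finset.mem_map, Equiv.coe_toEmbedding, Equiv.coe_addRight] at hx
  obtain ⟨y, hy, rfl⟩ := hx
  simp [FlowDomain.shift, hR y hy]

end SpatialMesh

section Exact

variable {dom : FlowDomain} {mesh : SpatialMesh dom} {T : ℝ} {N : ℕ} {q : SpaceTime → Plane}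
  {v : SpaceTime → ℝ}

open Classical in
/-- The exact solution takes the same values on the two periodic boundaries. -/
theorem IsExactSolution.ae_periodic (hqv : IsExactSolution mesh T N q v) {t₀ t₁ : ℝ} (h0 : 0 ≤ t₀)
    (h1 : t₁ ≤ T) {e : Finset Plane} (he : e ∈ mesh.edges) (hL : SpatialMesh.IsLeft dom e) :
    ∀ᵐ z ∂((during t₀ t₁).prod (arc e)), v (z.1, z.2 + dom.shift) = v z ∧
      q (z.1, z.2 + dom.shift) 0 = q z 0 := by
  obtain ⟨a, b, hab, rfl⟩ := exists_pair (mesh.mem_edges.1 he).2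
  have hef := (mesh.mem_edges.1 he).1
  wlog hle : a 1 ≤ b 1 generalizing a b
  · rw [Finset.pair_comm] at he hL hef ⊢
    exact this b a hab.symm he hL hef (le_of_not_ge hle)
  have ha : a 0 = dom.L := hL a (by simp)
  have hb : b 0 = dom.L := hL b (by simp)
  have hmema := mesh.mem_closedOmega hef (x := a) (by simp)
  have hmemb := mesh.mem_closedOmega hef (x := b) (by simp)
  have hull := hull_vertical ha hb hle
  rw [ae_prod_arc (compactlyCarried_during t₀ t₁) vertical_ne_zero hull]
  have hp := ae_slab_of_ae hqv.periodic h0 h1 (u := a 1) (w := b 1)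
    (by have := hmema.2.1; rwa [ha] at this) hmemb.2.2
  filter_upwards [hp] with w hw
  have e1 : !₂[dom.L, 0] + w.2 • (!₂[0, 1] : Plane) = !₂[dom.L, w.2] :=
    plane_ext (by simp) (by simp)
  have e2 : !₂[dom.L, w.2] + dom.shift = !₂[dom.R, w.2] :=
    plane_ext (by simp [FlowDomain.shift]) (by simp [FlowDomain.shift])
  simp only [e1, e2]
  exact ⟨hw.1.symm, hw.2.symm⟩

open Classical in
/-- The exact flux vanishes on the bottom. -/
theorem IsExactSolution.ae_bottom (hqv : IsExactSolution mesh T N q v) {t₀ t₁ : ℝ} (h0 : 0 ≤ t₀)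
    (h1 : t₁ ≤ T) {a b : Plane} (hab : a ≠ b)
    (hbot : ∀ x ∈ openSegment ℝ a b, (dom.L < x 0 ∧ x 0 < dom.R) ∧ x 1 = -dom.H + dom.b (x 0))
    {n : Plane} (hn : inner ℝ n (b - a) = 0) :
    ∀ᵐ z ∂((during t₀ t₁).prod (arc {a, b})), inner ℝ (q z) n = 0 := by
  wlog hle : a 0 ≤ b 0 generalizing a b
  · rw [Finset.pair_comm]
    refine this hab.symm (by rwa [openSegment_symm]) ?_ (le_of_not_ge hle)
    rw [← neg_sub, inner_neg_right, hn, neg_zero]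
  have hseg : ∀ s ∈ Ioo (0 : ℝ) 1, a + s • (b - a) ∈ openSegment ℝ a b := by
    intro s hs
    rw [openSegment_eq_image']
    exact ⟨s, hs, rfl⟩
  have hlt : a 0 < b 0 := by
    refine lt_of_le_of_ne hle fun heq => hab ?_
    have k1 := (hbot _ (hseg (1 / 3) ⟨by norm_num, by norm_num⟩)).2
    have k2 := (hbot _ (hseg (2 / 3) ⟨by norm_num, by norm_num⟩)).2
    simp only [PiLp.add_apply, PiLp.smul_apply, PiLp.sub_apply, smul_eq_mul, heq, sub_self,
      mul_zero, add_zero] at k1 k2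
    exact plane_ext heq (by linarith)
  have hpos : 0 < b 0 - a 0 := sub_pos.2 hlt
  -- the edge is the graph of an affine function over an interval of the horizontal axis
  set m := (b 1 - a 1) / (b 0 - a 0) with hm
  have hmm : m * (b 0 - a 0) = b 1 - a 1 := div_mul_cancel₀ _ hpos.ne'
  set c : Plane := !₂[0, a 1 - m * a 0] with hc
  have hull : convexHull ℝ (({a, b} : Finset Plane) : Set Plane)
      = (fun s : ℝ => c + s • (!₂[1, m] : Plane)) '' Icc (a 0) (b 0) := by
    rw [← hull_affine_pair _ _ hlt.le]
    congr
    · exact plane_ext (by simp [hc]) (by simp [hc]; ring)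
    · refine plane_ext (by simp [hc]) ?_
      simp only [hc, PiLp.add_apply, PiLp.smul_apply, smul_eq_mul, Matrix.cons_val_one]
      simp only [Matrix.cons_val_fin_one]
      linear_combination -hmm
  have hgraph : ∀ y ∈ Ioo (a 0) (b 0), (dom.L < y ∧ y < dom.R) ∧
      a 1 - m * a 0 + y * m = -dom.H + dom.b y := by
    intro y hy
    have hs : (y - a 0) / (b 0 - a 0) ∈ Ioo (0 : ℝ) 1 :=
      ⟨div_pos (sub_pos.2 hy.1) hpos, (div_lt_one hpos).2 (by linarith [hy.2])⟩
    have h := hbot _ (hseg _ hs)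
    have e0 : (a + ((y - a 0) / (b 0 - a 0)) • (b - a)) 0 = y := by
      simp only [PiLp.add_apply, PiLp.smul_apply, PiLp.sub_apply, smul_eq_mul]
      rw [div_mul_cancel₀ _ hpos.ne']; ring
    have e1 : (a + ((y - a 0) / (b 0 - a 0)) • (b - a)) 1 = a 1 - m * a 0 + y * m := by
      simp only [PiLp.add_apply, PiLp.smul_apply, PiLp.sub_apply, smul_eq_mul, hm]
      ring
    rwa [e0, e1] at h
  have hLa : dom.L ≤ a 0 := by
    by_contra hcon
    have hcon := not_le.1 hcon
    have h1 := (hgraph ((a 0 + min (b 0) dom.L) / 2)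
      ⟨by linarith [lt_min hlt hcon], by linarith [min_le_left (b 0) dom.L]⟩).1.1
    linarith [min_le_right (b 0) dom.L]
  have hRb : b 0 ≤ dom.R := by
    by_contra hcon
    have hcon := not_le.1 hcon
    have h1 := (hgraph ((b 0 + max (a 0) dom.R) / 2)
      ⟨by linarith [le_max_left (a 0) dom.R], by linarith [max_lt hlt hcon]⟩).1.2
    linarith [le_max_right (a 0) dom.R]
  rw [ae_prod_arc (compactlyCarried_during t₀ t₁) (horizontal_ne_zero m) hull]
  have hp := ae_slab_of_ae hqv.bottom h0 h1 hLa hRb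
  have := (compactlyCarried_during t₀ t₁).finite
  have hmem : ∀ᵐ w ∂((during t₀ t₁).prod (volume.restrict (Ioo (a 0) (b 0)))),
      w.2 ∈ Ioo (a 0) (b 0) :=
    Measure.quasiMeasurePreserving_snd.ae (ae_restrict_mem measurableSet_Ioo)
  filter_upwards [hp, hmem] with w hw hy
  have hg := hgraph w.2 hy
  have hder : deriv dom.b w.2 = m := by
    have hev : dom.b =ᶠ[𝓝 w.2] fun y => dom.H + (a 1 - m * a 0) + y * m := by
      filter_upwards [isOpen_Ioo.mem_nhds hy] with y hy
      linarith [(hgraph y hy).2]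
    rw [hev.deriv_eq]
    exact (((hasDerivAt_id w.2).mul_const m).const_add _).deriv.trans (by simp)
  have epoint : (!₂[w.2, -dom.H + dom.b w.2] : Plane) = c + w.2 • (!₂[1, m] : Plane) := by
    refine plane_ext (by simp [hc]) ?_
    simp only [hc, PiLp.add_apply, PiLp.smul_apply, smul_eq_mul, Matrix.cons_val_one,
      Matrix.cons_val_fin_one]
    linarith [hg.2]
  rw [hder, epoint] at hw
  rw [inner_plane] at hn ⊢
  simp only [PiLp.sub_apply] at hn
  have hn0 : n 0 = -m * n 1 := by
    apply mul_right_cancel₀ hpos.ne'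
    linear_combination hn + n 1 * hmm
  rw [hn0]
  linear_combination -n 1 * hw

open Classical in
/-- Tested with a function of the trace space, the exact flux through all faces reduces to the flux
through the free surface. -/
theorem IsExactSolution.sum_flux (hqv : IsExactSolution mesh T N q v) {t₀ t₁ : ℝ} (h0 : 0 ≤ t₀)
    (h1 : t₁ ≤ T) {p : ℕ} {μ : Finset Plane → SpaceTime → ℝ} (hμ : μ ∈ spaceM mesh p)
    (f : ℝ → ℝ) :
    ∑ K ∈ mesh.elements, ∑ e ∈ edgesOf K,
        ∫ z, inner ℝ (q z) (normal K e) * (μ e z * f z.1) ∂((during t₀ t₁).prod (arc e))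
      = ∑ e ∈ mesh.surfaceEdges, ∫ z, q z 1 * (μ e z * f z.1) ∂((during t₀ t₁).prod (arc e)) := by
  have hθ := compactlyCarried_during t₀ t₁
  have h := mesh.sum_faces (fun e n => ∫ z, inner ℝ (q z) n * (μ e z * f z.1)
    ∂((during t₀ t₁).prod (arc e))) ?_ ?_
  · rw [h]
    have e1 : ∀ e ∈ mesh.surfaceEdges,
        ∫ z, inner ℝ (q z) (EuclideanSpace.single 1 1 : Plane) * (μ e z * f z.1)
          ∂((during t₀ t₁).prod (arc e))
        = ∫ z, q z 1 * (μ e z * f z.1) ∂((during t₀ t₁).prod (arc e)) := by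
      intro e _
      simp [inner_plane]
    have hpair : ∑ e ∈ mesh.edges.filter (SpatialMesh.IsLeft dom),
        ∫ z, inner ℝ (q z) (EuclideanSpace.single 0 1 : Plane) * (μ e z * f z.1)
          ∂((during t₀ t₁).prod (arc e))
        = ∑ e ∈ mesh.edges.filter (SpatialMesh.IsRight dom),
        ∫ z, inner ℝ (q z) (EuclideanSpace.single 0 1 : Plane) * (μ e z * f z.1)
          ∂((during t₀ t₁).prod (arc e)) := by
      refine Finset.sum_bij (fun e _ => translate dom.shift e) ?_ ?_ ?_ ?_
      · intro e he
        rw [Finset.mem_filter] at he ⊢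
        exact mesh.translate_right he.1 he.2
      · intro e _ e' _ h
        rw [← translate_neg_translate dom.shift e, h, translate_neg_translate]
      · intro e he
        rw [Finset.mem_filter] at he
        exact ⟨_, Finset.mem_filter.2 (mesh.translate_left he.1 he.2),
          translate_translate_neg _ _⟩
      · intro e he
        rw [Finset.mem_filter] at he
        have hcard := (mesh.mem_edges.1 he.1).2
        rw [integral_translate hθ _ hcard]
        refine integral_congr_ae ?_
        filter_upwards [hqv.ae_periodic h0 h1 he.1 he.2, arc_ae_mem_hull hθ hcard] with z hz hzm
        have hm := hμ.2 e he.1 he.2 z.1 z.2 hzm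
        simp only [inner_plane]
        change (q z 0 * _ + q z 1 * _) * (μ e z * f z.1)
          = (q (z.1, z.2 + dom.shift) 0 * _ + q (z.1, z.2 + dom.shift) 1 * _)
            * (μ (e.map (Equiv.addRight dom.shift).toEmbedding) (z.1, z.2 + dom.shift) * f z.1)
        rw [hz.2, hm]
        simp
    rw [Finset.sum_congr rfl e1, hpair, sub_add_cancel]
  · intro e n
    simp only [inner_neg_right, neg_mul, integral_neg]
  · intro a b hab he hbot n hn
    rw [← integral_zero SpaceTime ℝ]
    refine integral_congr_ae ?_
    filter_upwards [hqv.ae_bottom h0 h1 hab hbot hn] with z hz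
    rw [hz, zero_mul]

end Exact

section Exact

variable {dom : FlowDomain} {mesh : SpatialMesh dom} {T : ℝ} {N : ℕ} {q : SpaceTime → Plane}
  {v : SpaceTime → ℝ}

open Classical in
/-- The family of face functions `P`, with the functions on the right periodic boundary replaced by
the translates of those on the left one. -/
def periodize (dom : FlowDomain) (P : Finset Plane → SpaceTime → ℝ) :
    Finset Plane → SpaceTime → ℝ := fun e =>
  if SpatialMesh.IsRight dom e then fun z => P (translate (-dom.shift) e) (z.1, z.2 - dom.shift)
  else P e

theorem periodize_of_not_right {P : Finset Plane → SpaceTime → ℝ} {e : Finset Plane}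
    (h : ¬ SpatialMesh.IsRight dom e) : periodize dom P e = P e := by
  rw [periodize, if_neg h]

theorem periodize_of_right {P : Finset Plane → SpaceTime → ℝ} {e : Finset Plane}
    (h : SpatialMesh.IsRight dom e) : periodize dom P e
      = fun z => P (translate (-dom.shift) e) (z.1, z.2 - dom.shift) := by
  rw [periodize, if_pos h]

theorem SpatialMesh.not_right_of_left {e : Finset Plane} (he : e ∈ mesh.edges)
    (hL : SpatialMesh.IsLeft dom e) : ¬ SpatialMesh.IsRight dom e := by
  intro hR
  obtain ⟨x, hx⟩ := Finset.card_pos.1 (by rw [(mesh.mem_edges.1 he).2]; norm_num : 0 < e.card)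
  exact dom.L_lt_R.ne ((hL x hx).symm.trans (hR x hx))

theorem SpatialMesh.mem_surfaceEdges {e : Finset Plane} :
    e ∈ mesh.surfaceEdges ↔ e ∈ mesh.edges ∧ ∀ x ∈ e, x 1 = 0 := by
  simp [SpatialMesh.surfaceEdges]

open Classical in
theorem SpatialMesh.not_right_of_surface {e : Finset Plane} (he : e ∈ mesh.surfaceEdges) :
    ¬ SpatialMesh.IsRight dom e := by
  obtain ⟨he, hS⟩ := SpatialMesh.mem_surfaceEdges.1 he
  obtain ⟨a, b, hab, rfl⟩ := exists_pair (mesh.mem_edges.1 he).2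
  intro hR
  exact hab (plane_ext ((hR a (by simp)).trans (hR b (by simp)).symm)
    ((hS a (by simp)).trans (hS b (by simp)).symm))

theorem periodize_mem_spaceM {p : ℕ} {P : Finset Plane → SpaceTime → ℝ}
    (hP : ∀ e ∈ mesh.edges, P e ∈ localM p e) : periodize dom P ∈ spaceM mesh p := by
  refine ⟨fun e he => ?_, fun e he hL t x hx => ?_⟩
  · by_cases hR : SpatialMesh.IsRight dom e
    · rw [periodize_of_right hR]
      have h := localM_translate dom.shift (hP _ (mesh.translate_left he hR).1)
      rwa [translate_translate_neg] at h
    · rw [periodize_of_not_right hR]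
      exact hP e he
  · have h1 := mesh.translate_right he hL
    change periodize dom P (translate dom.shift e) (t, x + dom.shift) = _
    rw [periodize_of_right h1.2, translate_neg_translate,
      periodize_of_not_right (SpatialMesh.not_right_of_left he hL)]
    simp

/-- By the periodicity of the exact solution the periodized family of projections is again one of
projections. -/
theorem IsExactSolution.isFaceProjection_periodize (hqv : IsExactSolution mesh T N q v)
    {t₀ t₁ : ℝ} (h0 : 0 ≤ t₀) (h1 : t₁ ≤ T) {p : ℕ} {α : ℝ} {P : Finset Plane → SpaceTime → ℝ}
    (hP : ∀ e ∈ mesh.edges, IsFaceProjection p α t₀ t₁ e v (P e)) {e : Finset Plane}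
    (he : e ∈ mesh.edges) : IsFaceProjection p α t₀ t₁ e v (periodize dom P e) := by
  refine ⟨(periodize_mem_spaceM fun e he => (hP e he).1).1 e he, fun σ hσ => ?_⟩
  by_cases hR : SpatialMesh.IsRight dom e
  · obtain ⟨hl, hL⟩ := mesh.translate_left he hR
    have hcard := (mesh.mem_edges.1 hl).2
    have hθ := compactlyCarried_during t₀ t₁
    have hback := translate_translate_neg dom.shift e
    rw [periodize_of_right hR]
    set e' := translate (-dom.shift) e
    have key := integral_translate hθ dom.shift hcard
    rw [hback] at key
    rw [key, key]
    have hσ' : (fun z : SpaceTime => σ (z.1, z.2 + dom.shift)) ∈ localM p e' := by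
      have := localM_translate (-dom.shift) hσ
      simpa using this
    have h2 := (hP e' hl).2 _ hσ'
    simp only [add_sub_cancel_right]
    rw [h2]
    refine integral_congr_ae ?_
    filter_upwards [hqv.ae_periodic h0 h1 hl hL] with z hz
    rw [hz.1]
  · rw [periodize_of_not_right hR]
    exact (hP e he).2 σ hσ

/-! ### The free surface -/

/-- Integration in one variable preserves square integrability. -/
theorem memLp_integral_left {X Y : Type*} [MeasurableSpace X] [MeasurableSpace Y] {θ : Measure X}
    {ρ : Measure Y} [IsFiniteMeasure θ] [IsFiniteMeasure ρ] {w : X × Y → ℝ}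
    (hw : MemLp w 2 (θ.prod ρ)) : MemLp (fun y => ∫ x, w (x, y) ∂θ) 2 ρ := by
  have hsq : Integrable (fun z => w z ^ 2) (θ.prod ρ) := hw.integrable_sq
  have hint : Integrable w (θ.prod ρ) := hw.integrable (by norm_num)
  have hmeas : AEStronglyMeasurable (fun y => ∫ x, w (x, y) ∂θ) ρ :=
    hint.integral_prod_right.aestronglyMeasurable
  rw [memLp_two_iff_integrable_sq hmeas]
  refine Integrable.mono' ((hsq.integral_prod_right).const_mul (θ.real univ)) (hmeas.pow 2) ?_
  filter_upwards [hsq.prod_left_ae, hint.prod_left_ae] with y h2 h1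
  rw [Real.norm_of_nonneg (sq_nonneg _)]
  set I := ∫ x, w (x, y) ∂θ with hI
  set J := ∫ x, w (x, y) ^ 2 ∂θ with hJ
  set m := θ.real univ with hm
  have hm0 : 0 ≤ m := measureReal_nonneg
  -- the quadratic polynomial `s ↦ ∫ (w - s)²` is nonnegative
  have hquad : ∀ s : ℝ, 0 ≤ J - 2 * s * I + s ^ 2 * m := by
    intro s
    have h3 : ∫ x, (w (x, y) - s) ^ 2 ∂θ = J - 2 * s * I + s ^ 2 * m := by
      have : (fun x => (w (x, y) - s) ^ 2) = fun x => w (x, y) ^ 2 - 2 * s * w (x, y) + s ^ 2 := by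
        funext x; ring
      have i3 : Integrable (fun x => w (x, y) ^ 2 - 2 * s * w (x, y)) θ := h2.sub (h1.const_mul _)
      rw [this, integral_add i3 (integrable_const _),
        integral_sub h2 (h1.const_mul _), integral_const_mul, integral_const, smul_eq_mul]
      ring
    rw [← h3]
    exact integral_nonneg fun x => sq_nonneg _
  rcases hm0.eq_or_lt with h0 | h0
  · have : θ = 0 := by
      rw [← Measure.measure_univ_eq_zero]
      exact (measureReal_eq_zero_iff).1 h0.symm
    have hI0 : I = 0 := by rw [hI, this, integral_zero_measure]
    rw [hI0, ← h0]
    simp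
  · have h4 := hquad (I / m)
    have h5 : J - 2 * (I / m) * I + (I / m) ^ 2 * m = J - I ^ 2 / m := by
      field_simp; ring
    rw [h5, sub_nonneg, div_le_iff₀ h0] at h4
    linarith

theorem IsExactSolution.memLp_face (hqv : IsExactSolution mesh T N q v) {t₀ t₁ : ℝ} (h0 : 0 ≤ t₀)
    (h1 : t₁ ≤ T) {e : Finset Plane} (he : e ∈ mesh.edges) :
    MemLp v 2 ((during t₀ t₁).prod (arc e)) ∧
      ∀ i, MemLp (fun z => q z i) 2 ((during t₀ t₁).prod (arc e)) := by
  obtain ⟨Dv, Dq, hv, hq, -, -⟩ := hqv.equations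
  have hle : (during t₀ t₁).prod (arc e) ≤ (during 0 T).prod (arc e) :=
    have := (compactlyCarried_arc (mesh.mem_edges.1 he).2).finite
    Measure.prod_mono (during_mono h0 h1) le_rfl
  exact ⟨(hv.memLp_trace _ ⟨e, he, rfl⟩).mono_measure hle,
    fun i => ((hq i).memLp_trace _ (Or.inl ⟨e, he, rfl⟩)).mono_measure hle⟩

/-- Integration by parts in time at one point of the free surface. -/
theorem surface_slice {V Q h : ℝ → ℝ} {t₀ t₁ : ℝ} (h0 : 0 ≤ t₀) (h01 : t₀ ≤ t₁) (h1 : t₁ ≤ T)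
    (hV : AbsolutelyContinuousOnInterval V 0 T)
    (hd : ∀ᵐ t ∂(volume.restrict (Ioo 0 T)), HasDerivAt V (-Q t) t) (hh : ContDiff ℝ 1 h) :
    ∫ t, Q t * h t ∂(during t₀ t₁) = (∫ t, V t * deriv h t ∂(during t₀ t₁)) - V t₁ * h t₁
      + V t₀ * h t₀ := by
  have conv : ∀ g : ℝ → ℝ, ∫ t, g t ∂(during t₀ t₁) = ∫ t in t₀..t₁, g t := fun g => by
    rw [during, ← integral_Ioc_eq_integral_Ioo, intervalIntegral.integral_of_le h01]
  have hV' : AbsolutelyContinuousOnInterval V t₀ t₁ := by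
    refine hV.mono ?_
    rw [uIcc_of_le h01, uIcc_of_le (h0.trans (h01.trans h1))]
    exact Icc_subset_Icc h0 h1
  have hh' : AbsolutelyContinuousOnInterval h t₀ t₁ :=
    hh.contDiffOn.absolutelyContinuousOnInterval
  have hder : ∫ t, Q t * h t ∂(during t₀ t₁) = -∫ t, deriv V t * h t ∂(during t₀ t₁) := by
    rw [← integral_neg]
    refine integral_congr_ae ?_
    filter_upwards [ae_mono (during_mono h0 h1) hd] with t ht
    rw [ht.deriv]
    ring
  rw [hder, conv, conv, hV'.integral_mul_deriv_eq_deriv_mul hh']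
  ring

open Classical in
/-- On the free surface the exact potential is square integrable at the ends of a time slab, and the
boundary condition may be integrated by parts in time. -/
theorem IsExactSolution.surface (hqv : IsExactSolution mesh T N q v) {t₀ t₁ : ℝ} (h0 : 0 ≤ t₀)
    (h01 : t₀ < t₁) (h1 : t₁ ≤ T) {e : Finset Plane} (he : e ∈ mesh.surfaceEdges) :
    MemLp v 2 ((atTime t₀).prod (arc e)) ∧ MemLp v 2 ((atTime t₁).prod (arc e)) ∧
    ∀ h : SpaceTime → ℝ, ContDiff ℝ 1 h →
      ∫ z, q z 1 * h z ∂((during t₀ t₁).prod (arc e))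
        = (∫ z, v z * fderiv ℝ h z (1, 0) ∂((during t₀ t₁).prod (arc e)))
          - (∫ z, v z * h z ∂((atTime t₁).prod (arc e)))
          + ∫ z, v z * h z ∂((atTime t₀).prod (arc e)) := by
  obtain ⟨heE, hS⟩ := SpatialMesh.mem_surfaceEdges.1 he
  have hmem := hqv.memLp_face h0 h1 heE
  obtain ⟨hef, hcard⟩ := mesh.mem_edges.1 heE
  -- parametrize the edge by the horizontal coordinate
  obtain ⟨u, w, hu, hw, hull⟩ : ∃ u w : ℝ, dom.L ≤ u ∧ w ≤ dom.R ∧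
      convexHull ℝ (e : Set Plane) = (fun s : ℝ => 0 + s • (!₂[1, 0] : Plane)) '' Icc u w := by
    obtain ⟨a, b, hab, rfl⟩ := exists_pair hcard
    have hmema := mesh.mem_closedOmega hef (x := a) (by simp)
    have hmemb := mesh.mem_closedOmega hef (x := b) (by simp)
    rcases le_total (a 0) (b 0) with hle | hle
    · exact ⟨a 0, b 0, hmema.1.1, hmemb.1.2,
        hull_horizontal (hS a (by simp)) (hS b (by simp)) hle⟩
    · rw [Finset.pair_comm]
      exact ⟨b 0, a 0, hmemb.1.1, hmema.1.2,
        hull_horizontal (hS b (by simp)) (hS a (by simp)) hle⟩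
  have hd := horizontal_ne_zero 0
  have hθ := compactlyCarried_during t₀ t₁
  have hγ : ∀ s : ℝ, (0 + s • (!₂[1, 0] : Plane)) = !₂[s, 0] := fun s =>
    plane_ext (by simp) (by simp)
  set ρ : Measure ℝ := volume.restrict (Ioo u w) with hρ
  have hρf : IsFiniteMeasure ρ := (compactlyCarried_during u w).finite
  have hθf := hθ.finite
  have hslice : ∀ᵐ s ∂ρ, AbsolutelyContinuousOnInterval (fun t => v (t, !₂[s, 0])) 0 T ∧
      ∀ᵐ t ∂(volume.restrict (Ioo 0 T)),
        HasDerivAt (fun t' => v (t', !₂[s, 0])) (-(q (t, !₂[s, 0]) 1)) t :=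
    ae_mono (Measure.restrict_mono (Ioo_subset_Ioo hu hw) le_rfl) hqv.freeSurface
  have hvL : MemLp (fun z : ℝ × ℝ => v (z.1, !₂[z.2, 0])) 2 ((during t₀ t₁).prod ρ) := by
    have := (memLp_prod_arc hθ hd hull v).1 hmem.1
    simpa only [hγ] using this
  have hqL : MemLp (fun z : ℝ × ℝ => q (z.1, !₂[z.2, 0]) 1) 2 ((during t₀ t₁).prod ρ) := by
    have := (memLp_prod_arc hθ hd hull (fun z => q z 1)).1 (hmem.2 1)
    simpa only [hγ] using this
  have hcc : CompactlyCarried ((during t₀ t₁).prod ρ) := hθ.prod (compactlyCarried_during u w)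
  -- the difference of the boundary values, weighted by a function of time
  have hdiff : ∀ h : ℝ → ℝ, ContDiff ℝ 1 h →
      MemLp (fun s => v (t₁, !₂[s, 0]) * h t₁ - v (t₀, !₂[s, 0]) * h t₀) 2 ρ := by
    intro h hh
    have m1 : MemLp (fun z : ℝ × ℝ => v (z.1, !₂[z.2, 0]) * deriv h z.1) 2
        ((during t₀ t₁).prod ρ) :=
      MemLp.mul' (hcc.memLp ((hh.continuous_deriv le_rfl).comp continuous_fst) ⊤) hvL
    have m2 : MemLp (fun z : ℝ × ℝ => q (z.1, !₂[z.2, 0]) 1 * h z.1) 2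
        ((during t₀ t₁).prod ρ) :=
      MemLp.mul' (hcc.memLp (hh.continuous.comp continuous_fst) ⊤) hqL
    refine ((memLp_integral_left m1).sub (memLp_integral_left m2)).ae_eq ?_
    filter_upwards [hslice] with s hs
    have := surface_slice (Q := fun t => q (t, !₂[s, 0]) 1) h0 h01.le h1 hs.1 hs.2 hh
    simp only [Pi.sub_apply]
    linarith
  have hpos : 0 < t₁ - t₀ := sub_pos.2 h01
  have hv1 : MemLp (fun s => v (t₁, !₂[s, 0])) 2 ρ := by
    refine ((hdiff (fun t => t - t₀) (by fun_prop)).const_mul (t₁ - t₀)⁻¹).ae_eq ?_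
    refine Eventually.of_forall fun s => ?_
    simp only [sub_self, mul_zero, sub_zero]
    field_simp
  have hv0 : MemLp (fun s => v (t₀, !₂[s, 0])) 2 ρ := by
    refine ((hdiff (fun t => t - t₁) (by fun_prop)).const_mul (t₁ - t₀)⁻¹).ae_eq ?_
    refine Eventually.of_forall fun s => ?_
    simp only [sub_self, mul_zero, zero_sub]
    field_simp
    ring
  have htime : ∀ t, MemLp (fun s => v (t, !₂[s, 0])) 2 ρ →
      MemLp v 2 ((atTime t).prod (arc e)) := by
    intro t ht
    rw [memLp_prod_arc (compactlyCarried_atTime t) hd hull, atTime, Measure.dirac_prod,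
      (measurableEmbedding_prodMk_left t).memLp_map_measure_iff]
    simpa only [hγ, Function.comp_def] using ht
  refine ⟨htime _ hv0, htime _ hv1, fun h hh => ?_⟩
  have cγ : Continuous fun s : ℝ => (!₂[s, 0] : Plane) := by
    have h2 : (fun s : ℝ => (!₂[s, 0] : Plane)) = fun s => 0 + s • (!₂[1, 0] : Plane) :=
      funext fun s => (hγ s).symm
    rw [h2]
    fun_prop
  have cγ2 : Continuous fun z : ℝ × ℝ => ((z.1, !₂[z.2, 0]) : SpaceTime) :=
    continuous_fst.prodMk (cγ.comp continuous_snd)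
  have i1 : Integrable (fun z : ℝ × ℝ => v (z.1, !₂[z.2, 0]) *
      fderiv ℝ h (z.1, !₂[z.2, 0]) (1, 0)) ((during t₀ t₁).prod ρ) :=
    hvL.integrable_mul (hcc.memLp ((continuous_fderiv_apply hh _).comp cγ2) 2)
  have i2 : Integrable (fun z : ℝ × ℝ => q (z.1, !₂[z.2, 0]) 1 * h (z.1, !₂[z.2, 0]))
      ((during t₀ t₁).prod ρ) :=
    hqL.integrable_mul (hcc.memLp (hh.continuous.comp cγ2) 2)
  have j : ∀ t, MemLp (fun s => v (t, !₂[s, 0])) 2 ρ →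
      Integrable (fun s => v (t, !₂[s, 0]) * h (t, !₂[s, 0])) ρ := fun t ht =>
    ht.integrable_mul ((compactlyCarried_during u w).memLp
      (hh.continuous.comp (continuous_const.prodMk cγ)) 2)
  rw [integral_prod_arc hθ hd hull, integral_prod_arc hθ hd hull,
    integral_prod_arc (compactlyCarried_atTime t₁) hd hull,
    integral_prod_arc (compactlyCarried_atTime t₀) hd hull, integral_atTime_prod,
    integral_atTime_prod]
  simp only [hγ]
  rw [integral_prod_symm _ i1, integral_prod_symm _ i2, ← mul_sub, ← mul_add,
    ← integral_sub i1.integral_prod_right (j _ hv1)]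
  have k := i1.integral_prod_right.sub (j _ hv1)
  simp only [Pi.sub_def] at k
  rw [← integral_add k (j _ hv0)]
  congr 1
  refine integral_congr_ae ?_
  filter_upwards [hslice] with s hs
  have hhs : ContDiff ℝ 1 fun t => h (t, !₂[s, 0]) := hh.comp (contDiff_id.prodMk contDiff_const)
  have := surface_slice (Q := fun t => q (t, !₂[s, 0]) 1) h0 h01.le h1 hs.1 hs.2 hhs
  rw [this]
  simp only [(hasDerivAt_slice hh _ _).deriv]

end Exact

/-! ### The weighted time-stepping form -/

/-- The part of the scheme that discretizes the time derivative on the cell with spatial measure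
`ρ`: the weighted discontinuous Galerkin form with value `Qm` from before. -/
def cellForm (α t₀ t₁ : ℝ) (ρ : Measure Plane) (Q Qm g : SpaceTime → ℝ) : ℝ :=
  -(∫ z, Q z * (weight α t₀ z.1 * fderiv ℝ g z (1, 0)) ∂((during t₀ t₁).prod ρ))
    + α * (∫ z, Q z * (weight α t₀ z.1 * g z) ∂((during t₀ t₁).prod ρ))
    + (∫ z, Q z * (weight α t₀ z.1 * g z) ∂((atTime t₁).prod ρ))
    - ∫ z, Qm z * (weight α t₀ z.1 * g z) ∂((atTime t₀).prod ρ)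

theorem continuous_weight_fst (α t₀ : ℝ) : Continuous fun z : SpaceTime => weight α t₀ z.1 :=
  (continuous_weight α t₀).comp continuous_fst

theorem contDiff_weight_fst (α t₀ : ℝ) {n : WithTop ℕ∞} :
    ContDiff ℝ n fun z : SpaceTime => weight α t₀ z.1 := by
  unfold weight
  fun_prop

theorem weight_start (α t₀ : ℝ) : weight α t₀ t₀ = 1 := by simp [weight]

theorem fderiv_weight_mul_space (α t₀ : ℝ) {g : SpaceTime → ℝ} (hg : ContDiff ℝ 1 g)
    (z : SpaceTime) (d : Plane) :
    fderiv ℝ (fun z => weight α t₀ z.1 * g z) z (0, d) = weight α t₀ z.1 * fderiv ℝ g z (0, d) := by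
  rw [fderiv_fun_mul ((contDiff_weight_fst α t₀).differentiable one_ne_zero z)
    (hg.differentiable one_ne_zero z)]
  have h : fderiv ℝ (fun z : SpaceTime => weight α t₀ z.1) z (0, d) = 0 := by
    rw [← fderiv_slice (contDiff_weight_fst α t₀) z.1 z.2]
    simp
  simp [h]

theorem fderiv_weight_mul_time (α t₀ : ℝ) {g : SpaceTime → ℝ} (hg : ContDiff ℝ 1 g)
    (z : SpaceTime) :
    fderiv ℝ (fun z => weight α t₀ z.1 * g z) z (1, 0)
      = weight α t₀ z.1 * fderiv ℝ g z (1, 0) - α * (weight α t₀ z.1 * g z) := by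
  have h1 := hasDerivAt_slice ((contDiff_weight_fst α t₀).mul hg) z.1 z.2
  have h2 := (hasDerivAt_weight α t₀ z.1).mul (hasDerivAt_slice hg z.1 z.2)
  rw [h1.unique h2]
  ring

section Cell

variable {α t₀ t₁ : ℝ} {ρ : Measure Plane} {p : ℕ}

theorem MemLp.integrable_mul_continuous {σ : Measure SpaceTime} (hσ : CompactlyCarried σ)
    {Q g : SpaceTime → ℝ} (hQ : MemLp Q 2 σ) (hg : Continuous g) :
    Integrable (fun z => Q z * g z) σ :=
  hQ.integrable_mul (hσ.memLp hg 2)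

theorem cellForm_sub (hρ : CompactlyCarried ρ) {Q Q' Qm Qm' g : SpaceTime → ℝ}
    (hg : ContDiff ℝ 1 g) (hQ : MemLp Q 2 ((during t₀ t₁).prod ρ))
    (hQ' : MemLp Q' 2 ((during t₀ t₁).prod ρ)) (hQ1 : MemLp Q 2 ((atTime t₁).prod ρ))
    (hQ1' : MemLp Q' 2 ((atTime t₁).prod ρ)) (hQm : MemLp Qm 2 ((atTime t₀).prod ρ))
    (hQm' : MemLp Qm' 2 ((atTime t₀).prod ρ)) :
    cellForm α t₀ t₁ ρ (fun z => Q z - Q' z) (fun z => Qm z - Qm' z) g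
      = cellForm α t₀ t₁ ρ Q Qm g - cellForm α t₀ t₁ ρ Q' Qm' g := by
  have c := (compactlyCarried_during t₀ t₁).prod hρ
  have c1 := (compactlyCarried_atTime t₁).prod hρ
  have c0 := (compactlyCarried_atTime t₀).prod hρ
  have k1 : Continuous fun z : SpaceTime => weight α t₀ z.1 * fderiv ℝ g z (1, 0) :=
    (continuous_weight_fst α t₀).mul (continuous_fderiv_apply hg _)
  have k2 : Continuous fun z : SpaceTime => weight α t₀ z.1 * g z :=
    (continuous_weight_fst α t₀).mul hg.continuous
  have i {σ : Measure SpaceTime} (hσ : CompactlyCarried σ) {Q g : SpaceTime → ℝ}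
      (hQ : MemLp Q 2 σ) (hg : Continuous g) := MemLp.integrable_mul_continuous hσ hQ hg
  simp only [cellForm, sub_mul]
  rw [integral_sub (i c hQ k1) (i c hQ' k1), integral_sub (i c hQ k2) (i c hQ' k2),
    integral_sub (i c1 hQ1 k2) (i c1 hQ1' k2), integral_sub (i c0 hQm k2) (i c0 hQm' k2)]
  ring

/-- The energy controlled by the time-stepping form: integration by parts in time gives half the
derivative of the weight, which is `-α` times the weight, and the jump at the first time level
completes a square. -/
theorem cellForm_self_ge (hρ : CompactlyCarried ρ) (ht : t₀ ≤ t₁) {g Gm : SpaceTime → ℝ}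
    (hg : ContDiff ℝ 1 g) (hGm : MemLp Gm 2 ((atTime t₀).prod ρ)) :
    α * (∫ z, weight α t₀ z.1 * g z ^ 2 ∂((during t₀ t₁).prod ρ))
      + Real.exp (-(α * (t₁ - t₀))) * (∫ z, 1 * g z ^ 2 ∂((atTime t₁).prod ρ))
      - (∫ z, 1 * Gm z ^ 2 ∂((atTime t₀).prod ρ))
      ≤ 2 * cellForm α t₀ t₁ ρ g Gm g := by
  have := hρ.finite
  have c := (compactlyCarried_during t₀ t₁).prod hρ
  have c1 := (compactlyCarried_atTime t₁).prod hρ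
  have c0 := (compactlyCarried_atTime t₀).prod hρ
  have cw := continuous_weight_fst α t₀
  have cg := hg.continuous
  have cg' := continuous_fderiv_apply hg (1, 0)
  -- the derivative of the weighted square
  have hG := integral_fderiv_time hρ ((contDiff_weight_fst α t₀).mul (hg.mul hg)) ht
  simp only [fderiv_weight_mul_time α t₀ (hg.mul hg)] at hG
  have hsq : ∀ z, fderiv ℝ (fun z => g z * g z) z (1, 0) = 2 * (g z * fderiv ℝ g z (1, 0)) := by
    intro z
    rw [fderiv_fun_mul (hg.differentiable one_ne_zero z) (hg.differentiable one_ne_zero z)]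
    simp only [add_apply, smul_apply, smul_eq_mul]
    ring
  simp only [hsq] at hG
  have i1 : Integrable (fun z => g z * (weight α t₀ z.1 * fderiv ℝ g z (1, 0)))
      ((during t₀ t₁).prod ρ) := c.integrable (by fun_prop)
  have i2 : Integrable (fun z => g z * (weight α t₀ z.1 * g z))
      ((during t₀ t₁).prod ρ) := c.integrable (by fun_prop)
  have hG2 : ∫ z, weight α t₀ z.1 * (2 * (g z * fderiv ℝ g z (1, 0)))
        - α * (weight α t₀ z.1 * (g z * g z)) ∂((during t₀ t₁).prod ρ)
      = 2 * (∫ z, g z * (weight α t₀ z.1 * fderiv ℝ g z (1, 0)) ∂((during t₀ t₁).prod ρ))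
        - α * ∫ z, g z * (weight α t₀ z.1 * g z) ∂((during t₀ t₁).prod ρ) := by
    rw [← integral_const_mul, ← integral_const_mul, ← integral_sub (i1.const_mul _)
      (i2.const_mul _)]
    refine integral_congr_ae (Eventually.of_forall fun z => ?_)
    simp only
    ring
  rw [hG2] at hG
  have e1 : ∫ z, g z * (weight α t₀ z.1 * g z) ∂((during t₀ t₁).prod ρ)
      = ∫ z, weight α t₀ z.1 * g z ^ 2 ∂((during t₀ t₁).prod ρ) := by
    congr 1; funext z; ring
  have e2 : ∫ z, g z * (weight α t₀ z.1 * g z) ∂((atTime t₁).prod ρ)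
      = Real.exp (-(α * (t₁ - t₀))) * (∫ z, 1 * g z ^ 2 ∂((atTime t₁).prod ρ)) := by
    rw [integral_atTime_prod, integral_atTime_prod, ← integral_const_mul]
    congr 1; funext x; simp only [weight]; ring
  have e3 : ∫ z, weight α t₀ z.1 * (g z * g z) ∂((atTime t₁).prod ρ)
      = Real.exp (-(α * (t₁ - t₀))) * (∫ z, 1 * g z ^ 2 ∂((atTime t₁).prod ρ)) := by
    rw [integral_atTime_prod, integral_atTime_prod, ← integral_const_mul]
    congr 1; funext x; simp only [weight]; ring
  have hjump : 0 ≤ (∫ z, weight α t₀ z.1 * (g z * g z) ∂((atTime t₀).prod ρ))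
      - 2 * (∫ z, Gm z * (weight α t₀ z.1 * g z) ∂((atTime t₀).prod ρ))
      + ∫ z, 1 * Gm z ^ 2 ∂((atTime t₀).prod ρ) := by
    have j1 : Integrable (fun z => weight α t₀ z.1 * (g z * g z)) ((atTime t₀).prod ρ) :=
      c0.integrable (by fun_prop)
    have j2 : Integrable (fun z => 2 * (Gm z * (weight α t₀ z.1 * g z))) ((atTime t₀).prod ρ) :=
      (MemLp.integrable_mul_continuous c0 hGm (cw.mul cg)).const_mul 2
    have j3 : Integrable (fun z => 1 * Gm z ^ 2) ((atTime t₀).prod ρ) :=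
      hGm.integrable_sq.const_mul 1
    rw [← integral_const_mul, ← integral_sub j1 j2]
    have j4 := j1.sub j2
    simp only [Pi.sub_def] at j4
    rw [← integral_add j4 j3, integral_atTime_prod]
    refine integral_nonneg fun x => ?_
    simp only [weight_start, Pi.zero_apply]
    nlinarith [sq_nonneg (g (t₀, x) - Gm (t₀, x))]
  simp only [cellForm, e2]
  rw [e3] at hG
  rw [← e1]
  linarith

/-- Young's inequality for weighted integrals. -/
theorem two_mul_integral_le {σ : Measure SpaceTime} (hσ : CompactlyCarried σ) {δ g : SpaceTime → ℝ}
    (hδ : MemLp δ 2 σ) (hg : Continuous g) {η : ℝ} (hη : 0 < η) :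
    |2 * ∫ z, δ z * (weight α t₀ z.1 * g z) ∂σ|
      ≤ η⁻¹ * (∫ z, weight α t₀ z.1 * δ z ^ 2 ∂σ) + η * ∫ z, weight α t₀ z.1 * g z ^ 2 ∂σ := by
  have cw := continuous_weight_fst α t₀
  have i1 : Integrable (fun z => weight α t₀ z.1 * δ z ^ 2) σ := by
    have h1 : MemLp (fun z => δ z * weight α t₀ z.1) 2 σ :=
      MemLp.mul' (hσ.memLp cw ⊤) hδ
    have := h1.integrable_mul hδ
    refine this.congr (Eventually.of_forall fun z => ?_)
    simp only [Pi.mul_apply]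
    ring
  have i2 : Integrable (fun z => weight α t₀ z.1 * g z ^ 2) σ := hσ.integrable (by fun_prop)
  rw [← integral_const_mul, ← integral_const_mul, ← integral_const_mul,
    ← integral_add (i1.const_mul _) (i2.const_mul _)]
  refine (abs_integral_le_integral_abs).trans (integral_mono_ae
    ((MemLp.integrable_mul_continuous hσ hδ (cw.mul hg)).const_mul 2).abs
    ((i1.const_mul _).add (i2.const_mul _)) (Eventually.of_forall fun z => ?_))
  have hw := weight_pos α t₀ z.1
  have hy : 2 * |δ z * g z| ≤ η⁻¹ * δ z ^ 2 + η * g z ^ 2 := by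
    have h1 : 0 ≤ η⁻¹ * (|δ z| - η * |g z|) ^ 2 := by positivity
    have h2 : η⁻¹ * (|δ z| - η * |g z|) ^ 2
        = η⁻¹ * |δ z| ^ 2 - 2 * (|δ z| * |g z|) + η * |g z| ^ 2 := by
      field_simp; ring
    rw [h2, sq_abs, sq_abs] at h1
    rw [abs_mul]
    linarith
  have h3 := mul_le_mul_of_nonneg_left hy hw.le
  have h4 : |2 * (δ z * (weight α t₀ z.1 * g z))| = weight α t₀ z.1 * (2 * |δ z * g z|) := by
    rw [show 2 * (δ z * (weight α t₀ z.1 * g z)) = (2 * weight α t₀ z.1) * (δ z * g z) by ring,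
      abs_mul, abs_of_pos (by positivity)]
    ring
  simp only
  rw [h4]
  linarith

end Cell

/-- The time-stepping form of the projection error is absorbed by the energy; the constant depends
on the degree, the weight and the final time only. -/
theorem exists_cellForm_bounds (p : ℕ) {α T : ℝ} (hα : 0 < α) : ∃ C : ℝ, 0 < C ∧
    ∀ t₀ t₁ : ℝ, t₀ < t₁ → t₁ - t₀ ≤ T → ∀ ρ : Measure Plane, CompactlyCarried ρ →
    ∀ g : SpaceTime → ℝ, ContDiff ℝ 1 g → (∀ᵐ x ∂ρ, IsTimePolynomial p (fun t => g (t, x))) →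
    ∀ δ δm : SpaceTime → ℝ, MemLp δ 2 ((atTime t₁).prod ρ) → MemLp δm 2 ((atTime t₀).prod ρ) →
      (2 * ((∫ z, δ z * (weight α t₀ z.1 * g z) ∂((atTime t₁).prod ρ))
          - ∫ z, δm z * (weight α t₀ z.1 * g z) ∂((atTime t₀).prod ρ))
        ≤ α / 4 * (∫ z, weight α t₀ z.1 * g z ^ 2 ∂((during t₀ t₁).prod ρ))
          + C * (t₁ - t₀)⁻¹ * (∫ z, weight α t₀ z.1 * δ z ^ 2 ∂((atTime t₁).prod ρ))
          + C * (t₁ - t₀)⁻¹ * ∫ z, weight α t₀ z.1 * δm z ^ 2 ∂((atTime t₀).prod ρ)) ∧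
      (MemLp δ 2 ((during t₀ t₁).prod ρ) →
        2 * cellForm α t₀ t₁ ρ δ δm g
        ≤ α / 2 * (∫ z, weight α t₀ z.1 * g z ^ 2 ∂((during t₀ t₁).prod ρ))
          + C * ((t₁ - t₀) ^ 2)⁻¹ * (∫ z, weight α t₀ z.1 * δ z ^ 2 ∂((during t₀ t₁).prod ρ))
          + C * (∫ z, weight α t₀ z.1 * δ z ^ 2 ∂((during t₀ t₁).prod ρ))
          + C * (t₁ - t₀)⁻¹ * (∫ z, weight α t₀ z.1 * δ z ^ 2 ∂((atTime t₁).prod ρ))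
          + C * (t₁ - t₀)⁻¹ * ∫ z, weight α t₀ z.1 * δm z ^ 2 ∂((atTime t₀).prod ρ)) := by
  obtain ⟨A, hA, hinv⟩ := exists_inverse_prod p (T := T) hα
  -- the weights in Young's inequality are chosen to leave one eighth of `α` for each term
  refine ⟨8 * A / α + 8 * α, by positivity, fun t₀ t₁ ht hT ρ hρ g hg hpoly δ δm hδ1 hδm => ?_⟩
  obtain ⟨v1, v2, v3⟩ := hinv t₀ t₁ ht hT ρ hρ g hg hpoly
  have hΔ : 0 < t₁ - t₀ := sub_pos.2 ht
  set Δ := t₁ - t₀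
  have c := (compactlyCarried_during t₀ t₁).prod hρ
  have c1 := (compactlyCarried_atTime t₁).prod hρ
  have c0 := (compactlyCarried_atTime t₀).prod hρ
  have nn : ∀ (σ : Measure SpaceTime) (u : SpaceTime → ℝ),
      0 ≤ ∫ z, weight α t₀ z.1 * u z ^ 2 ∂σ := fun σ u =>
    integral_nonneg fun z => mul_nonneg (weight_pos _ _ _).le (sq_nonneg _)
  have y1 := (le_abs_self _).trans (two_mul_integral_le (α := α) (t₀ := t₀) c1 hδ1 hg.continuous
    (η := α * Δ / (8 * A)) (by positivity))
  have y0 := (neg_le_abs _).trans (two_mul_integral_le (α := α) (t₀ := t₀) c0 hδm hg.continuous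
    (η := α * Δ / (8 * A)) (by positivity))
  have n1 := nn ((atTime t₁).prod ρ) δ
  have n0 := nn ((atTime t₀).prod ρ) δm
  have n := nn ((during t₀ t₁).prod ρ) δ
  set G := ∫ z, weight α t₀ z.1 * g z ^ 2 ∂((during t₀ t₁).prod ρ) with hG
  set D1 := ∫ z, weight α t₀ z.1 * δ z ^ 2 ∂((atTime t₁).prod ρ)
  set D0 := ∫ z, weight α t₀ z.1 * δm z ^ 2 ∂((atTime t₀).prod ρ)
  set D := ∫ z, weight α t₀ z.1 * δ z ^ 2 ∂((during t₀ t₁).prod ρ)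
  have e1 : (α * Δ / (8 * A)) * (A * Δ⁻¹ * G) = α / 8 * G := by field_simp
  have w1 := mul_le_mul_of_nonneg_left v2 (by positivity : 0 ≤ α * Δ / (8 * A))
  have w0 := mul_le_mul_of_nonneg_left v3 (by positivity : 0 ≤ α * Δ / (8 * A))
  rw [e1] at w1 w0
  have e2 : (α * Δ / (8 * A))⁻¹ = 8 * A / α * Δ⁻¹ := by field_simp
  rw [e2] at y1 y0
  have p1 : 0 ≤ 8 * α * Δ⁻¹ * D1 := by positivity
  have p0 : 0 ≤ 8 * α * Δ⁻¹ * D0 := by positivity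
  have q1 : 2 * ((∫ z, δ z * (weight α t₀ z.1 * g z) ∂((atTime t₁).prod ρ))
        - ∫ z, δm z * (weight α t₀ z.1 * g z) ∂((atTime t₀).prod ρ))
      ≤ α / 4 * G + (8 * A / α + 8 * α) * Δ⁻¹ * D1 + (8 * A / α + 8 * α) * Δ⁻¹ * D0 := by
    linarith
  refine ⟨q1, fun hδ => ?_⟩
  have y2 := (neg_le_abs _).trans (two_mul_integral_le (α := α) (t₀ := t₀) c hδ
    (continuous_fderiv_apply hg (1, 0)) (η := α * Δ ^ 2 / (8 * A)) (by positivity))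
  have y3 := (le_abs_self _).trans (two_mul_integral_le (α := α) (t₀ := t₀) c hδ hg.continuous
    (η := 1 / 8) (by positivity))
  have w2 := mul_le_mul_of_nonneg_left v1 (by positivity : 0 ≤ α * Δ ^ 2 / (8 * A))
  have e3 : (α * Δ ^ 2 / (8 * A)) * (A * (Δ ^ 2)⁻¹ * G) = α / 8 * G := by field_simp
  have e4 : (α * Δ ^ 2 / (8 * A))⁻¹ = 8 * A / α * (Δ ^ 2)⁻¹ := by field_simp
  rw [e3] at w2
  rw [e4] at y2
  have y4 := mul_le_mul_of_nonneg_left y3 hα.le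
  have p2 : 0 ≤ 8 * α * (Δ ^ 2)⁻¹ * D := by positivity
  have p3 : 0 ≤ 8 * A / α * D := by positivity
  norm_num at y4
  simp only [cellForm]
  linarith

/-! ### Identities satisfied by the exact solution and its projections -/

/-- The weighted `L²` pairing, with weight `exp(-α(t - t₀))`. -/
def pairing (α t₀ : ℝ) (σ : Measure SpaceTime) (u g : SpaceTime → ℝ) : ℝ :=
  ∫ z, u z * (g z * weight α t₀ z.1) ∂σ

/-- The functions that may be tested against square integrable functions in a weighted pairing. -/
def IsTest (α t₀ : ℝ) (σ : Measure SpaceTime) (g : SpaceTime → ℝ) : Prop :=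
  MemLp (fun z => g z * weight α t₀ z.1) 2 σ

section Pairing

variable {α t₀ : ℝ} {σ : Measure SpaceTime} {u u' g : SpaceTime → ℝ}

theorem isTest_of_continuous (hσ : CompactlyCarried σ) (hg : Continuous g) : IsTest α t₀ σ g :=
  hσ.memLp (hg.mul (continuous_weight_fst α t₀)) 2

theorem pairing_sub_left (hu : MemLp u 2 σ) (hu' : MemLp u' 2 σ) (hg : IsTest α t₀ σ g) :
    pairing α t₀ σ (fun z => u z - u' z) g = pairing α t₀ σ u g - pairing α t₀ σ u' g := by
  simp only [pairing, sub_mul]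
  exact integral_sub (hu.integrable_mul hg) (hu'.integrable_mul hg)

theorem pairing_const_mul_left (k : ℝ) :
    pairing α t₀ σ (fun z => k * u z) g = k * pairing α t₀ σ u g := by
  simp only [pairing, mul_assoc]
  exact integral_const_mul _ _

end Pairing

theorem ae_eq_of_eq_on_hull {θ : Measure ℝ} (hθ : CompactlyCarried θ) {e : Finset Plane}
    (he : e.card = 2) {u w : SpaceTime → ℝ}
    (h : ∀ t, ∀ x ∈ convexHull ℝ (e : Set Plane), u (t, x) = w (t, x)) :
    u =ᵐ[θ.prod (arc e)] w := by
  filter_upwards [arc_ae_mem_hull hθ he] with z hz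
  exact h z.1 z.2 hz

theorem memLp_of_mem_localM {p : ℕ} {θ : Measure ℝ} (hθ : CompactlyCarried θ) {e : Finset Plane}
    (he : e.card = 2) {μ : SpaceTime → ℝ} (hμ : μ ∈ localM p e) :
    MemLp μ 2 (θ.prod (arc e)) := by
  obtain ⟨μ', hs, h⟩ := exists_smooth_extension he hμ
  exact ((hθ.prod (compactlyCarried_arc he)).memLp hs.continuous 2).ae_eq
    (ae_eq_of_eq_on_hull hθ he h).symm

theorem isTest_of_mem_localM {p : ℕ} {α t₀ : ℝ} {θ : Measure ℝ} (hθ : CompactlyCarried θ)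
    {e : Finset Plane} (he : e.card = 2) {μ : SpaceTime → ℝ} (hμ : μ ∈ localM p e) :
    IsTest α t₀ (θ.prod (arc e)) μ :=
  MemLp.mul' ((hθ.prod (compactlyCarried_arc he)).memLp (continuous_weight_fst α t₀) ⊤)
    (memLp_of_mem_localM hθ he hμ)

theorem integral_inner_smul {σ : Measure SpaceTime} (hσ : CompactlyCarried σ)
    {Q S : SpaceTime → Plane} (hQ : ∀ i, MemLp (fun z => Q z i) 2 σ)
    (hS : ∀ i, Continuous fun z => S z i) {c : ℝ → ℝ} (hc : Continuous c) :
    ∫ z, inner ℝ (Q z) (c z.1 • S z) ∂σ = ∑ i, ∫ z, Q z i * (c z.1 * S z i) ∂σ := by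
  have hi (i : Fin 2) : Integrable (fun z => Q z i * (c z.1 * S z i)) σ :=
    MemLp.integrable_mul_continuous hσ (hQ i) ((hc.comp continuous_fst).mul (hS i))
  rw [Fin.sum_univ_two, ← integral_add (hi 0) (hi 1)]
  refine integral_congr_ae (Eventually.of_forall fun z => ?_)
  simp [inner_plane]

/-- The time-stepping part of the scheme, written in components. -/
theorem sum_cellForm_eq {α t₀ t₁ : ℝ} {ρ : Measure Plane} (hρ : CompactlyCarried ρ)
    {Q Qm r : SpaceTime → Plane} (hQ : ∀ i, MemLp (fun z => Q z i) 2 ((during t₀ t₁).prod ρ))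
    (hQ1 : ∀ i, MemLp (fun z => Q z i) 2 ((atTime t₁).prod ρ))
    (hQm : ∀ i, MemLp (fun z => Qm z i) 2 ((atTime t₀).prod ρ)) (hr : ContDiff ℝ 1 r) :
    ∑ i, cellForm α t₀ t₁ ρ (fun z => Q z i) (fun z => Qm z i) (fun z => r z i)
      = -(∫ z, inner ℝ (Q z) (weight α t₀ z.1 • dt r z) ∂((during t₀ t₁).prod ρ))
        - (∫ z, inner ℝ (Q z) (deriv (weight α t₀) z.1 • r z) ∂((during t₀ t₁).prod ρ))
        + (∫ z, inner ℝ (Q z) (weight α t₀ z.1 • r z) ∂((atTime t₁).prod ρ))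
        - ∫ z, inner ℝ (Qm z) (weight α t₀ z.1 • r z) ∂((atTime t₀).prod ρ) := by
  have c := (compactlyCarried_during t₀ t₁).prod hρ
  have c1 := (compactlyCarried_atTime t₁).prod hρ
  have c0 := (compactlyCarried_atTime t₀).prod hρ
  have hri (i : Fin 2) : ContDiff ℝ 1 fun z => r z i := contDiff_euclidean.1 hr i
  have hd (i : Fin 2) : (fun z => dt r z i) = fun z => fderiv ℝ (fun z => r z i) z (1, 0) :=
    funext fun z => dt_component hr z i
  have hw : deriv (weight α t₀) = fun t => -α * weight α t₀ t := funext (deriv_weight α t₀)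
  rw [hw, integral_inner_smul c hQ (fun i => by
      rw [hd i]; exact continuous_fderiv_apply (hri i) _) (continuous_weight α t₀),
    integral_inner_smul (c := fun t => -α * weight α t₀ t) c hQ (fun i => (hri i).continuous)
      (continuous_const.mul (continuous_weight α t₀)),
    integral_inner_smul c1 hQ1 (fun i => (hri i).continuous) (continuous_weight α t₀),
    integral_inner_smul c0 hQm (fun i => (hri i).continuous) (continuous_weight α t₀)]
  have h2 (i : Fin 2) : ∫ z, Q z i * (-α * weight α t₀ z.1 * r z i) ∂((during t₀ t₁).prod ρ)
      = -(α * ∫ z, Q z i * (weight α t₀ z.1 * r z i) ∂((during t₀ t₁).prod ρ)) := by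
    rw [← integral_const_mul, ← integral_neg]
    congr 1; funext z; ring
  simp only [h2, Fin.sum_univ_two, cellForm, dt_component hr]
  ring

section Exact

variable {dom : FlowDomain} {mesh : SpatialMesh dom} {T : ℝ} {N : ℕ} {q : SpaceTime → Plane}
  {v : SpaceTime → ℝ} {α t₀ t₁ : ℝ} {K : Finset Plane} {p : ℕ}

theorem SpatialMesh.affineIndependent (hK : K ∈ mesh.elements) :
    AffineIndependent ℝ ((↑) : K → Plane) :=
  mesh.complex.indep ((mesh.mem_elements).1 hK).1

theorem SpatialMesh.exists_lateral (hK : K ∈ mesh.elements) (h0 : 0 ≤ t₀) (h1 : t₁ ≤ T) :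
    ∀ e ∈ edgesOf K, ∃ σ ∈ lateralSurfaces mesh T, (during t₀ t₁).prod (arc e) ≤ σ := by
  intro e he
  have := (compactlyCarried_arc (card_of_mem_edgesOf he)).finite
  have := (compactlyCarried_during t₀ t₁).finite
  have := (compactlyCarried_during 0 T).finite
  exact ⟨_, ⟨e, mesh.edge_of_element hK he, rfl⟩, Measure.prod_mono (during_mono h0 h1) le_rfl⟩

theorem SpatialMesh.exists_level (hK : K ∈ mesh.elements) {n : ℕ} (hn : n ≤ N) :
    ∃ σ ∈ timeSurfaces dom T N, (atTime (n * (T / N))).prod (area K) ≤ σ := by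
  have := (compactlyCarried_area K).finite
  have := (compactlyCarried_atTime (n * (T / N))).finite
  exact ⟨_, ⟨n, hn, rfl⟩, Measure.prod_mono le_rfl
    (dom.area_le (mesh.hull_subset ((mesh.mem_elements).1 hK).1))⟩

theorem SpatialMesh.slab_le (hK : K ∈ mesh.elements) (h0 : 0 ≤ t₀) (h1 : t₁ ≤ T) :
    (during t₀ t₁).prod (area K) ≤ volume.restrict (dom.spaceTime T) :=
  during_prod_area_le (mesh.hull_subset ((mesh.mem_elements).1 hK).1) h0 h1

theorem IsExactSolution.memLp_element (hqv : IsExactSolution mesh T N q v) (hK : K ∈ mesh.elements)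
    (h0 : 0 ≤ t₀) (h1 : t₁ ≤ T) :
    MemLp v 2 ((during t₀ t₁).prod (area K)) ∧
      ∀ i, MemLp (fun z => q z i) 2 ((during t₀ t₁).prod (area K)) := by
  obtain ⟨Dv, Dq, hv, hq, -, -⟩ := hqv.equations
  exact ⟨hv.memLp.mono_measure (SpatialMesh.slab_le hK h0 h1),
    fun i => (hq i).memLp.mono_measure (SpatialMesh.slab_le hK h0 h1)⟩

theorem IsExactSolution.memLp_level (hqv : IsExactSolution mesh T N q v) (hK : K ∈ mesh.elements)
    {n : ℕ} (hn : n ≤ N) (i : Fin 2) :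
    MemLp (fun z => q z i) 2 ((atTime (n * (T / N))).prod (area K)) := by
  obtain ⟨Dv, Dq, hv, hq, -, -⟩ := hqv.equations
  obtain ⟨σ, hσ, hle⟩ := SpatialMesh.exists_level (T := T) hK hn
  exact ((hq i).memLp_trace σ (Or.inr hσ)).mono_measure hle

/-- Consistency of the first equation of the scheme on one element. -/
theorem IsExactSolution.element_identity (hqv : IsExactSolution mesh T N q v)
    (hK : K ∈ mesh.elements) {n m : ℕ} (hn : n ≤ N) (hm : m ≤ N) (hn0 : t₀ = n * (T / N))
    (hm1 : t₁ = m * (T / N)) (h0 : 0 ≤ t₀) (h01 : t₀ ≤ t₁) (h1 : t₁ ≤ T) {r : SpaceTime → Plane}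
    (hr : ContDiff ℝ 1 r) :
    ∑ i, cellForm α t₀ t₁ (area K) (fun z => q z i) (fun z => q z i) (fun z => r z i)
      + pairing α t₀ ((during t₀ t₁).prod (area K)) v (divx r)
      - ∑ e ∈ edgesOf K, pairing α t₀ ((during t₀ t₁).prod (arc e)) v
          (fun z => inner ℝ (r z) (normal K e)) = 0 := by
  have hmv := (hqv.memLp_element hK h0 h1).1
  have hmq := (hqv.memLp_element hK h0 h1).2
  have hface (e) (he : e ∈ edgesOf K) := (hqv.memLp_face h0 h1 (mesh.edge_of_element hK he)).1
  obtain ⟨Dv, Dq, hv, hq, hDt, -⟩ := hqv.equations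
  have hle := SpatialMesh.slab_le hK h0 h1
  have hcard := ((mesh.mem_elements).1 hK).2
  have hlat := SpatialMesh.exists_lateral hK h0 h1
  have c := (compactlyCarried_during t₀ t₁).prod (compactlyCarried_area K)
  have hri (i : Fin 2) : ContDiff ℝ 1 fun z => r z i := contDiff_euclidean.1 hr i
  have hh (i : Fin 2) : ContDiff ℝ 1 fun z : SpaceTime => weight α t₀ z.1 * r z i :=
    (contDiff_weight_fst α t₀).mul (hri i)
  -- in time, the weak time derivative of `q` is replaced by the gradient of `v`
  have htime (i : Fin 2) : cellForm α t₀ t₁ (area K) (fun z => q z i) (fun z => q z i)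
      (fun z => r z i)
      = ∫ z, Dv i z * (weight α t₀ z.1 * r z i) ∂((during t₀ t₁).prod (area K)) := by
    have hl0 : ∃ σ ∈ lateralSurfaces mesh T ∪ timeSurfaces dom T N,
        (atTime t₀).prod (area K) ≤ σ := by
      obtain ⟨σ, hσ, hle⟩ := SpatialMesh.exists_level (T := T) hK hn
      exact ⟨σ, Or.inr hσ, hn0 ▸ hle⟩
    have hl1 : ∃ σ ∈ lateralSurfaces mesh T ∪ timeSurfaces dom T N,
        (atTime t₁).prod (area K) ≤ σ := by
      obtain ⟨σ, hσ, hle⟩ := SpatialMesh.exists_level (T := T) hK hm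
      exact ⟨σ, Or.inr hσ, hm1 ▸ hle⟩
    have hg := green_time (hq i) h01 hle hl0 hl1 0 rfl (hh i)
    have hsame : ∫ z, Dq i 0 z * (weight α t₀ z.1 * r z i) ∂((during t₀ t₁).prod (area K))
        = ∫ z, Dv i z * (weight α t₀ z.1 * r z i) ∂((during t₀ t₁).prod (area K)) := by
      refine integral_congr_ae ?_
      filter_upwards [Measure.absolutelyContinuous_of_le hle (hDt i)] with z hz
      rw [sub_eq_zero.1 hz]
    have hsplit : ∫ z, q z i * fderiv ℝ (fun z : SpaceTime => weight α t₀ z.1 * r z i) z (1, 0)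
          ∂((during t₀ t₁).prod (area K))
        = (∫ z, q z i * (weight α t₀ z.1 * fderiv ℝ (fun z => r z i) z (1, 0))
            ∂((during t₀ t₁).prod (area K)))
          - α * ∫ z, q z i * (weight α t₀ z.1 * r z i) ∂((during t₀ t₁).prod (area K)) := by
      have hi : Integrable (fun z => q z i * (weight α t₀ z.1
          * fderiv ℝ (fun z => r z i) z (1, 0))) ((during t₀ t₁).prod (area K)) :=
        MemLp.integrable_mul_continuous c (hmq i) ((continuous_weight_fst α t₀).mul
          (continuous_fderiv_apply (hri i) _))
      rw [← integral_const_mul, ← integral_sub hi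
        ((MemLp.integrable_mul_continuous c (hmq i) (hh i).continuous).const_mul α)]
      refine integral_congr_ae (Eventually.of_forall fun z => ?_)
      simp only [fderiv_weight_mul_time α t₀ (hri i)]
      ring
    rw [hsplit, hsame] at hg
    simp only [cellForm]
    linarith
  -- in space, the gradient of `v` is moved to the test function
  have hspace (i : Fin 2) := green_space hv hcard (SpatialMesh.affineIndependent hK) hle hlat i
    (EuclideanSpace.single i 1) rfl (hh i)
  simp only [fderiv_weight_mul_space α t₀ (hri _)] at hspace
  have hdiv : pairing α t₀ ((during t₀ t₁).prod (area K)) v (divx r)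
      = ∑ i : Fin 2, ∫ z, v z * (weight α t₀ z.1
          * fderiv ℝ (fun z => r z i) z (0, EuclideanSpace.single i 1))
          ∂((during t₀ t₁).prod (area K)) := by
    have hi (i : Fin 2) : Integrable (fun z => v z * (weight α t₀ z.1
          * fderiv ℝ (fun z => r z i) z (0, EuclideanSpace.single i 1)))
          ((during t₀ t₁).prod (area K)) := MemLp.integrable_mul_continuous c hmv
        ((continuous_weight_fst α t₀).mul (continuous_fderiv_apply (hri i) _))
    rw [Fin.sum_univ_two, ← integral_add (hi 0) (hi 1)]
    refine integral_congr_ae (Eventually.of_forall fun z => ?_)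
    simp only [divx_eq hr, spaceDir]
    ring
  have hsides : ∑ e ∈ edgesOf K, pairing α t₀ ((during t₀ t₁).prod (arc e)) v
        (fun z => inner ℝ (r z) (normal K e))
      = ∑ i : Fin 2, ∑ e ∈ edgesOf K, ∫ z, v z * (weight α t₀ z.1 * r z i
          * inner ℝ (normal K e) (EuclideanSpace.single i 1)) ∂((during t₀ t₁).prod (arc e)) := by
    rw [Finset.sum_comm]
    refine Finset.sum_congr rfl fun e he => ?_
    have ce := (compactlyCarried_during t₀ t₁).prod
      (compactlyCarried_arc (card_of_mem_edgesOf he))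
    have hi (i : Fin 2) : Integrable (fun z => v z * (weight α t₀ z.1 * r z i
          * inner ℝ (normal K e) (EuclideanSpace.single i 1))) ((during t₀ t₁).prod (arc e)) :=
      MemLp.integrable_mul_continuous ce (hface e he) ((hh i).continuous.mul continuous_const)
    rw [Fin.sum_univ_two, ← integral_add (hi 0) (hi 1)]
    refine integral_congr_ae (Eventually.of_forall fun z => ?_)
    simp [inner_plane]
    ring
  rw [hdiv, hsides]
  simp only [htime, Fin.sum_univ_two]
  have := hspace 0
  have := hspace 1
  linarith

/-- Integration by parts for a divergence-free field. -/
theorem IsExactSolution.divergence_free (hqv : IsExactSolution mesh T N q v)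
    (hK : K ∈ mesh.elements) (h0 : 0 ≤ t₀) (h1 : t₁ ≤ T) {h : SpaceTime → ℝ}
    (hh : ContDiff ℝ 1 h) :
    ∑ i, ∫ z, q z i * fderiv ℝ h z (0, EuclideanSpace.single i 1) ∂((during t₀ t₁).prod (area K))
      = ∑ e ∈ edgesOf K, ∫ z, inner ℝ (q z) (normal K e) * h z
          ∂((during t₀ t₁).prod (arc e)) := by
  have hface (e) (he : e ∈ edgesOf K) := (hqv.memLp_face h0 h1 (mesh.edge_of_element hK he)).2
  obtain ⟨Dv, Dq, hv, hq, -, hdiv⟩ := hqv.equations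
  have hle := SpatialMesh.slab_le hK h0 h1
  have c := (compactlyCarried_during t₀ t₁).prod (compactlyCarried_area K)
  have hlat : ∀ e ∈ edgesOf K, ∃ σ ∈ lateralSurfaces mesh T ∪ timeSurfaces dom T N,
      (during t₀ t₁).prod (arc e) ≤ σ := fun e he => by
    obtain ⟨σ, hσ, h⟩ := SpatialMesh.exists_lateral hK h0 h1 e he
    exact ⟨σ, Or.inl hσ, h⟩
  have hspace (i : Fin 2) := green_space (hq i) ((mesh.mem_elements).1 hK).2
    (SpatialMesh.affineIndependent hK) hle hlat i.succ (EuclideanSpace.single i 1)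
    (by fin_cases i <;> rfl) hh
  have hzero : ∑ i : Fin 2, ∫ z, Dq i i.succ z * h z ∂((during t₀ t₁).prod (area K)) = 0 := by
    have hi (i : Fin 2) : Integrable (fun z => Dq i i.succ z * h z)
        ((during t₀ t₁).prod (area K)) := MemLp.integrable_mul_continuous c
      (((hq i).memLp_deriv i.succ).mono_measure hle) hh.continuous
    rw [Fin.sum_univ_two, ← integral_add (hi 0) (hi 1)]
    refine integral_eq_zero_of_ae ?_
    filter_upwards [Measure.absolutelyContinuous_of_le hle hdiv] with z hz
    rw [Fin.sum_univ_two] at hz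
    simp only [Pi.zero_apply, ← add_mul, hz, zero_mul]
  have hsides : ∑ e ∈ edgesOf K, ∫ z, inner ℝ (q z) (normal K e) * h z
        ∂((during t₀ t₁).prod (arc e))
      = ∑ i : Fin 2, ∑ e ∈ edgesOf K, ∫ z, q z i
          * (h z * inner ℝ (normal K e) (EuclideanSpace.single i 1))
          ∂((during t₀ t₁).prod (arc e)) := by
    rw [Finset.sum_comm]
    refine Finset.sum_congr rfl fun e he => ?_
    have ce := (compactlyCarried_during t₀ t₁).prod
      (compactlyCarried_arc (card_of_mem_edgesOf he))
    have hi (i : Fin 2) : Integrable (fun z => q z i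
          * (h z * inner ℝ (normal K e) (EuclideanSpace.single i 1)))
          ((during t₀ t₁).prod (arc e)) :=
      MemLp.integrable_mul_continuous ce (hface e he i) (hh.continuous.mul continuous_const)
    rw [Fin.sum_univ_two, ← integral_add (hi 0) (hi 1)]
    refine integral_congr_ae (Eventually.of_forall fun z => ?_)
    simp [inner_plane]
    ring
  rw [hsides]
  rw [Fin.sum_univ_two] at hzero ⊢
  have := hspace 0
  have := hspace 1
  rw [Fin.sum_univ_two]
  linarith

/-- Integration by parts for a smooth field, against a smooth function. -/
theorem integral_mul_divx (hK : K ∈ mesh.elements) {r : SpaceTime → Plane} (hr : ContDiff ℝ 1 r)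
    {h : SpaceTime → ℝ} (hh : ContDiff ℝ 1 h) :
    ∫ z, h z * divx r z ∂((during t₀ t₁).prod (area K))
      + ∑ i, ∫ z, r z i * fderiv ℝ h z (0, EuclideanSpace.single i 1)
          ∂((during t₀ t₁).prod (area K))
      = ∑ e ∈ edgesOf K, ∫ z, inner ℝ (r z) (normal K e) * h z
          ∂((during t₀ t₁).prod (arc e)) := by
  have c := (compactlyCarried_during t₀ t₁).prod (compactlyCarried_area K)
  have hri (i : Fin 2) : ContDiff ℝ 1 fun z => r z i := contDiff_euclidean.1 hr i
  have hcr (i : Fin 2) := (hri i).continuous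
  have hcd (i : Fin 2) := continuous_fderiv_apply (hri i) (0, EuclideanSpace.single i 1)
  have hch (i : Fin 2) := continuous_fderiv_apply hh (0, EuclideanSpace.single i 1)
  have i1 (i : Fin 2) : Integrable (fun z => h z
      * fderiv ℝ (fun z => r z i) z (0, EuclideanSpace.single i 1))
      ((during t₀ t₁).prod (area K)) :=
    c.integrable (hh.continuous.mul (hcd i))
  have i2 (i : Fin 2) : Integrable (fun z => r z i
      * fderiv ℝ h z (0, EuclideanSpace.single i 1)) ((during t₀ t₁).prod (area K)) :=
    c.integrable ((hcr i).mul (hch i))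
  have hparts (i : Fin 2) := integral_fderiv_space ((mesh.mem_elements).1 hK).2
    (SpatialMesh.affineIndependent hK) (compactlyCarried_during t₀ t₁) (hh.mul (hri i))
    (EuclideanSpace.single i 1)
  have hleft (i : Fin 2) : ∫ z, fderiv ℝ (fun z => h z * r z i) z (0, EuclideanSpace.single i 1)
        ∂((during t₀ t₁).prod (area K))
      = (∫ z, h z * fderiv ℝ (fun z => r z i) z (0, EuclideanSpace.single i 1)
          ∂((during t₀ t₁).prod (area K)))
        + ∫ z, r z i * fderiv ℝ h z (0, EuclideanSpace.single i 1)
          ∂((during t₀ t₁).prod (area K)) := by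
    rw [← integral_add (i1 i) (i2 i)]
    refine integral_congr_ae (Eventually.of_forall fun z => ?_)
    simp only
    rw [fderiv_fun_mul (hh.differentiable one_ne_zero z) ((hri i).differentiable one_ne_zero z)]
    simp
  have hdiv : ∫ z, h z * divx r z ∂((during t₀ t₁).prod (area K))
      = ∑ i : Fin 2, ∫ z, h z * fderiv ℝ (fun z => r z i) z (0, EuclideanSpace.single i 1)
          ∂((during t₀ t₁).prod (area K)) := by
    rw [Fin.sum_univ_two, ← integral_add (i1 0) (i1 1)]
    refine integral_congr_ae (Eventually.of_forall fun z => ?_)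
    simp only [divx_eq hr, spaceDir]
    ring
  have hsides : ∑ e ∈ edgesOf K, ∫ z, inner ℝ (r z) (normal K e) * h z
        ∂((during t₀ t₁).prod (arc e))
      = ∑ i : Fin 2, ∑ e ∈ edgesOf K, ∫ z, h z * r z i
          * inner ℝ (normal K e) (EuclideanSpace.single i 1)
          ∂((during t₀ t₁).prod (arc e)) := by
    rw [Finset.sum_comm]
    refine Finset.sum_congr rfl fun e he => ?_
    have ce := (compactlyCarried_during t₀ t₁).prod
      (compactlyCarried_arc (card_of_mem_edgesOf he))
    have hi (i : Fin 2) : Integrable (fun z => h z * r z i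
          * inner ℝ (normal K e) (EuclideanSpace.single i 1)) ((during t₀ t₁).prod (arc e)) :=
      ce.integrable ((hh.continuous.mul (hcr i)).mul continuous_const)
    rw [Fin.sum_univ_two, ← integral_add (hi 0) (hi 1)]
    refine integral_congr_ae (Eventually.of_forall fun z => ?_)
    simp [inner_plane]
    ring
  rw [hdiv, hsides]
  have e0 := hparts 0
  have e1 := hparts 1
  rw [hleft] at e0 e1
  simp only [Fin.sum_univ_two]
  linarith

end Exact

/-! ### Error equations on a slab -/

theorem pairing_comm (α t₀ : ℝ) (σ : Measure SpaceTime) (u g : SpaceTime → ℝ) :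
    pairing α t₀ σ u g = pairing α t₀ σ g u := by
  simp only [pairing]
  congr 1; funext z; ring

theorem localV_sub {p : ℕ} {r s : SpaceTime → Plane} (hr : r ∈ localV p) (hs : s ∈ localV p) :
    (fun z => r z - s z) ∈ localV p := fun i => (localW p).sub_mem (hr i) (hs i)

theorem continuous_divx {r : SpaceTime → Plane} (hr : ContDiff ℝ 1 r) : Continuous (divx r) := by
  rw [show divx r = _ from funext (divx_eq hr)]
  exact (continuous_fderiv_apply (contDiff_euclidean.1 hr 0) _).add
    (continuous_fderiv_apply (contDiff_euclidean.1 hr 1) _)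

theorem divx_sub {r s : SpaceTime → Plane} (hr : ContDiff ℝ 1 r) (hs : ContDiff ℝ 1 s)
    (z : SpaceTime) : divx (fun z => r z - s z) z = divx r z - divx s z := by
  have hi (i : Fin 2) : fderiv ℝ (fun z => (r z - s z) i) z
      = fderiv ℝ (fun z => r z i) z - fderiv ℝ (fun z => s z i) z :=
    fderiv_fun_sub ((contDiff_euclidean.1 hr i).differentiable one_ne_zero z)
      ((contDiff_euclidean.1 hs i).differentiable one_ne_zero z)
  rw [divx_eq (hr.sub hs), divx_eq hr, divx_eq hs, hi, hi]
  simp only [sub_apply]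
  ring

section Element

variable {dom : FlowDomain} {mesh : SpatialMesh dom} {T : ℝ} {N : ℕ} {q : SpaceTime → Plane}
  {v : SpaceTime → ℝ} {α t₀ t₁ : ℝ} {K : Finset Plane} {p : ℕ}
  {τ : Finset Plane → Finset Plane → ℝ} {PV : SpaceTime → Plane} {PW : SpaceTime → ℝ}

theorem memLp_inner {σ : Measure SpaceTime} {r : SpaceTime → Plane}
    (hr : ∀ i, MemLp (fun z => r z i) 2 σ) (n : Plane) :
    MemLp (fun z => inner ℝ (r z) n) 2 σ := by
  simp only [inner_plane]
  exact ((hr 0).mul_const _).add ((hr 1).mul_const _)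

theorem memLp_component {σ : Measure SpaceTime} (hσ : CompactlyCarried σ) {r : SpaceTime → Plane}
    (hr : r ∈ localV p) (i : Fin 2) : MemLp (fun z => r z i) 2 σ :=
  hσ.memLp (contDiff_of_mem_localW (hr i)).continuous 2

/-- On a face, the normal component of the projection error is `τ` times the error of the scalar
projection, when tested with polynomials. -/
theorem IsElementProjection.flux (hP : IsElementProjection p α τ t₀ t₁ K q v PV PW)
    (hqv : IsExactSolution mesh T N q v) (hK : K ∈ mesh.elements) (h0 : 0 ≤ t₀) (h1 : t₁ ≤ T)
    {e : Finset Plane} (he : e ∈ edgesOf K) {s : SpaceTime → ℝ} (hs : s ∈ localM p e) :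
    pairing α t₀ ((during t₀ t₁).prod (arc e)) (fun z => inner ℝ (PV z) (normal K e)) s
      - pairing α t₀ ((during t₀ t₁).prod (arc e)) (fun z => inner ℝ (q z) (normal K e)) s
      = τ K e * (pairing α t₀ ((during t₀ t₁).prod (arc e)) PW s
        - pairing α t₀ ((during t₀ t₁).prod (arc e)) v s) := by
  have hcard := card_of_mem_edgesOf he
  have cd := compactlyCarried_during t₀ t₁
  have hte : IsTest α t₀ ((during t₀ t₁).prod (arc e)) s := isTest_of_mem_localM cd hcard hs
  have hm := hqv.memLp_face h0 h1 (mesh.edge_of_element hK he)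
  have hPV := memLp_of_mem_localM cd hcard (inner_mem_localM e hP.mem_V (normal K e))
  have hPW := memLp_of_mem_localM cd hcard (localM_of_mem_localW e hP.mem_W)
  have h : pairing α t₀ ((during t₀ t₁).prod (arc e))
        (fun z => inner ℝ (PV z) (normal K e) - τ K e * PW z) s
      = pairing α t₀ ((during t₀ t₁).prod (arc e))
        (fun z => inner ℝ (q z) (normal K e) - τ K e * v z) s := hP.eq_face e he s hs
  rw [pairing_sub_left hPV (hPW.const_mul _) hte, pairing_const_mul_left,
    pairing_sub_left (memLp_inner hm.2 _) (hm.1.const_mul _) hte, pairing_const_mul_left] at h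
  linarith

/-- The projections satisfy the second equation of the scheme exactly: `∇·q = 0`, and the defining
conditions of the projection replace `q` by its projection. -/
theorem IsElementProjection.second_equation (hP : IsElementProjection p α τ t₀ t₁ K q v PV PW)
    (hqv : IsExactSolution mesh T N q v) (hK : K ∈ mesh.elements) (h0 : 0 ≤ t₀) (h1 : t₁ ≤ T)
    {PM : Finset Plane → SpaceTime → ℝ}
    (hPM : ∀ e ∈ mesh.edges, IsFaceProjection p α t₀ t₁ e v (PM e)) {w : SpaceTime → ℝ}
    (hw : w ∈ localW p) :
    pairing α t₀ ((during t₀ t₁).prod (area K)) w (divx PV)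
      = ∑ e ∈ edgesOf K, pairing α t₀ ((during t₀ t₁).prod (arc e))
          (fun z => τ K e * (PW z - PM e z)) w := by
  have cd := compactlyCarried_during t₀ t₁
  have c := cd.prod (compactlyCarried_area K)
  have hPV1 : ContDiff ℝ 1 PV := (contDiff_of_mem_localV hP.mem_V).of_le (by norm_num)
  have hw1 : ContDiff ℝ 1 w := (contDiff_of_mem_localW hw).of_le (by norm_num)
  have hh : ContDiff ℝ 1 fun z : SpaceTime => weight α t₀ z.1 * w z :=
    (contDiff_weight_fst α t₀).mul hw1
  -- the gradient of `w` is an admissible test function for the projection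
  have hgrad : ∑ i, ∫ z, PV z i * fderiv ℝ (fun z : SpaceTime => weight α t₀ z.1 * w z) z
          (0, EuclideanSpace.single i 1) ∂((during t₀ t₁).prod (area K))
      = ∑ i, ∫ z, q z i * fderiv ℝ (fun z : SpaceTime => weight α t₀ z.1 * w z) z
          (0, EuclideanSpace.single i 1) ∂((during t₀ t₁).prod (area K)) := by
    have hc (i : Fin 2) : Continuous fun z => fderiv ℝ w z (0, EuclideanSpace.single i 1) :=
      continuous_fderiv_apply hw1 _
    have h := hP.eq_V (fun z => !₂[fderiv ℝ w z (spaceDir 0), fderiv ℝ w z (spaceDir 1)])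
      (fun i => by fin_cases i <;> exact fderiv_mem_localWTilde hw _)
    have hS (i : Fin 2) : Continuous fun z : SpaceTime =>
        (!₂[fderiv ℝ w z (spaceDir 0), fderiv ℝ w z (spaceDir 1)] : Plane) i := by
      fin_cases i
      · exact hc 0
      · exact hc 1
    rw [integral_inner_smul c (fun i => memLp_component c hP.mem_V i) hS (continuous_weight α t₀),
      integral_inner_smul c (hqv.memLp_element hK h0 h1).2 hS (continuous_weight α t₀)] at h
    simp only [fderiv_weight_mul_space α t₀ hw1]
    rw [Fin.sum_univ_two, Fin.sum_univ_two] at h ⊢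
    exact h
  have hparts := integral_mul_divx (t₀ := t₀) (t₁ := t₁) hK hPV1 hh
  rw [hgrad, hqv.divergence_free hK h0 h1 hh] at hparts
  have hL : pairing α t₀ ((during t₀ t₁).prod (area K)) w (divx PV)
      = ∫ z, weight α t₀ z.1 * w z * divx PV z ∂((during t₀ t₁).prod (area K)) := by
    simp only [pairing]; congr 1; funext z; ring
  have hswap (e : Finset Plane) (r : SpaceTime → Plane) :
      ∫ z, inner ℝ (r z) (normal K e) * (weight α t₀ z.1 * w z) ∂((during t₀ t₁).prod (arc e))
        = pairing α t₀ ((during t₀ t₁).prod (arc e)) (fun z => inner ℝ (r z) (normal K e)) w := by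
    simp only [pairing]; congr 1; funext z; ring
  simp only [hswap] at hparts
  rw [hL, eq_sub_of_add_eq hparts, ← Finset.sum_sub_distrib]
  refine Finset.sum_congr rfl fun e he => ?_
  have hcard := card_of_mem_edgesOf he
  have hM := hPM e (mesh.edge_of_element hK he)
  have hwM := localM_of_mem_localW e hw
  have hproj : pairing α t₀ ((during t₀ t₁).prod (arc e)) (PM e) w
      = pairing α t₀ ((during t₀ t₁).prod (arc e)) v w := hM.2 w hwM
  rw [hP.flux hqv hK h0 h1 he hwM, pairing_const_mul_left, pairing_sub_left
    (memLp_of_mem_localM cd hcard (localM_of_mem_localW e hP.mem_W))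
    (memLp_of_mem_localM cd hcard hM.1) (isTest_of_mem_localM cd hcard hwM), hproj]

end Element

/-- The situation on one time slab: exact solution, scheme, projections, and the values `qm`, `lm`
of the scheme and `PVm`, `PMm` of the projections from before the slab. Here `PM` is a face
projection that is compatible with the periodicity. -/
structure IsSlab {dom : FlowDomain} (mesh : SpatialMesh dom) (T : ℝ) (N p : ℕ) (α : ℝ)
    (τ : Finset Plane → Finset Plane → ℝ) (t₀ t₁ : ℝ) (q : SpaceTime → Plane)
    (v : SpaceTime → ℝ) (qm PVm qh PV : Finset Plane → SpaceTime → Plane)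
    (lm PMm vh lh PW PM : Finset Plane → SpaceTime → ℝ) : Prop where
  exact_solution : IsExactSolution mesh T N q v
  nonneg : 0 ≤ t₀
  lt : t₀ < t₁
  le : t₁ ≤ T
  levels : ∃ n m : ℕ, n ≤ N ∧ m ≤ N ∧ t₀ = n * (T / N) ∧ t₁ = m * (T / N)
  scheme : IsHDGSolution mesh p α τ t₀ t₁ qm lm qh vh lh
  element : ∀ K ∈ mesh.elements, IsElementProjection p α τ t₀ t₁ K q v (PV K) (PW K)
  face : ∀ e ∈ mesh.edges, IsFaceProjection p α t₀ t₁ e v (PM e)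
  mem_M : PM ∈ spaceM mesh p
  memLp_qm : ∀ K ∈ mesh.elements, ∀ i, MemLp (fun z => qm K z i) 2 ((atTime t₀).prod (area K))
  memLp_PVm : ∀ K ∈ mesh.elements, ∀ i, MemLp (fun z => PVm K z i) 2 ((atTime t₀).prod (area K))
  memLp_lm : ∀ e ∈ mesh.surfaceEdges, MemLp (lm e) 2 ((atTime t₀).prod (arc e))
  memLp_PMm : ∀ e ∈ mesh.surfaceEdges, MemLp (PMm e) 2 ((atTime t₀).prod (arc e))

namespace IsSlab

variable {dom : FlowDomain} {mesh : SpatialMesh dom} {T : ℝ} {N p : ℕ} {α : ℝ}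
  {τ : Finset Plane → Finset Plane → ℝ} {t₀ t₁ : ℝ} {q : SpaceTime → Plane}
  {v : SpaceTime → ℝ} {qm PVm qh PV : Finset Plane → SpaceTime → Plane}
  {lm PMm vh lh PW PM : Finset Plane → SpaceTime → ℝ}

theorem memLp_q_levels
    (S : IsSlab mesh T N p α τ t₀ t₁ q v qm PVm qh PV lm PMm vh lh PW PM)
    {K : Finset Plane} (hK : K ∈ mesh.elements) (i : Fin 2) :
    MemLp (fun z => q z i) 2 ((atTime t₀).prod (area K)) ∧
      MemLp (fun z => q z i) 2 ((atTime t₁).prod (area K)) := by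
  obtain ⟨n, m, hn, hm, rfl, rfl⟩ := S.levels
  exact ⟨S.exact_solution.memLp_level hK hn i, S.exact_solution.memLp_level hK hm i⟩

/-- The first error equation: the projection error of `q` enters through the time derivative only. -/
theorem first_error (S : IsSlab mesh T N p α τ t₀ t₁ q v qm PVm qh PV lm PMm vh lh PW PM)
    {r : Finset Plane → SpaceTime → Plane} (hr : r ∈ spaceV mesh p) :
    ∑ K ∈ mesh.elements,
      (∑ i, cellForm α t₀ t₁ (area K) (fun z => PV K z i - qh K z i)
          (fun z => PVm K z i - qm K z i) (fun z => r K z i)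
        + pairing α t₀ ((during t₀ t₁).prod (area K)) (fun z => PW K z - vh K z) (divx (r K))
        - ∑ e ∈ edgesOf K, pairing α t₀ ((during t₀ t₁).prod (arc e))
            (fun z => PM e z - lh e z) (fun z => inner ℝ (r K z) (normal K e)))
      = ∑ K ∈ mesh.elements, ∑ i, cellForm α t₀ t₁ (area K) (fun z => PV K z i - q z i)
          (fun z => PVm K z i - q z i) (fun z => r K z i) := by
  have cd := compactlyCarried_during t₀ t₁
  have c1 := compactlyCarried_atTime t₁
  have hscheme : ∑ K ∈ mesh.elements,
      (∑ i, cellForm α t₀ t₁ (area K) (fun z => qh K z i) (fun z => qm K z i) (fun z => r K z i)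
        + pairing α t₀ ((during t₀ t₁).prod (area K)) (vh K) (divx (r K))
        - ∑ e ∈ edgesOf K, pairing α t₀ ((during t₀ t₁).prod (arc e))
            (lh e) (fun z => inner ℝ (r K z) (normal K e))) = 0 := by
    have h := S.scheme.eq_q r hr
    have hcell : ∀ K ∈ mesh.elements, _ := fun K hK =>
      sum_cellForm_eq (α := α) (t₀ := t₀) (t₁ := t₁) (compactlyCarried_area K)
        (fun i => memLp_component (cd.prod (compactlyCarried_area K)) (S.scheme.mem_V K hK) i)
        (fun i => memLp_component (c1.prod (compactlyCarried_area K)) (S.scheme.mem_V K hK) i)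
        (S.memLp_qm K hK) ((contDiff_of_mem_localV (hr K hK)).of_le (by norm_num))
    have hdiv : ∀ K, ∫ z, vh K z * (weight α t₀ z.1 * divx (r K) z) ∂(during t₀ t₁).prod (area K)
        = pairing α t₀ ((during t₀ t₁).prod (area K)) (vh K) (divx (r K)) := fun K => by
      simp only [pairing]; congr 1; funext z; ring
    rw [Finset.sum_sub_distrib, Finset.sum_add_distrib, Finset.sum_congr rfl hcell]
    simp only [Finset.sum_sub_distrib, Finset.sum_add_distrib, Finset.sum_neg_distrib, ← hdiv]
    simp only [pairing]
    linarith
  rw [← sub_zero (∑ K ∈ mesh.elements, ∑ i, cellForm _ _ _ _ _ _ _), ← hscheme,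
    ← Finset.sum_sub_distrib]
  refine Finset.sum_congr rfl fun K hK => ?_
  have hEl := S.element K hK
  have cK := compactlyCarried_area K
  have c := cd.prod cK
  have hrK := hr K hK
  have hr1 : ContDiff ℝ 1 (r K) := (contDiff_of_mem_localV hrK).of_le (by norm_num)
  obtain ⟨n, m, hn, hm, hn0, hm1⟩ := S.levels
  have hid := S.exact_solution.element_identity (α := α) hK hn hm hn0 hm1 S.nonneg S.lt.le S.le hr1
  have hmq := (S.exact_solution.memLp_element hK S.nonneg S.le).2
  have hcq (i : Fin 2) := cellForm_sub (α := α) cK (contDiff_euclidean.1 hr1 i)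
    (memLp_component c hEl.mem_V i) (memLp_component c (S.scheme.mem_V K hK) i)
    (memLp_component (c1.prod cK) hEl.mem_V i)
    (memLp_component (c1.prod cK) (S.scheme.mem_V K hK) i) (S.memLp_PVm K hK i)
    (S.memLp_qm K hK i)
  have hcd (i : Fin 2) := cellForm_sub (α := α) cK (contDiff_euclidean.1 hr1 i)
    (memLp_component c hEl.mem_V i) (hmq i)
    (memLp_component (c1.prod cK) hEl.mem_V i)
    (S.memLp_q_levels hK i).2 (S.memLp_PVm K hK i) (S.memLp_q_levels hK i).1
  have hdivT := divx_mem_localWTilde hrK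
  have hW : pairing α t₀ ((during t₀ t₁).prod (area K)) (fun z => PW K z - vh K z) (divx (r K))
      = pairing α t₀ ((during t₀ t₁).prod (area K)) v (divx (r K))
        - pairing α t₀ ((during t₀ t₁).prod (area K)) (vh K) (divx (r K)) := by
    rw [pairing_sub_left (c.memLp (contDiff_of_mem_localW hEl.mem_W).continuous 2)
      (c.memLp (contDiff_of_mem_localW (S.scheme.mem_W K hK)).continuous 2)
      (isTest_of_continuous c (continuous_divx hr1))]
    exact congrArg (· - _) (hEl.eq_W _ hdivT)
  have hM : ∑ e ∈ edgesOf K, pairing α t₀ ((during t₀ t₁).prod (arc e))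
        (fun z => PM e z - lh e z) (fun z => inner ℝ (r K z) (normal K e))
      = (∑ e ∈ edgesOf K, pairing α t₀ ((during t₀ t₁).prod (arc e)) v
          (fun z => inner ℝ (r K z) (normal K e)))
        - ∑ e ∈ edgesOf K, pairing α t₀ ((during t₀ t₁).prod (arc e)) (lh e)
          (fun z => inner ℝ (r K z) (normal K e)) := by
    rw [← Finset.sum_sub_distrib]
    refine Finset.sum_congr rfl fun e he => ?_
    have hcard := card_of_mem_edgesOf he
    have hed := mesh.edge_of_element hK he
    have hin := inner_mem_localM e hrK (normal K e)
    rw [pairing_sub_left (memLp_of_mem_localM cd hcard (S.face e hed).1)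
      (memLp_of_mem_localM cd hcard (S.scheme.mem_M.1 e hed)) (isTest_of_mem_localM cd hcard hin)]
    exact congrArg (· - _) ((S.face e hed).2 _ hin)
  simp only [hcq, hcd, hW, hM, Finset.sum_sub_distrib]
  linarith

/-- The second error equation, in which no projection error remains: this is where the choice of the
projection pays off. -/
theorem second_error (S : IsSlab mesh T N p α τ t₀ t₁ q v qm PVm qh PV lm PMm vh lh PW PM)
    {w : Finset Plane → SpaceTime → ℝ} (hw : w ∈ spaceW mesh p) :
    ∑ K ∈ mesh.elements, pairing α t₀ ((during t₀ t₁).prod (area K)) (w K)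
        (divx (fun z => PV K z - qh K z))
      = ∑ K ∈ mesh.elements, ∑ e ∈ edgesOf K, pairing α t₀ ((during t₀ t₁).prod (arc e))
          (fun z => τ K e * (PW K z - vh K z - (PM e z - lh e z))) (w K) := by
  have cd := compactlyCarried_during t₀ t₁
  have h := S.scheme.eq_v w hw
  have hdiv : ∀ K, ∫ z, w K z * (weight α t₀ z.1 * divx (qh K) z) ∂(during t₀ t₁).prod (area K)
      = pairing α t₀ ((during t₀ t₁).prod (area K)) (divx (qh K)) (w K) := fun K => by
    simp only [pairing]; congr 1; funext z; ring
  simp only [hdiv] at h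
  have hL : ∀ K ∈ mesh.elements, pairing α t₀ ((during t₀ t₁).prod (area K)) (w K)
        (divx (fun z => PV K z - qh K z))
      = (∑ e ∈ edgesOf K, pairing α t₀ ((during t₀ t₁).prod (arc e))
          (fun z => τ K e * (PW K z - PM e z)) (w K))
        - pairing α t₀ ((during t₀ t₁).prod (area K)) (divx (qh K)) (w K) := by
    intro K hK
    have hEl := S.element K hK
    have c := cd.prod (compactlyCarried_area K)
    have h1 : ContDiff ℝ 1 (PV K) := (contDiff_of_mem_localV hEl.mem_V).of_le (by norm_num)
    have h2 : ContDiff ℝ 1 (qh K) :=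
      (contDiff_of_mem_localV (S.scheme.mem_V K hK)).of_le (by norm_num)
    rw [pairing_comm, show divx (fun z => PV K z - qh K z) = _ from funext (divx_sub h1 h2),
      pairing_sub_left (c.memLp (continuous_divx h1) 2) (c.memLp (continuous_divx h2) 2)
        (isTest_of_continuous c (contDiff_of_mem_localW (hw K hK)).continuous),
      pairing_comm _ _ _ (divx (PV K)),
      hEl.second_equation S.exact_solution hK S.nonneg S.le S.face (hw K hK)]
  have hR : ∀ K ∈ mesh.elements, ∀ e ∈ edgesOf K, pairing α t₀ ((during t₀ t₁).prod (arc e))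
        (fun z => τ K e * (PW K z - vh K z - (PM e z - lh e z))) (w K)
      = pairing α t₀ ((during t₀ t₁).prod (arc e)) (fun z => τ K e * (PW K z - PM e z)) (w K)
        - pairing α t₀ ((during t₀ t₁).prod (arc e)) (fun z => τ K e * (vh K z - lh e z))
          (w K) := by
    intro K hK e he
    have hcard := card_of_mem_edgesOf he
    have hed := mesh.edge_of_element hK he
    rw [← pairing_sub_left
      ((memLp_of_mem_localM cd hcard (localM_sub (localM_of_mem_localW e (S.element K hK).mem_W)
        (S.face e hed).1)).const_mul _)
      ((memLp_of_mem_localM cd hcard (localM_sub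
        (localM_of_mem_localW e (S.scheme.mem_W K hK)) (S.scheme.mem_M.1 e hed))).const_mul _)
      (isTest_of_mem_localM cd hcard (localM_of_mem_localW e (hw K hK)))]
    congr 1; funext z; ring
  rw [Finset.sum_congr rfl hL, Finset.sum_congr rfl fun K hK =>
    Finset.sum_congr rfl (hR K hK)]
  simp only [Finset.sum_sub_distrib]
  simp only [pairing] at h ⊢
  linarith

end IsSlab

theorem dt_eq_of_eq_on_hull {e : Finset Plane} {μ μ' : SpaceTime → ℝ} (hμ' : ContDiff ℝ 1 μ')
    (h : ∀ t, ∀ x ∈ convexHull ℝ (e : Set Plane), μ (t, x) = μ' (t, x)) (t : ℝ) {x : Plane}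
    (hx : x ∈ convexHull ℝ (e : Set Plane)) : dt μ (t, x) = fderiv ℝ μ' (t, x) (1, 0) := by
  rw [← dt_apply_eq hμ']
  exact congrArg (fun u => deriv u t) (funext fun s => h s x hx)

/-- The free-surface part of the scheme; a test function that is polynomial on the edge only is
replaced by a smooth extension. -/
theorem cellForm_arc_eq {α t₀ t₁ : ℝ} {e : Finset Plane} (he : e.card = 2)
    {μ μ' : SpaceTime → ℝ} (hμ' : ContDiff ℝ 1 μ')
    (h : ∀ t, ∀ x ∈ convexHull ℝ (e : Set Plane), μ (t, x) = μ' (t, x)) (Q Qm : SpaceTime → ℝ) :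
    cellForm α t₀ t₁ (arc e) Q Qm μ'
      = -(∫ z, Q z * (weight α t₀ z.1 * dt μ z) ∂(during t₀ t₁).prod (arc e))
        - (∫ z, Q z * (μ z * deriv (weight α t₀) z.1) ∂(during t₀ t₁).prod (arc e))
        + (∫ z, Q z * (μ z * weight α t₀ z.1) ∂(atTime t₁).prod (arc e))
        - ∫ z, Qm z * (μ z * weight α t₀ z.1) ∂(atTime t₀).prod (arc e) := by
  have a := arc_ae_mem_hull (compactlyCarried_during t₀ t₁) he
  have a1 := arc_ae_mem_hull (compactlyCarried_atTime t₁) he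
  have a0 := arc_ae_mem_hull (compactlyCarried_atTime t₀) he
  have e1 : ∫ z, Q z * (weight α t₀ z.1 * dt μ z) ∂(during t₀ t₁).prod (arc e)
      = ∫ z, Q z * (weight α t₀ z.1 * fderiv ℝ μ' z (1, 0)) ∂(during t₀ t₁).prod (arc e) := by
    refine integral_congr_ae ?_
    filter_upwards [a] with z hz
    rw [dt_eq_of_eq_on_hull hμ' h z.1 hz]
  have e2 : ∫ z, Q z * (μ z * deriv (weight α t₀) z.1) ∂(during t₀ t₁).prod (arc e)
      = -(α * ∫ z, Q z * (weight α t₀ z.1 * μ' z) ∂(during t₀ t₁).prod (arc e)) := by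
    rw [← integral_const_mul, ← integral_neg]
    refine integral_congr_ae ?_
    filter_upwards [a] with z hz
    rw [deriv_weight, show μ z = μ' z from h z.1 z.2 hz]
    ring
  have e3 : ∫ z, Q z * (μ z * weight α t₀ z.1) ∂(atTime t₁).prod (arc e)
      = ∫ z, Q z * (weight α t₀ z.1 * μ' z) ∂(atTime t₁).prod (arc e) := by
    refine integral_congr_ae ?_
    filter_upwards [a1] with z hz
    rw [show μ z = μ' z from h z.1 z.2 hz]
    ring
  have e4 : ∫ z, Qm z * (μ z * weight α t₀ z.1) ∂(atTime t₀).prod (arc e)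
      = ∫ z, Qm z * (weight α t₀ z.1 * μ' z) ∂(atTime t₀).prod (arc e) := by
    refine integral_congr_ae ?_
    filter_upwards [a0] with z hz
    rw [show μ z = μ' z from h z.1 z.2 hz]
    ring
  rw [e1, e2, e3, e4, cellForm]
  ring

/-- On the free surface, the boundary condition `q·n = -∂ₜv` and the projection property leave only
the errors at the two time levels. -/
theorem surface_projection_error {dom : FlowDomain} {mesh : SpatialMesh dom} {T : ℝ} {N : ℕ}
    {q : SpaceTime → Plane} {v : SpaceTime → ℝ} (hqv : IsExactSolution mesh T N q v)
    {t₀ t₁ : ℝ} (h0 : 0 ≤ t₀) (h01 : t₀ < t₁) (h1 : t₁ ≤ T) {e : Finset Plane}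
    (he : e ∈ mesh.surfaceEdges) {p : ℕ} {α : ℝ} {P Pm : SpaceTime → ℝ}
    (hP : IsFaceProjection p α t₀ t₁ e v P) (hPm : MemLp Pm 2 ((atTime t₀).prod (arc e)))
    {μ μ' : SpaceTime → ℝ} (hμ : μ ∈ localM p e) (hμ' : ContDiff ℝ 1 μ')
    (h : ∀ t, ∀ x ∈ convexHull ℝ (e : Set Plane), μ (t, x) = μ' (t, x)) :
    (∫ z, q z 1 * (μ z * weight α t₀ z.1) ∂(during t₀ t₁).prod (arc e))
        + cellForm α t₀ t₁ (arc e) P Pm μ'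
      = (∫ z, (P z - v z) * (weight α t₀ z.1 * μ' z) ∂(atTime t₁).prod (arc e))
        - ∫ z, (Pm z - v z) * (weight α t₀ z.1 * μ' z) ∂(atTime t₀).prod (arc e) := by
  have hed := (SpatialMesh.mem_surfaceEdges.1 he).1
  have hcard := (mesh.mem_edges.1 hed).2
  have cd := compactlyCarried_during t₀ t₁
  have ce := compactlyCarried_arc hcard
  have c := cd.prod ce
  have c1 := (compactlyCarried_atTime t₁).prod ce
  have c0 := (compactlyCarried_atTime t₀).prod ce
  have a := arc_ae_mem_hull cd hcard
  obtain ⟨hv0, hv1, hibp⟩ := hqv.surface h0 h01 h1 he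
  have hv := (hqv.memLp_face h0 h1 hed).1
  have hh : ContDiff ℝ 1 fun z : SpaceTime => weight α t₀ z.1 * μ' z :=
    (contDiff_weight_fst α t₀).mul hμ'
  have hq : ∫ z, q z 1 * (μ z * weight α t₀ z.1) ∂(during t₀ t₁).prod (arc e)
      = ∫ z, q z 1 * (weight α t₀ z.1 * μ' z) ∂(during t₀ t₁).prod (arc e) := by
    refine integral_congr_ae ?_
    filter_upwards [a] with z hz
    rw [show μ z = μ' z from h z.1 z.2 hz]
    ring
  -- both the test function and its time derivative are admissible in the face projection
  have hproj : ∫ z, P z * (weight α t₀ z.1 * μ' z) ∂(during t₀ t₁).prod (arc e)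
      = ∫ z, v z * (weight α t₀ z.1 * μ' z) ∂(during t₀ t₁).prod (arc e) := by
    have key (u : SpaceTime → ℝ) : ∫ z, u z * (weight α t₀ z.1 * μ' z) ∂(during t₀ t₁).prod (arc e)
        = ∫ z, u z * (μ z * weight α t₀ z.1) ∂(during t₀ t₁).prod (arc e) := by
      refine integral_congr_ae ?_
      filter_upwards [a] with z hz
      rw [show μ z = μ' z from h z.1 z.2 hz]
      ring
    rw [key, key, hP.2 μ hμ]
  have hprojt : ∫ z, P z * (weight α t₀ z.1 * fderiv ℝ μ' z (1, 0)) ∂(during t₀ t₁).prod (arc e)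
      = ∫ z, v z * (weight α t₀ z.1 * fderiv ℝ μ' z (1, 0)) ∂(during t₀ t₁).prod (arc e) := by
    have key (u : SpaceTime → ℝ) :
        ∫ z, u z * (weight α t₀ z.1 * fderiv ℝ μ' z (1, 0)) ∂(during t₀ t₁).prod (arc e)
        = ∫ z, u z * (dt μ z * weight α t₀ z.1) ∂(during t₀ t₁).prod (arc e) := by
      refine integral_congr_ae ?_
      filter_upwards [a] with z hz
      rw [dt_eq_of_eq_on_hull hμ' h z.1 hz]
      ring
    rw [key, key, hP.2 _ (localM_dt hμ)]
  have hsplit : ∫ z, v z * fderiv ℝ (fun z : SpaceTime => weight α t₀ z.1 * μ' z) z (1, 0)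
        ∂(during t₀ t₁).prod (arc e)
      = (∫ z, v z * (weight α t₀ z.1 * fderiv ℝ μ' z (1, 0)) ∂(during t₀ t₁).prod (arc e))
        - α * ∫ z, v z * (weight α t₀ z.1 * μ' z) ∂(during t₀ t₁).prod (arc e) := by
    have hi : Integrable (fun z => v z * (weight α t₀ z.1 * fderiv ℝ μ' z (1, 0)))
        ((during t₀ t₁).prod (arc e)) := MemLp.integrable_mul_continuous c hv
          ((continuous_weight_fst α t₀).mul (continuous_fderiv_apply hμ' _))
    rw [← integral_const_mul, ← integral_sub hi
      ((MemLp.integrable_mul_continuous c hv hh.continuous).const_mul α)]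
    refine integral_congr_ae (Eventually.of_forall fun z => ?_)
    simp only [fderiv_weight_mul_time α t₀ hμ']
    ring
  have hP1 := memLp_of_mem_localM (compactlyCarried_atTime t₁) hcard hP.1
  simp only [sub_mul]
  rw [integral_sub (MemLp.integrable_mul_continuous c1 hP1 hh.continuous)
      (MemLp.integrable_mul_continuous c1 hv1 hh.continuous),
    integral_sub (MemLp.integrable_mul_continuous c0 hPm hh.continuous)
      (MemLp.integrable_mul_continuous c0 hv0 hh.continuous),
    hq, hibp _ hh, hsplit, cellForm, hproj, hprojt]
  ring

namespace IsSlab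

variable {dom : FlowDomain} {mesh : SpatialMesh dom} {T : ℝ} {N p : ℕ} {α : ℝ}
  {τ : Finset Plane → Finset Plane → ℝ} {t₀ t₁ : ℝ} {q : SpaceTime → Plane}
  {v : SpaceTime → ℝ} {qm PVm qh PV : Finset Plane → SpaceTime → Plane}
  {lm PMm vh lh PW PM : Finset Plane → SpaceTime → ℝ}

/-- The third error equation: besides the discrete errors only the projection error of `v` on the
free surface at the two time levels enters. -/
theorem third_error (S : IsSlab mesh T N p α τ t₀ t₁ q v qm PVm qh PV lm PMm vh lh PW PM)
    {μ μ' : Finset Plane → SpaceTime → ℝ} (hμ : μ ∈ spaceM mesh p)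
    (hμ' : ∀ e ∈ mesh.surfaceEdges, ContDiff ℝ 1 (μ' e))
    (h : ∀ e ∈ mesh.surfaceEdges, ∀ t, ∀ x ∈ convexHull ℝ (e : Set Plane),
      μ e (t, x) = μ' e (t, x)) :
    (∑ K ∈ mesh.elements, ∑ e ∈ edgesOf K, pairing α t₀ ((during t₀ t₁).prod (arc e))
        (fun z => inner ℝ (PV K z - qh K z) (normal K e)
          - τ K e * (PW K z - vh K z - (PM e z - lh e z))) (μ e))
      + ∑ e ∈ mesh.surfaceEdges, cellForm α t₀ t₁ (arc e) (fun z => PM e z - lh e z)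
          (fun z => PMm e z - lm e z) (μ' e)
      = ∑ e ∈ mesh.surfaceEdges,
        ((∫ z, (PM e z - v z) * (weight α t₀ z.1 * μ' e z) ∂(atTime t₁).prod (arc e))
          - ∫ z, (PMm e z - v z) * (weight α t₀ z.1 * μ' e z) ∂(atTime t₀).prod (arc e)) := by
  have cd := compactlyCarried_during t₀ t₁
  have c1 := compactlyCarried_atTime t₁
  have hscheme : (∑ K ∈ mesh.elements, ∑ e ∈ edgesOf K,
        pairing α t₀ ((during t₀ t₁).prod (arc e))
          (fun z => inner ℝ (qh K z) (normal K e) - τ K e * (vh K z - lh e z)) (μ e))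
      + ∑ e ∈ mesh.surfaceEdges, cellForm α t₀ t₁ (arc e) (lh e) (lm e) (μ' e) = 0 := by
    have hs := S.scheme.eq_l μ hμ
    have hcell : ∀ e ∈ mesh.surfaceEdges, _ := fun e he => cellForm_arc_eq (α := α) (t₀ := t₀)
      (t₁ := t₁) (mesh.mem_edges.1 (SpatialMesh.mem_surfaceEdges.1 he).1).2 (hμ' e he) (h e he)
      (lh e) (lm e)
    rw [Finset.sum_congr rfl hcell]
    simp only [Finset.sum_sub_distrib, Finset.sum_add_distrib, Finset.sum_neg_distrib]
    simp only [pairing]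
    linarith
  have hflux : ∀ K ∈ mesh.elements, ∀ e ∈ edgesOf K, pairing α t₀ ((during t₀ t₁).prod (arc e))
        (fun z => inner ℝ (PV K z - qh K z) (normal K e)
          - τ K e * (PW K z - vh K z - (PM e z - lh e z))) (μ e)
      = (∫ z, inner ℝ (q z) (normal K e) * (μ e z * weight α t₀ z.1)
          ∂(during t₀ t₁).prod (arc e))
        - pairing α t₀ ((during t₀ t₁).prod (arc e))
          (fun z => inner ℝ (qh K z) (normal K e) - τ K e * (vh K z - lh e z)) (μ e) := by
    intro K hK e he
    have hcard := card_of_mem_edgesOf he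
    have hed := mesh.edge_of_element hK he
    have hμe := hμ.1 e hed
    have hte := isTest_of_mem_localM (α := α) (t₀ := t₀) cd hcard hμe
    have mPV := memLp_of_mem_localM cd hcard
      (inner_mem_localM e (S.element K hK).mem_V (normal K e))
    have mqh := memLp_of_mem_localM cd hcard
      (inner_mem_localM e (S.scheme.mem_V K hK) (normal K e))
    have mPW := memLp_of_mem_localM cd hcard (localM_of_mem_localW e (S.element K hK).mem_W)
    have mvh := memLp_of_mem_localM cd hcard (localM_of_mem_localW e (S.scheme.mem_W K hK))
    have mPM := memLp_of_mem_localM cd hcard (S.face e hed).1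
    have mlh := memLp_of_mem_localM cd hcard (S.scheme.mem_M.1 e hed)
    have mPX : MemLp (fun z => τ K e * (PW K z - PM e z)) 2 ((during t₀ t₁).prod (arc e)) :=
      (mPW.sub mPM).const_mul _
    have mhX : MemLp (fun z => inner ℝ (qh K z) (normal K e) - τ K e * (vh K z - lh e z)) 2
        ((during t₀ t₁).prod (arc e)) := mqh.sub ((mvh.sub mlh).const_mul _)
    have mPX' : MemLp (fun z => inner ℝ (PV K z) (normal K e) - τ K e * (PW K z - PM e z)) 2
        ((during t₀ t₁).prod (arc e)) := mPV.sub mPX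
    have hf := (S.element K hK).flux S.exact_solution hK S.nonneg S.le he hμe
    have hM : pairing α t₀ ((during t₀ t₁).prod (arc e)) (PM e) (μ e)
        = pairing α t₀ ((during t₀ t₁).prod (arc e)) v (μ e) := (S.face e hed).2 _ hμe
    have hsplit : pairing α t₀ ((during t₀ t₁).prod (arc e))
          (fun z => inner ℝ (PV K z - qh K z) (normal K e)
            - τ K e * (PW K z - vh K z - (PM e z - lh e z))) (μ e)
        = pairing α t₀ ((during t₀ t₁).prod (arc e))
            (fun z => inner ℝ (PV K z) (normal K e) - τ K e * (PW K z - PM e z)) (μ e)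
          - pairing α t₀ ((during t₀ t₁).prod (arc e))
            (fun z => inner ℝ (qh K z) (normal K e) - τ K e * (vh K z - lh e z)) (μ e) := by
      rw [← pairing_sub_left mPX' mhX hte]
      congr 1
      funext z
      rw [inner_sub_left]
      ring
    rw [hsplit, pairing_sub_left mPV mPX hte, pairing_const_mul_left,
      pairing_sub_left mPW mPM hte, hM, ← hf]
    simp only [pairing]
    ring
  have hsurf : ∀ e ∈ mesh.surfaceEdges, cellForm α t₀ t₁ (arc e) (fun z => PM e z - lh e z)
        (fun z => PMm e z - lm e z) (μ' e)
      = ((∫ z, (PM e z - v z) * (weight α t₀ z.1 * μ' e z) ∂(atTime t₁).prod (arc e))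
          - ∫ z, (PMm e z - v z) * (weight α t₀ z.1 * μ' e z) ∂(atTime t₀).prod (arc e))
        - (∫ z, q z 1 * (μ e z * weight α t₀ z.1) ∂(during t₀ t₁).prod (arc e))
        - cellForm α t₀ t₁ (arc e) (lh e) (lm e) (μ' e) := by
    intro e he
    have hed := (SpatialMesh.mem_surfaceEdges.1 he).1
    have hcard := (mesh.mem_edges.1 hed).2
    have hlh := S.scheme.mem_M.1 e hed
    rw [cellForm_sub (compactlyCarried_arc hcard) (hμ' e he)
      (memLp_of_mem_localM cd hcard (S.face e hed).1) (memLp_of_mem_localM cd hcard hlh)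
      (memLp_of_mem_localM c1 hcard (S.face e hed).1) (memLp_of_mem_localM c1 hcard hlh)
      (S.memLp_PMm e he) (S.memLp_lm e he),
      ← surface_projection_error S.exact_solution S.nonneg S.lt S.le he (S.face e hed)
        (S.memLp_PMm e he) (hμ.1 e hed) (hμ' e he) (h e he)]
    ring
  rw [Finset.sum_congr rfl fun K hK => Finset.sum_congr rfl (hflux K hK),
    Finset.sum_congr rfl hsurf]
  simp only [Finset.sum_sub_distrib] at hscheme ⊢
  rw [S.exact_solution.sum_flux S.nonneg S.le hμ (weight α t₀)]
  linarith

/-- The energy inequality: the errors themselves are used as test functions, and the stabilization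
contributes with a favourable sign. -/
theorem energy (S : IsSlab mesh T N p α τ t₀ t₁ q v qm PVm qh PV lm PMm vh lh PW PM)
    (hτ : ∀ K ∈ mesh.elements, ∀ e ∈ edgesOf K, 0 ≤ τ K e) {g : Finset Plane → SpaceTime → ℝ}
    (hg : ∀ e ∈ mesh.surfaceEdges, ContDiff ℝ 1 (g e))
    (hgM : ∀ e ∈ mesh.surfaceEdges, ∀ t, ∀ x ∈ convexHull ℝ (e : Set Plane),
      PM e (t, x) - lh e (t, x) = g e (t, x)) :
    (∑ K ∈ mesh.elements, ∑ i, cellForm α t₀ t₁ (area K) (fun z => PV K z i - qh K z i)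
        (fun z => PVm K z i - qm K z i) (fun z => PV K z i - qh K z i))
      + ∑ e ∈ mesh.surfaceEdges, cellForm α t₀ t₁ (arc e) (g e) (fun z => PMm e z - lm e z) (g e)
      ≤ (∑ K ∈ mesh.elements, ∑ i, cellForm α t₀ t₁ (area K) (fun z => PV K z i - q z i)
          (fun z => PVm K z i - q z i) (fun z => PV K z i - qh K z i))
        + ∑ e ∈ mesh.surfaceEdges,
          ((∫ z, (PM e z - v z) * (weight α t₀ z.1 * g e z) ∂(atTime t₁).prod (arc e))
            - ∫ z, (PMm e z - v z) * (weight α t₀ z.1 * g e z) ∂(atTime t₀).prod (arc e)) := by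
  have cd := compactlyCarried_during t₀ t₁
  have hE : (fun K z => PV K z - qh K z) ∈ spaceV mesh p := fun K hK =>
    localV_sub (S.element K hK).mem_V (S.scheme.mem_V K hK)
  have hW : (fun K z => PW K z - vh K z) ∈ spaceW mesh p := fun K hK =>
    (localW p).sub_mem (S.element K hK).mem_W (S.scheme.mem_W K hK)
  have hM : (fun e z => PM e z - lh e z) ∈ spaceM mesh p :=
    ⟨fun e he => localM_sub (S.mem_M.1 e he) (S.scheme.mem_M.1 e he), fun e he hL t x hx => by
      simp only [S.mem_M.2 e he hL t x hx, S.scheme.mem_M.2 e he hL t x hx]⟩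
  have q1 := S.first_error hE
  have q2 := S.second_error hW
  have q3 := S.third_error hM hg hgM
  have hstab : 0 ≤ ∑ K ∈ mesh.elements, ∑ e ∈ edgesOf K,
      (pairing α t₀ ((during t₀ t₁).prod (arc e))
          (fun z => τ K e * (PW K z - vh K z - (PM e z - lh e z))) (fun z => PW K z - vh K z)
        - pairing α t₀ ((during t₀ t₁).prod (arc e))
            (fun z => PM e z - lh e z) (fun z => inner ℝ (PV K z - qh K z) (normal K e))
        + pairing α t₀ ((during t₀ t₁).prod (arc e))
          (fun z => inner ℝ (PV K z - qh K z) (normal K e)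
            - τ K e * (PW K z - vh K z - (PM e z - lh e z))) (fun z => PM e z - lh e z)) := by
    refine Finset.sum_nonneg fun K hK => Finset.sum_nonneg fun e he => ?_
    have hcard := card_of_mem_edgesOf he
    have hed := mesh.edge_of_element hK he
    have lM := hM.1 e hed
    have lW := localM_of_mem_localW e (hW K hK)
    have mX := memLp_of_mem_localM cd hcard (localM_sub lW lM)
    rw [pairing_sub_left (memLp_of_mem_localM cd hcard (inner_mem_localM e (hE K hK) _))
      (mX.const_mul _) (isTest_of_mem_localM cd hcard lM),
      pairing_comm _ _ _ (fun z => PM e z - lh e z), pairing_const_mul_left,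
      pairing_const_mul_left, pairing_comm _ _ _ _ (fun z => PW K z - vh K z),
      pairing_comm _ _ _ (fun z => PW K z - vh K z - (PM e z - lh e z))
        (fun z => PM e z - lh e z)]
    have hsq := pairing_sub_left (α := α) (t₀ := t₀) (memLp_of_mem_localM cd hcard lW)
      (memLp_of_mem_localM cd hcard lM) (isTest_of_mem_localM cd hcard (localM_sub lW lM))
    have hpos : 0 ≤ pairing α t₀ ((during t₀ t₁).prod (arc e))
        (fun z => PW K z - vh K z - (PM e z - lh e z))
        (fun z => PW K z - vh K z - (PM e z - lh e z)) := by
      refine integral_nonneg fun z => ?_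
      have := mul_nonneg (mul_self_nonneg (PW K z - vh K z - (PM e z - lh e z)))
        (weight_pos α t₀ z.1).le
      simp only [Pi.zero_apply]
      linarith
    have := mul_nonneg (hτ K hK e he) hpos
    rw [hsq] at this
    linarith
  have hcong : ∀ e ∈ mesh.surfaceEdges, cellForm α t₀ t₁ (arc e) (g e)
      (fun z => PMm e z - lm e z) (g e) = cellForm α t₀ t₁ (arc e) (fun z => PM e z - lh e z)
      (fun z => PMm e z - lm e z) (g e) := by
    intro e he
    have hcard := (mesh.mem_edges.1 (SpatialMesh.mem_surfaceEdges.1 he).1).2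
    have a := ae_eq_of_eq_on_hull (u := fun z => PM e z - lh e z) (w := g e) cd hcard
      (hgM e he)
    have a1 := ae_eq_of_eq_on_hull (u := fun z => PM e z - lh e z) (w := g e)
      (compactlyCarried_atTime t₁) hcard (hgM e he)
    have swap {σ : Measure SpaceTime} (hσ : (fun z => PM e z - lh e z) =ᵐ[σ] g e)
        (k : SpaceTime → ℝ) : ∫ z, g e z * k z ∂σ = ∫ z, (PM e z - lh e z) * k z ∂σ := by
      refine integral_congr_ae ?_
      filter_upwards [hσ] with z hz
      rw [← hz]
    simp only [cellForm]
    rw [swap a, swap a, swap a1]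
  rw [Finset.sum_congr rfl hcong]
  simp only [Finset.sum_sub_distrib, Finset.sum_add_distrib] at q1 q2 q3 hstab ⊢
  simp only [PiLp.sub_apply] at q1
  linarith

end IsSlab

/-! ### The estimate on a slab -/

theorem integrable_weighted_sq {σ : Measure SpaceTime} (hσ : CompactlyCarried σ) {f : ℝ → ℝ}
    (hf : Continuous f) {u : SpaceTime → ℝ} (hu : MemLp u 2 σ) :
    Integrable (fun z => f z.1 * u z ^ 2) σ := by
  have h1 : MemLp (fun z => u z * f z.1) 2 σ :=
    MemLp.mul' (hσ.memLp (hf.comp continuous_fst) ⊤) hu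
  refine (h1.integrable_mul hu).congr (Eventually.of_forall fun z => ?_)
  simp only [Pi.mul_apply]
  ring

theorem sqNormElements_eq {dom : FlowDomain} {mesh : SpatialMesh dom} {θ : Measure ℝ}
    (hθ : CompactlyCarried θ) {f : ℝ → ℝ} (hf : Continuous f)
    {u : Finset Plane → SpaceTime → Plane}
    (hu : ∀ K ∈ mesh.elements, ∀ i, MemLp (fun z => u K z i) 2 (θ.prod (area K))) :
    sqNormElements mesh θ f u
      = ∑ K ∈ mesh.elements, ∑ i, ∫ z, f z.1 * u K z i ^ 2 ∂(θ.prod (area K)) := by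
  refine Finset.sum_congr rfl fun K hK => ?_
  have hi (i : Fin 2) := integrable_weighted_sq (hθ.prod (compactlyCarried_area K)) hf (hu K hK i)
  rw [Fin.sum_univ_two, ← integral_add (hi 0) (hi 1)]
  congr 1; funext z
  rw [norm_sq_plane]
  ring

theorem sqNormElements_neg {dom : FlowDomain} {mesh : SpatialMesh dom} {θ : Measure ℝ} {f : ℝ → ℝ}
    (u w : Finset Plane → SpaceTime → Plane) :
    sqNormElements mesh θ f (fun K z => u K z - w K z)
      = sqNormElements mesh θ f (fun K z => w K z - u K z) := by
  simp only [sqNormElements, norm_sub_rev]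

/-- The energy inequality together with coercivity and absorption; on the free surface a quarter of
`α` is left over. -/
theorem exists_slab_estimate (p : ℕ) {α T : ℝ} (hα : 0 < α) : ∃ C : ℝ, 0 < C ∧
    ∀ {dom : FlowDomain} {mesh : SpatialMesh dom} {N : ℕ}
      {τ : Finset Plane → Finset Plane → ℝ} {t₀ t₁ : ℝ} {q : SpaceTime → Plane}
      {v : SpaceTime → ℝ} {qm PVm qh PV : Finset Plane → SpaceTime → Plane}
      {lm PMm vh lh PW PM : Finset Plane → SpaceTime → ℝ},
      IsSlab mesh T N p α τ t₀ t₁ q v qm PVm qh PV lm PMm vh lh PW PM →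
      (∀ K ∈ mesh.elements, ∀ e ∈ edgesOf K, 0 ≤ τ K e) →
      α / 2 * sqNormElements mesh (during t₀ t₁) (weight α t₀) (fun K z => PV K z - qh K z)
        + α / 2 * sqNormSurface mesh (during t₀ t₁) (weight α t₀) (fun e z => PM e z - lh e z)
        + Real.exp (-(α * (t₁ - t₀))) * sqNormElements mesh (atTime t₁) (fun _ => 1)
          (fun K z => PV K z - qh K z)
        + Real.exp (-(α * (t₁ - t₀))) * sqNormSurface mesh (atTime t₁) (fun _ => 1)
          (fun e z => PM e z - lh e z)
      ≤ sqNormElements mesh (atTime t₀) (fun _ => 1) (fun K z => PVm K z - qm K z)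
        + sqNormSurface mesh (atTime t₀) (fun _ => 1) (fun e z => PMm e z - lm e z)
        + C * ((t₁ - t₀) ^ 2)⁻¹ * sqNormElements mesh (during t₀ t₁) (weight α t₀)
          (fun K z => PV K z - q z)
        + C * sqNormElements mesh (during t₀ t₁) (weight α t₀) (fun K z => PV K z - q z)
        + C * (t₁ - t₀)⁻¹ * sqNormElements mesh (atTime t₁) (weight α t₀)
          (fun K z => PV K z - q z)
        + C * (t₁ - t₀)⁻¹ * sqNormElements mesh (atTime t₀) (weight α t₀)
          (fun K z => PVm K z - q z)
        + C * (t₁ - t₀)⁻¹ * sqNormSurface mesh (atTime t₁) (weight α t₀)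
          (fun e z => PM e z - v z)
        + C * (t₁ - t₀)⁻¹ * sqNormSurface mesh (atTime t₀) (weight α t₀)
          (fun e z => PMm e z - v z) := by
  obtain ⟨C, hC, hbound⟩ := exists_cellForm_bounds p (T := T) hα
  refine ⟨C, hC, ?_⟩
  intro dom mesh N τ t₀ t₁ q v qm PVm qh PV lm PMm vh lh PW PM S hτ
  have hlt := S.lt
  have hle : t₁ - t₀ ≤ T := by linarith [S.nonneg, S.le]
  have cd := compactlyCarried_during t₀ t₁
  have c1 := compactlyCarried_atTime t₁
  have c0 := compactlyCarried_atTime t₀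
  have hE : ∀ K ∈ mesh.elements, (fun z => PV K z - qh K z) ∈ localV p := fun K hK =>
    localV_sub (S.element K hK).mem_V (S.scheme.mem_V K hK)
  have hcard : ∀ e ∈ mesh.surfaceEdges, e.card = 2 := fun e he =>
    (mesh.mem_edges.1 (SpatialMesh.mem_surfaceEdges.1 he).1).2
  have hMe : ∀ e ∈ mesh.surfaceEdges, (fun z => PM e z - lh e z) ∈ localM p e := fun e he =>
    have hed := (SpatialMesh.mem_surfaceEdges.1 he).1
    localM_sub (S.mem_M.1 e hed) (S.scheme.mem_M.1 e hed)
  have hext : ∀ e, ∃ g : SpaceTime → ℝ, e ∈ mesh.surfaceEdges → ContDiff ℝ 1 g ∧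
      ∀ t, ∀ x ∈ convexHull ℝ (e : Set Plane), PM e (t, x) - lh e (t, x) = g (t, x) := by
    intro e
    by_cases he : e ∈ mesh.surfaceEdges
    · obtain ⟨g, hg, h⟩ := exists_smooth_extension (hcard e he) (hMe e he)
      exact ⟨g, fun _ => ⟨hg.of_le (by norm_num), h⟩⟩
    · exact ⟨0, fun h => absurd h he⟩
  choose g hg using hext
  have hen := S.energy hτ (fun e he => (hg e he).1) (fun e he => (hg e he).2)
  -- coercivity and absorption on the elements
  have hpolyK (K) (hK : K ∈ mesh.elements) (i : Fin 2) : ∀ᵐ x ∂(area K),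
      IsTimePolynomial p (fun t => PV K (t, x) i - qh K (t, x) i) :=
    Eventually.of_forall fun x => isTimePolynomial_of_mem_localW (hE K hK i) x
  have hsm (K) (hK : K ∈ mesh.elements) (i : Fin 2) :
      ContDiff ℝ 1 fun z => PV K z i - qh K z i :=
    (contDiff_of_mem_localW (hE K hK i)).of_le (by norm_num)
  have mEm (K) (hK : K ∈ mesh.elements) (i : Fin 2) :
      MemLp (fun z => PVm K z i - qm K z i) 2 ((atTime t₀).prod (area K)) :=
    (S.memLp_PVm K hK i).sub (S.memLp_qm K hK i)
  have mδ (K) (hK : K ∈ mesh.elements) (i : Fin 2) :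
      MemLp (fun z => PV K z i - q z i) 2 ((during t₀ t₁).prod (area K)) :=
    (memLp_component (cd.prod (compactlyCarried_area K)) (S.element K hK).mem_V i).sub
      ((S.exact_solution.memLp_element hK S.nonneg S.le).2 i)
  have mδ1 (K) (hK : K ∈ mesh.elements) (i : Fin 2) :
      MemLp (fun z => PV K z i - q z i) 2 ((atTime t₁).prod (area K)) :=
    (memLp_component (c1.prod (compactlyCarried_area K)) (S.element K hK).mem_V i).sub
      (S.memLp_q_levels hK i).2
  have mδm (K) (hK : K ∈ mesh.elements) (i : Fin 2) :
      MemLp (fun z => PVm K z i - q z i) 2 ((atTime t₀).prod (area K)) :=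
    (S.memLp_PVm K hK i).sub (S.memLp_q_levels hK i).1
  have ge1 := Finset.sum_le_sum fun K hK => Finset.sum_le_sum fun i (_ : i ∈ Finset.univ) =>
    cellForm_self_ge (α := α) (compactlyCarried_area K) hlt.le (hsm K hK i) (mEm K hK i)
  have le1 := Finset.sum_le_sum fun K hK => Finset.sum_le_sum fun i (_ : i ∈ Finset.univ) =>
    (hbound t₀ t₁ hlt hle (area K) (compactlyCarried_area K) _ (hsm K hK i) (hpolyK K hK i)
      _ _ (mδ1 K hK i) (mδm K hK i)).2 (mδ K hK i)
  -- the same on the free surface, with the smooth representatives `g` of the face errors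
  have ge2 := Finset.sum_le_sum fun e (he : e ∈ mesh.surfaceEdges) =>
    cellForm_self_ge (α := α) (Gm := fun z => PMm e z - lm e z)
      (compactlyCarried_arc (hcard e he)) hlt.le (hg e he).1
      ((S.memLp_PMm e he).sub (S.memLp_lm e he))
  have hpolye (e) (he : e ∈ mesh.surfaceEdges) : ∀ᵐ x ∂(arc e),
      IsTimePolynomial p (fun t => g e (t, x)) := by
    have hm : ∀ᵐ x ∂(arc e), x ∈ convexHull ℝ (e : Set Plane) :=
      ae_restrict_mem (measurableSet_hull e)
    filter_upwards [hm] with x hx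
    have h := isTimePolynomial_of_mem_localM (hcard e he) (hMe e he) hx
    simpa only [(hg e he).2 _ x hx] using h
  have mη1 (e) (he : e ∈ mesh.surfaceEdges) :
      MemLp (fun z => PM e z - v z) 2 ((atTime t₁).prod (arc e)) :=
    (memLp_of_mem_localM c1 (hcard e he)
      (S.mem_M.1 e (SpatialMesh.mem_surfaceEdges.1 he).1)).sub
      (S.exact_solution.surface S.nonneg hlt S.le he).2.1
  have mηm (e) (he : e ∈ mesh.surfaceEdges) :
      MemLp (fun z => PMm e z - v z) 2 ((atTime t₀).prod (arc e)) :=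
    (S.memLp_PMm e he).sub (S.exact_solution.surface S.nonneg hlt S.le he).1
  have le2 := Finset.sum_le_sum fun e (he : e ∈ mesh.surfaceEdges) =>
    (hbound t₀ t₁ hlt hle (arc e) (compactlyCarried_arc (hcard e he)) _ (hg e he).1
      (hpolye e he) _ _ (mη1 e he) (mηm e he)).1
  have hsurf (θ : Measure ℝ) (hθ : CompactlyCarried θ) (f : ℝ → ℝ) :
      sqNormSurface mesh θ f (fun e z => PM e z - lh e z)
        = ∑ e ∈ mesh.surfaceEdges, ∫ z, f z.1 * g e z ^ 2 ∂(θ.prod (arc e)) := by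
    refine Finset.sum_congr rfl fun e he => integral_congr_ae ?_
    filter_upwards [arc_ae_mem_hull hθ (hcard e he)] with z hz
    rw [show PM e z - lh e z = g e z from (hg e he).2 z.1 z.2 hz]
  have hcw := continuous_weight α t₀
  have hone : Continuous fun _ : ℝ => (1 : ℝ) := continuous_const
  rw [sqNormElements_eq (u := fun K z => PV K z - qh K z) cd hcw fun K hK i =>
      (cd.prod (compactlyCarried_area K)).memLp (hsm K hK i).continuous 2,
    sqNormElements_eq (u := fun K z => PV K z - qh K z) c1 hone fun K hK i =>
      (c1.prod (compactlyCarried_area K)).memLp (hsm K hK i).continuous 2,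
    sqNormElements_eq (u := fun K z => PVm K z - qm K z) c0 hone mEm,
    sqNormElements_eq (u := fun K z => PV K z - q z) cd hcw mδ,
    sqNormElements_eq (u := fun K z => PV K z - q z) c1 hcw mδ1,
    sqNormElements_eq (u := fun K z => PVm K z - q z) c0 hcw mδm, hsurf _ cd, hsurf _ c1]
  simp only [sqNormSurface, PiLp.sub_apply]
  have hpos : 0 ≤ α / 4 * ∑ e ∈ mesh.surfaceEdges, ∫ z, weight α t₀ z.1 * g e z ^ 2
      ∂((during t₀ t₁).prod (arc e)) :=
    mul_nonneg (by positivity) (Finset.sum_nonneg fun e _ =>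
      integral_nonneg fun z => mul_nonneg (weight_pos _ _ _).le (sq_nonneg _))
  simp only [Finset.sum_sub_distrib, Finset.sum_add_distrib, ← Finset.mul_sum]
    at ge1 le1 ge2 le2 hen
  linarith

end FreeSurfaceHDG

end

open FreeSurfaceHDG in
theorem mainTheorem8 (p : ℕ) (α T : ℝ) (hα : 0 < α) (hT : 0 < T) :
    ∃ C : ℝ, 0 < C ∧
      ∀ (dom : FlowDomain) (mesh : SpatialMesh dom)
        (τ : Finset Plane → Finset Plane → ℝ)
        (_hτ : ∀ K ∈ mesh.elements, ∀ e ∈ edgesOf K, 0 < τ K e)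
        (N : ℕ) (_hN : 0 < N) (Δt : ℝ) (_hΔt : Δt = T / N)
        (t : ℕ → ℝ) (_ht : ∀ n, t n = n * Δt)
        (q : SpaceTime → Plane) (v : SpaceTime → ℝ)
        (_hqv : IsExactSolution mesh T N q v)
        (qh : ℕ → Finset Plane → SpaceTime → Plane)
        (vh lh : ℕ → Finset Plane → SpaceTime → ℝ)
        (_hh : ∀ n < N, IsHDGSolution mesh p α τ (t n) (t (n + 1))
          (previous (fun _ => q) qh n) (previous (fun _ => v) lh n) (qh n) (vh n) (lh n))
        (PV : ℕ → Finset Plane → SpaceTime → Plane)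
        (PW PM : ℕ → Finset Plane → SpaceTime → ℝ)
        (_hP : ∀ n < N, ∀ K ∈ mesh.elements,
          IsElementProjection p α τ (t n) (t (n + 1)) K q v (PV n K) (PW n K))
        (_hPM : ∀ n < N, ∀ e ∈ mesh.edges,
          IsFaceProjection p α (t n) (t (n + 1)) e v (PM n e))
        (n : ℕ) (_hn : n < N),
        α / 2 * sqNormElements mesh (during (t n) (t (n + 1))) (weight α (t n))
            (fun K z => PV n K z - qh n K z)
          + α / 2 * sqNormSurface mesh (during (t n) (t (n + 1))) (weight α (t n))
            (fun e z => PM n e z - lh n e z)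
          + Real.exp (-(α * Δt)) * sqNormElements mesh (atTime (t (n + 1))) (fun _ => 1)
            (fun K z => PV n K z - qh n K z)
          + Real.exp (-(α * Δt)) * sqNormSurface mesh (atTime (t (n + 1))) (fun _ => 1)
            (fun e z => PM n e z - lh n e z)
        ≤ sqNormElements mesh (atTime (t n)) (fun _ => 1)
            (fun K z => previous (fun _ => q) PV n K z - previous (fun _ => q) qh n K z)
          + sqNormSurface mesh (atTime (t n)) (fun _ => 1)
            (fun e z => previous (fun _ => v) PM n e z - previous (fun _ => v) lh n e z)
          + C * (Δt ^ 2)⁻¹ * sqNormElements mesh (during (t n) (t (n + 1))) (weight α (t n))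
            (fun K z => q z - PV n K z)
          + C * sqNormElements mesh (during (t n) (t (n + 1))) (weight α (t n))
            (fun K z => PV n K z - q z)
          + C * Δt⁻¹ * sqNormElements mesh (atTime (t (n + 1))) (weight α (t n))
            (fun K z => PV n K z - q z)
          + C * Δt⁻¹ * sqNormElements mesh (atTime (t n)) (weight α (t n))
            (fun K z => previous (fun _ => q) PV n K z - q z)
          + C * Δt⁻¹ * sqNormSurface mesh (atTime (t (n + 1))) (weight α (t n))
            (fun e z => PM n e z - v z)
          + C * Δt⁻¹ * sqNormSurface mesh (atTime (t n)) (weight α (t n))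
            (fun e z => previous (fun _ => v) PM n e z - v z) := by
  obtain ⟨C, hC, hest⟩ := exists_slab_estimate p (T := T) hα
  refine ⟨C, hC, ?_⟩
  intro dom mesh τ hτ N hN Δt hΔt t ht q v hqv qh vh lh hh PV PW PM hP hPM n hn
  have hN' : (0 : ℝ) < N := Nat.cast_pos.2 hN
  have hΔ : 0 < Δt := hΔt ▸ div_pos hT hN'
  have hlevel : ∀ k, t k = k * (T / N) := fun k => hΔt ▸ ht k
  have hstep : t (n + 1) - t n = Δt := by
    rw [ht, ht]; push_cast; ring
  have hlt : t n < t (n + 1) := by linarith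
  have hnonneg : 0 ≤ t n := by
    rw [ht]; positivity
  have hle : t (n + 1) ≤ T := by
    have h1 : ((n + 1 : ℕ) : ℝ) ≤ N := Nat.cast_le.2 hn
    have h2 : (N : ℝ) * Δt = T := by rw [hΔt]; field_simp
    rw [ht, ← h2]
    exact mul_le_mul_of_nonneg_right h1 hΔ.le
  have c0 := compactlyCarried_atTime (t n)
  have hq0 : ∀ K ∈ mesh.elements, ∀ i, MemLp (fun z => q z i) 2 ((atTime (t n)).prod (area K)) :=
    fun K hK i => by rw [hlevel]; exact hqv.memLp_level hK hn.le i
  have hV : ∀ r : ℕ → Finset Plane → SpaceTime → Plane,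
      (∀ k < N, ∀ K ∈ mesh.elements, r k K ∈ localV p) → ∀ K ∈ mesh.elements, ∀ i,
      MemLp (fun z => previous (fun _ => q) r n K z i) 2 ((atTime (t n)).prod (area K)) := by
    intro r hr K hK i
    cases n with
    | zero => exact hq0 K hK i
    | succ k =>
      exact memLp_component (r := r k K) (c0.prod (compactlyCarried_area K))
        (hr k (Nat.lt_of_succ_lt hn) K hK) i
  have hM : ∀ μ : ℕ → Finset Plane → SpaceTime → ℝ,
      (∀ k < N, ∀ e ∈ mesh.edges, μ k e ∈ localM p e) → ∀ e ∈ mesh.surfaceEdges,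
      MemLp (previous (fun _ => v) μ n e) 2 ((atTime (t n)).prod (arc e)) := by
    intro μ hμ e he
    have hed := (SpatialMesh.mem_surfaceEdges.1 he).1
    cases n with
    | zero => exact (hqv.surface hnonneg hlt hle he).1
    | succ k =>
      exact memLp_of_mem_localM c0 (mesh.mem_edges.1 hed).2
        (hμ k (Nat.lt_of_succ_lt hn) e hed)
  have S : IsSlab mesh T N p α τ (t n) (t (n + 1)) q v (previous (fun _ => q) qh n)
      (previous (fun _ => q) PV n) (qh n) (PV n) (previous (fun _ => v) lh n)
      (previous (fun _ => v) PM n) (vh n) (lh n) (PW n) (periodize dom (PM n)) :=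
    { exact_solution := hqv
      nonneg := hnonneg
      lt := hlt
      le := hle
      levels := ⟨n, n + 1, hn.le, hn, hlevel n, hlevel (n + 1)⟩
      scheme := hh n hn
      element := hP n hn
      face := fun e he => hqv.isFaceProjection_periodize hnonneg hle (hPM n hn) he
      mem_M := periodize_mem_spaceM fun e he => (hPM n hn e he).1
      memLp_qm := hV qh fun k hk => (hh k hk).mem_V
      memLp_PVm := hV PV fun k hk K hK => (hP k hk K hK).mem_V
      memLp_lm := hM lh fun k hk => (hh k hk).mem_M.1
      memLp_PMm := hM PM fun k hk e he => (hPM k hk e he).1 }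
  have key := hest S fun K hK e he => (hτ K hK e he).le
  -- periodizing changes the face projections on the right boundary only, not on the free surface
  have hper : ∀ (θ : Measure ℝ) (f : ℝ → ℝ) (u : Finset Plane → SpaceTime → ℝ),
      sqNormSurface mesh θ f (fun e z => periodize dom (PM n) e z - u e z)
        = sqNormSurface mesh θ f (fun e z => PM n e z - u e z) := fun θ f u =>
    Finset.sum_congr rfl fun e he => by
      simp only [periodize_of_not_right (SpatialMesh.not_right_of_surface he)]
  rw [hper _ _ (lh n), hper _ _ (lh n), hper _ _ (fun _ => v), hstep] at key
  rw [sqNormElements_neg (fun _ => q) (PV n)]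
  exact key
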